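/- **Setting.** A six-vertex configuration on $\mathbb{Z}^2$ or on the torus $\mathbb{T}_n=(\mathbb{Z}/n)^2$ is an orientation of the nearest-neighbour edges such that every vertex has two incoming and two outgoing arrows. Listing the arrows on the (west, east, south, north) edges of a vertex, the six vertex types $1,\dots,6$ are $(\to,\to,\uparrow,\uparrow)$, $(\leftarrow,\leftarrow,\downarrow,\downarrow)$, $(\to,\to,\downarrow,\downarrow)$, $(\leftarrow,\leftarrow,\uparrow,\uparrow)$, $(\to,\leftarrow,\downarrow,\uparrow)$, $(\leftarrow,\to,\uparrow,\downarrow)$; $\tau_v(\sigma)$ denotes the type of the vertex $v$ in $\sigma$. Let $\alpha,\beta,\gamma>0$ with $\gamma^2-\alpha\beta>0$, and give the types $1,\dots,6$ the free-fermion weights $1,\ \gamma^2-\alpha\beta,\ \beta,\ \alpha,\ \gamma,\ \gamma$. Let $\mathbb{P}_n$ be the probability measure on configurations on $\mathbb{T}_n$ (viewed as $(n,n)$-periodic configurations on $\mathbb{Z}^2$) that gives each configuration a probability proportional to the product of its vertex weights. For $\mathbf{w}=(w_1,w_2,\tilde w_1,\tilde w_2)\in\mathbb{C}^4$ put $\Delta(w_1,w_2)=(1+\alpha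 w_1)(1+\beta w_2)-\gamma^2w_1w_2$ and $$\begin{aligned} f_1(\mathbf w)&=(1+\beta w_2)(1+\alpha\tilde w_1)-\gamma^2w_1\tilde w_2,\\ f_2(\mathbf w)&=(\gamma^2-\alpha\beta)\big(\gamma^2\tilde w_1w_2-(1+\alpha\tilde w_1)(1+\beta w_2)\big)w_1\tilde w_2,\\ f_3(\mathbf w)&=\beta\tilde w_2\big((1+\beta w_2)(1+\alpha\tilde w_1)-\gamma^2w_1w_2\big),\\ f_4(\mathbf w)&=\alpha w_1\big((1+\beta w_2)(1+\alpha\tilde w_1)-\gamma^2\tilde w_1\tilde w_2\big),\\ f_5(\mathbf w)&=\gamma^2\tilde w_2(1+\beta w_2)(w_1-\tilde w_1),\\ f_6(\mathbf w)&=\gamma^2w_1(1+\alpha\tilde w_1)(\tilde w_2-w_2). \end{aligned}$$ **Theorem 1.2.** There is a unique probability measure $\mathbb{P}$ on six-vertex configurations on $\mathbb{Z}^2$ such that, for every finite set $S\subset\mathbb{Z}^2$ and all types $(t_u)_{u\in S}$, $$\mathbb{P}(\tau_u=t_u\text{ for all }u\in S)=\lim_{n\to\infty}\mathbb{P}_n(\tau_u=t_u\text{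 for all }u\in S).$$ For every $v\in\mathbb{Z}^2$ and every $t\in\{1,\dots,6\}$ the integral below converges absolutely, and $$\mathbb{P}(\tau_v=t)=\int_{(S^1)^4}\frac{\mathrm dw_1}{2\pi i\,w_1}\frac{\mathrm dw_2}{2\pi i\,w_2}\frac{\mathrm d\tilde w_1}{2\pi i\,\tilde w_1}\frac{\mathrm d\tilde w_2}{2\pi i\,\tilde w_2}\;\frac{f_t(\mathbf w)}{\Delta(w_1,w_2)\,\Delta(\tilde w_1,\tilde w_2)}.$$ Moreover $\sum_{t=1}^6f_t(\mathbf w)=\Delta(w_1,w_2)\,\Delta(\tilde w_1,\tilde w_2)$ for all $\mathbf w\in\mathbb{C}^4$. -/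

import Mathlib

open MeasureTheory Filter Topology

namespace SixVertex

/-- The six vertex types, listed in the order `1, …, 6`. -/
inductive VertexType
  | a1 | a2 | b1 | b2 | c1 | c2
  deriving DecidableEq

instance : Fintype VertexType :=
  ⟨{.a1, .a2, .b1, .b2, .c1, .c2}, fun t => by cases t <;> decide⟩

/-- An orientation of the edges of the square lattice with coordinates in `R`
(`R = ℤ` is the lattice `ℤ²`, `R = ZMod n` is the `n × n` torus).
`σ.1 v = true` means that the horizontal edge from `v` to `v + (1, 0)` points right, and
`σ.2 v = true` means that the vertical edge from `v` to `v + (0, 1)` points up. -/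
abbrev Orientation (R : Type*) := (R × R → Bool) × (R × R → Bool)

section Lattice

variable {R : Type*} [CommRing R]

/-- The arrow on the edge to the west of `v`; `true` is right. -/
def west (σ : Orientation R) (v : R × R) : Bool := σ.1 (v - (1, 0))

/-- The arrow on the edge to the east of `v`; `true` is right. -/
def east (σ : Orientation R) (v : R × R) : Bool := σ.1 v

/-- The arrow on the edge to the south of `v`; `true` is up. -/
def south (σ : Orientation R) (v : R × R) : Bool := σ.2 (v - (0, 1))

/-- The arrow on the edge to the north of `v`; `true` is up. -/
def north (σ : Orientation R) (v : R × R) : Bool := σ.2 v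

/-- The number of arrows pointing into `v`. -/
def indegree (σ : Orientation R) (v : R × R) : ℕ :=
  (west σ v).toNat + (!east σ v).toNat + (south σ v).toNat + (!north σ v).toNat

/-- The number of arrows pointing out of `v`. -/
def outdegree (σ : Orientation R) (v : R × R) : ℕ :=
  (!west σ v).toNat + (east σ v).toNat + (!south σ v).toNat + (north σ v).toNat

/-- The ice rule: two arrows in and two arrows out at every vertex. -/
def IceRule (σ : Orientation R) : Prop :=
  ∀ v, indegree σ v = 2 ∧ outdegree σ v = 2

end Lattice

/-- Six-vertex configurations on the square lattice with coordinates in `R`. On `R = ℤ` the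
`σ`-algebra is the one generated by the arrows on the individual edges. -/
abbrev Config (R : Type*) [CommRing R] := {σ : Orientation R // IceRule σ}

/-- The arrows (west, east, south, north) at a vertex of a given type; `true` is right,
respectively up. -/
def arrows : VertexType → Bool × Bool × Bool × Bool
  | .a1 => (true, true, true, true)
  | .a2 => (false, false, false, false)
  | .b1 => (true, true, false, false)
  | .b2 => (false, false, true, true)
  | .c1 => (true, false, false, true)
  | .c2 => (false, true, true, false)

theorem existsUnique_type {R : Type*} [CommRing R] (σ : Config R) (v : R × R) :
    ∃! t : VertexType, (west σ.1 v, east σ.1 v, south σ.1 v, north σ.1 v) = arrows t := by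
  have h := σ.2 v
  unfold indegree outdegree at h
  generalize west σ.1 v = w at h ⊢
  generalize east σ.1 v = e at h ⊢
  generalize south σ.1 v = s at h ⊢
  generalize north σ.1 v = m at h ⊢
  revert h
  unfold ExistsUnique
  revert w e s m
  decide

/-- The local type `τ_v(σ)` of the vertex `v` in the six-vertex configuration `σ`. -/
noncomputable def vertexType {R : Type*} [CommRing R] (σ : Config R) (v : R × R) : VertexType :=
  (existsUnique_type σ v).choose

theorem vertexType_eq_iff {R : Type*} [CommRing R] (σ : Config R) (v : R × R) (t : VertexType) :
    vertexType σ v = t ↔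
      (west σ.1 v, east σ.1 v, south σ.1 v, north σ.1 v) = arrows t := by
  constructor
  · rintro rfl
    exact (existsUnique_type σ v).choose_spec.1
  · intro h
    exact ((existsUnique_type σ v).choose_spec.2 t h).symm

/-- The `(n, n)`-periodic configuration on `ℤ²` given by a configuration on the torus. -/
def periodize {n : ℕ} (σ : Config (ZMod n)) : Config ℤ :=
  ⟨(fun v => σ.1.1 ((v.1 : ZMod n), (v.2 : ZMod n)),
    fun v => σ.1.2 ((v.1 : ZMod n), (v.2 : ZMod n))), by
    intro v
    have h := σ.2 ((v.1 : ZMod n), (v.2 : ZMod n))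
    simpa [indegree, outdegree, west, east, south, north] using h⟩

section Torus

variable {n : ℕ} [NeZero n]

noncomputable instance : Fintype (Config (ZMod n)) := Fintype.ofFinite _

/-- The weight `w(σ)` of a torus configuration: the product of its vertex weights. -/
noncomputable def weight (a : VertexType → ℝ) (σ : Config (ZMod n)) : ℝ :=
  ∏ v : ZMod n × ZMod n, a (vertexType σ v)

variable (n) in
/-- The partition function `Z_n` of the torus. -/
noncomputable def partitionFunction (a : VertexType → ℝ) : ℝ :=
  ∑ σ : Config (ZMod n), weight a σ

variable (n) in
/-- The Boltzmann measure `σ ↦ w(σ) / Z_n` of the `n × n` torus, regarded as a measure on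
periodic six-vertex configurations on `ℤ²`. -/
noncomputable def boltzmann (a : VertexType → ℝ) : Measure (Config ℤ) :=
  ∑ σ : Config (ZMod n),
    ENNReal.ofReal (weight a σ / partitionFunction n a) • Measure.dirac (periodize σ)

end Torus

/-- `P` is the law of the six-vertex model on `ℤ²` with vertex weights `a`: a probability measure
which is the limit of the Boltzmann measures of the tori of side `n → ∞`, in the sense of
convergence of the joint law of the types of any finite set of vertices. -/
def IsSixVertexLaw (a : VertexType → ℝ) (P : Measure (Config ℤ)) : Prop :=
  IsProbabilityMeasure P ∧
    ∀ (s : Finset (ℤ × ℤ)) (t : ℤ × ℤ → VertexType),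
      Tendsto (fun n : ℕ => (boltzmann (n + 1) a).real {σ | ∀ v ∈ s, vertexType σ v = t v}) atTop
        (𝓝 (P.real {σ | ∀ v ∈ s, vertexType σ v = t v}))

/-- The free-fermion vertex weights with parameters `α, β, γ`. -/
def freeFermionWeight (α β γ : ℝ) : VertexType → ℝ
  | .a1 => 1
  | .a2 => γ ^ 2 - α * β
  | .b1 => β
  | .b2 => α
  | .c1 => γ
  | .c2 => γ

/-- `Δ(w₁, w₂) = (1 + α w₁)(1 + β w₂) - γ² w₁ w₂`. -/
noncomputable def charPoly (α β γ : ℝ) (w₁ w₂ : ℂ) : ℂ :=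
  (1 + α * w₁) * (1 + β * w₂) - γ ^ 2 * w₁ * w₂

/-- The vertex polynomials `f_t(w₁, w₂, u₁, u₂)`, with `u₁, u₂` the second pair of variables. -/
noncomputable def vertexPoly (α β γ : ℝ) (t : VertexType) (w₁ w₂ u₁ u₂ : ℂ) : ℂ :=
  match t with
  | .a1 => (1 + β * w₂) * (1 + α * u₁) - γ ^ 2 * w₁ * u₂
  | .a2 => (γ ^ 2 - α * β) * (γ ^ 2 * u₁ * w₂ - (1 + α * u₁) * (1 + β * w₂)) * w₁ * u₂
  | .b1 => β * u₂ * ((1 + β * w₂) * (1 + α * u₁) - γ ^ 2 * w₁ * w₂)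
  | .b2 => α * w₁ * ((1 + β * w₂) * (1 + α * u₁) - γ ^ 2 * u₁ * u₂)
  | .c1 => γ ^ 2 * u₂ * (1 + β * w₂) * (w₁ - u₁)
  | .c2 => γ ^ 2 * w₁ * (1 + α * u₁) * (u₂ - w₂)

/-- The integrand of the single-vertex formula with respect to `dw₁ dw₂ dw̃₁ dw̃₂`, where
`w = (w₁, w₂, w̃₁, w̃₂)`. The product is the density of the normalized Haar measure on the torus
`|w₁| = |w₂| = |w̃₁| = |w̃₂| = 1`. -/
noncomputable def vertexIntegrand (α β γ : ℝ) (t : VertexType) (w : Fin 4 → ℂ) : ℂ :=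
  (∏ i, 1 / (2 * Real.pi * Complex.I * w i)) *
    (vertexPoly α β γ t (w 0) (w 1) (w 2) (w 3) /
      (charPoly α β γ (w 0) (w 1) * charPoly α β γ (w 2) (w 3)))

end SixVertex

/-!
A configuration is encoded by the edges whose arrow points left or down, the *occupied* edges. They
form paths going north-east, two paths meeting at a vertex of type `a2` turning without crossing.
The model is free-fermionic: the determinant of the sparse matrix `torusMatrix`, indexed by the
edges of the torus, expands vertex by vertex into the six vertex types, and becomes the sum over
all configurations of the product of the weights with a sign and with twists `w₁`, `w₂` attached
to the horizontal and vertical steps (`det_torusMatrix`). The sign, computed by comparing two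
orders of the edges, only depends on the numbers `h`, `k` of paths winding around the torus; it is
`(-1) ^ ((n - 1) (h + k) + h k)` (`sign_nextPerm`). Hence the unsigned partition function is a
combination of the determinants for four choices of twists of modulus one (`restrictedSum_eq`).
Prescribing the types of finitely many vertices replaces the rows of the matrix at these vertices,
so that each determinant is multiplied by a minor of the inverse matrix
(`det_torusMatrix_eq_mul_greenMinor`). Fourier analysis diagonalizes the torus matrix. Its
determinant is the product of `Δ(z₁, z₂)` over the twisted roots of unity, and the entries of the
inverse are averages of `z₁ ^ p z₂ ^ q / Δ(z₁, z₂)` over these roots.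

Write `Δ(z₁, z₂) = A(z₁) + B(z₁) z₂`. On the circle `|A| ^ 2 - |B| ^ 2 = κ cos θ + μ` with
`κ = 2 (α + β (γ ^ 2 - α β))` and `μ = 1 + α ^ 2 - β ^ 2 - (γ ^ 2 - α β) ^ 2`.

In the liquid phase `|μ| < κ`, the polynomial `Δ` has zeros on the torus, and for some of the four
twists the determinant may be small or zero. As a function of `ε = w₂ ^ n` the determinant is the
product over the roots `z₁` of `A ^ n - ε (-B) ^ n`. The two terms of such a factor are comparable
for boundedly many roots only (`exists_sum_ratio_le`), hence around each of the four values of `ε`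
there is a circle on which all factors are bounded below relative to their terms, and on which the
determinant is at most a constant times the partition function (`exists_good_circle`). On this
circle the averages converge to the moments of `1 / Δ`, and the maximum principle carries the
resulting estimate to the centre (`tendsto_signedSum_sub`). The probabilities of all cylinder
events thus converge to determinants in the moments (`tendsto_boltzmann_liquid`).

In the frozen phase `κ ≤ |μ|`, one of `|A|`, `|B|` dominates on the whole circle. Multiplying the
weights by `s > 1` for each edge in the unlikely state changes the determinants only a little,
while constant configurations bound the partition function from below. By Jensen's inequality the
densities of these edges tend to zero (`tendsto_edgeDensity_true`, `tendsto_edgeDensity_false`).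
All vertices then have the same type in the limit, and the moments, which are elementary in this
case, give the same answer (`exists_frozen_type`).

The configurations on the lattice form a compact space, so that convergence of the cylinder
probabilities yields a limit law (`exists_law`). It is unique because the cylinders are a
generating system stable under intersections (`law_unique`). For the integral, each `f_t` is a
difference of two products of a function of `w₁, w₂` with a function of `u₁, u₂`, and the integral
is a polynomial in the moments, the one found as the limit of the probabilities (`typeProb`).
Absolute convergence follows from `∫ dφ / |A + B exp (i φ)| ≤ C |κ cos θ + μ| ^ (-1 / 4)`, which is
integrable because the zeros of `κ cos θ + μ` are at most double (`integrable_div_symbolDet`).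
-/

namespace SixVertex

/-! ### The sign of a permutation as a count of discordant pairs -/

theorem exists_equiv_fin_monotone {α : Type*} [Fintype α] (f : α → ℕ)
    (hf : Function.Injective f) :
    ∃ (m : ℕ) (e : Fin m ≃ α), ∀ i j, f (e i) < f (e j) ↔ i < j := by
  let : LinearOrder α := LinearOrder.lift' f hf
  refine ⟨Fintype.card α, (Fintype.orderIsoFinOfCardEq α rfl).toEquiv, fun i j => ?_⟩
  have h := (Fintype.orderIsoFinOfCardEq α rfl).lt_iff_lt (x := i) (y := j)
  rw [← h]
  rfl

theorem sign_eq_prod_pairs {α : Type*} [Fintype α] [DecidableEq α] (f : α → ℕ)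
    (hf : Function.Injective f) (ρ : Equiv.Perm α) :
    Equiv.Perm.sign ρ =
      ∏ p : α × α with f p.1 < f p.2, if f (ρ p.1) < f (ρ p.2) then (1 : ℤˣ) else -1 := by
  obtain ⟨m, e, he⟩ := exists_equiv_fin_monotone f hf
  have h1 := Equiv.Perm.sign_symm_trans_trans ρ e.symm
  rw [← h1, Equiv.Perm.sign_eq_prod_prod_Iio, Finset.prod_sigma']
  refine Finset.prod_bij (fun p _ => (e p.2, e p.1)) ?_ ?_ ?_ ?_
  · intro p hp
    simp only [Finset.mem_sigma, Finset.mem_univ, Finset.mem_Iio, true_and] at hp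
    simpa [he] using hp
  · rintro ⟨a, b⟩ _ ⟨c, d⟩ _ h
    simp only [Prod.mk.injEq, EmbeddingLike.apply_eq_iff_eq] at h
    simp [h.1, h.2]
  · rintro ⟨a, b⟩ hp
    refine ⟨⟨e.symm b, e.symm a⟩, ?_, by simp⟩
    simp only [Finset.mem_sigma, Finset.mem_univ, Finset.mem_Iio, true_and]
    rw [← he]
    simpa using hp
  · rintro ⟨a, b⟩ _
    simp [← he]

/-- If `ρ` carries the order defined by `f` to the order defined by `g`, its sign is the parity of
the number of pairs on which the two orders disagree. -/
theorem sign_eq_neg_one_pow_discordant {α : Type*} [Fintype α] [DecidableEq α] (f g : α → ℕ)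
    (hf : Function.Injective f) (ρ : Equiv.Perm α)
    (hρ : ∀ a b, g (ρ a) < g (ρ b) ↔ f a < f b) :
    Equiv.Perm.sign ρ =
      (-1) ^ (Finset.univ.filter fun p : α × α => g p.1 < g p.2 ∧ f p.2 < f p.1).card := by
  have h1 : Equiv.Perm.sign ρ =
      ∏ p : α × α with g p.1 < g p.2, if f p.1 < f p.2 then (1 : ℤˣ) else -1 := by
    rw [sign_eq_prod_pairs f hf]
    refine Finset.prod_equiv (Equiv.prodCongr ρ ρ) ?_ ?_
    · rintro ⟨a, b⟩
      simp [hρ]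
    · rintro ⟨a, b⟩ _
      simp
  rw [h1, Finset.prod_ite, Finset.prod_const_one, one_mul, Finset.prod_const, Finset.filter_filter]
  congr 2
  ext ⟨a, b⟩
  simp only [Finset.mem_filter, Finset.mem_univ, true_and, not_lt]
  refine and_congr_right fun hab => ⟨fun h => lt_of_le_of_ne h ?_, le_of_lt⟩
  intro h
  have : b = a := hf h
  subst this
  exact lt_irrefl _ hab

/-! ### Edges of the torus -/

/-- The edges of the torus, indexed by their head: `(v, false)` is the edge to the west of `v` and
`(v, true)` the edge to the south of `v`. -/
abbrev Edge (n : ℕ) := (ZMod n × ZMod n) × Bool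

/-- The edge out of `v`, to the east (`k = false`) or to the north (`k = true`). -/
def outEdge {R : Type*} [CommRing R] (v : R × R) (k : Bool) : (R × R) × Bool :=
  bif k then (v + (0, 1), true) else (v + (1, 0), false)

/-- The tail of an edge, which is its west or its south end. -/
def tail {n : ℕ} (e : Edge n) : ZMod n × ZMod n :=
  bif e.2 then e.1 - (0, 1) else e.1 - (1, 0)

/-- An edge is occupied when its arrow points left or down. At a vertex of type `t`, this says
whether the west (`k = false`) or south (`k = true`) edge is occupied. -/
def inOcc : VertexType → Bool → Bool
  | .a1, _ => false
  | .a2, _ => true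
  | .b1, k => k
  | .b2, k => !k
  | .c1, k => k
  | .c2, k => !k

/-- At a vertex of type `t`, whether the east (`k = false`) or north (`k = true`) edge is
occupied. -/
def outOcc : VertexType → Bool → Bool
  | .a1, _ => false
  | .a2, _ => true
  | .b1, k => k
  | .b2, k => !k
  | .c1, k => !k
  | .c2, k => k

/-- The edge through which the path entering a vertex `v` of type `t` through its west
(`k = false`) or south (`k = true`) edge leaves `v`; the two paths at a vertex of type `a2` turn
without crossing. The incoming edge itself if it is not occupied. -/
def step {R : Type*} [CommRing R] (t : VertexType) (v : R × R) (k : Bool) : (R × R) × Bool :=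
  match t, k with
  | .a1, k => (v, k)
  | .a2, k => outEdge v (!k)
  | .b1, false => (v, false)
  | .b1, true => outEdge v true
  | .b2, false => outEdge v false
  | .b2, true => (v, true)
  | .c1, false => (v, false)
  | .c1, true => outEdge v false
  | .c2, false => outEdge v true
  | .c2, true => (v, true)

/-- The map on edges following the paths of an assignment of types to the vertices. -/
def next {n : ℕ} (t : ZMod n × ZMod n → VertexType) (e : Edge n) : Edge n := step (t e.1) e.1 e.2

/-- The types at the two ends of every edge agree on whether it is occupied. -/
def Consistent {n : ℕ} (t : ZMod n × ZMod n → VertexType) : Prop :=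
  ∀ e : Edge n, inOcc (t e.1) e.2 = outOcc (t (tail e)) e.2

theorem tail_outEdge {n : ℕ} (v : ZMod n × ZMod n) (k : Bool) : tail (outEdge v k) = v := by
  cases k <;> simp [tail, outEdge]

theorem outEdge_snd {n : ℕ} (v : ZMod n × ZMod n) (k : Bool) : (outEdge v k).2 = k := by
  cases k <;> rfl

theorem outEdge_tail {n : ℕ} (e : Edge n) : outEdge (tail e) e.2 = e := by
  obtain ⟨v, k⟩ := e
  cases k <;> simp [tail, outEdge]

/-- The kind of the edge by which an occupied edge of kind `k` is continued at a vertex of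
type `t`. -/
def turn (t : VertexType) (k : Bool) : Bool :=
  match t with
  | .a1 | .b1 | .b2 => k
  | .a2 | .c1 | .c2 => !k

theorem step_of_occ {n : ℕ} {t : VertexType} {k : Bool} (h : inOcc t k = true)
    (v : ZMod n × ZMod n) : step t v k = outEdge v (turn t k) := by
  cases t <;> cases k <;> simp_all [inOcc, step, turn]

theorem step_of_not_occ {n : ℕ} {t : VertexType} {k : Bool} (h : inOcc t k = false)
    (v : ZMod n × ZMod n) : step t v k = (v, k) := by
  cases t <;> cases k <;> simp_all [inOcc, step]

theorem outOcc_turn {t : VertexType} {k : Bool} (h : inOcc t k = true) :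
    outOcc t (turn t k) = true := by
  revert h; cases t <;> cases k <;> decide

theorem exists_turn_of_outOcc {t : VertexType} {k : Bool} (h : outOcc t k = true) :
    ∃ j, inOcc t j = true ∧ turn t j = k := by
  revert h; cases t <;> cases k <;> decide

theorem turn_injective {t : VertexType} {k j : Bool} (h : inOcc t k = true)
    (h' : inOcc t j = true) (hkj : turn t k = turn t j) : k = j := by
  revert h h' hkj; cases t <;> cases k <;> cases j <;> decide

theorem next_injective {n : ℕ} {t : ZMod n × ZMod n → VertexType} (ht : Consistent t) :
    Function.Injective (next t) := by
  have key : ∀ e e' : Edge n, inOcc (t e.1) e.2 = true → inOcc (t e'.1) e'.2 = false →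
      next t e ≠ next t e' := by
    intro e e' h h' he
    unfold next at he
    rw [step_of_occ h, step_of_not_occ h'] at he
    have h3 : inOcc (t (outEdge e.1 (turn (t e.1) e.2)).1) (outEdge e.1 (turn (t e.1) e.2)).2 =
        true := by rw [ht, tail_outEdge, outEdge_snd, outOcc_turn h]
    have he' : outEdge e.1 (turn (t e.1) e.2) = e' := he
    rw [he', h'] at h3
    exact Bool.false_ne_true h3
  intro e e' he
  cases h : inOcc (t e.1) e.2 <;> cases h' : inOcc (t e'.1) e'.2
  · unfold next at he
    rwa [step_of_not_occ h, step_of_not_occ h'] at he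
  · exact absurd he.symm (key _ _ h' h)
  · exact absurd he (key _ _ h h')
  · unfold next at he
    rw [step_of_occ h, step_of_occ h'] at he
    have h1 : e.1 = e'.1 := by rw [← tail_outEdge e.1, he, tail_outEdge]
    have h2 : turn (t e.1) e.2 = turn (t e'.1) e'.2 := by
      rw [← outEdge_snd e.1 (turn (t e.1) e.2), he, outEdge_snd]
    rw [← h1] at h2 h'
    exact Prod.ext h1 (turn_injective h h' h2)

theorem consistent_of_next_injective {n : ℕ} [NeZero n] {t : ZMod n × ZMod n → VertexType}
    (ht : Function.Injective (next t)) : Consistent t := by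
  have hsurj := Finite.surjective_of_injective ht
  intro e
  cases h : inOcc (t e.1) e.2 <;> cases h' : outOcc (t (tail e)) e.2
  · rfl
  · obtain ⟨j, hj, hj'⟩ := exists_turn_of_outOcc h'
    have h1 : next t e = e := by unfold next; rw [step_of_not_occ h]
    have h2 : next t (tail e, j) = e := by
      unfold next; rw [step_of_occ hj, hj', outEdge_tail]
    have h3 := ht (h1.trans h2.symm)
    have h4 : inOcc (t (tail e, j).1) (tail e, j).2 = inOcc (t e.1) e.2 := by rw [← h3]
    rw [h] at h4
    exact absurd (hj.symm.trans h4) (by simp)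
  · obtain ⟨e', he'⟩ := hsurj e
    cases h3 : inOcc (t e'.1) e'.2
    · have h4 : next t e' = e' := by unfold next; rw [step_of_not_occ h3]
      rw [h4] at he'
      rw [he', h] at h3
      exact absurd h3 (by simp)
    · have h4 : next t e' = outEdge e'.1 (turn (t e'.1) e'.2) := by
        unfold next; rw [step_of_occ h3]
      rw [h4] at he'
      have h5 := outOcc_turn h3
      rw [← he', tail_outEdge, outEdge_snd, h5] at h'
      exact absurd h' (by simp)
  · rfl

theorem consistent_iff {n : ℕ} [NeZero n] {t : ZMod n × ZMod n → VertexType} :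
    Consistent t ↔ Function.Injective (next t) :=
  ⟨next_injective, consistent_of_next_injective⟩

/-! ### Conservation of paths and the sign of a configuration -/

section Sign

variable {n : ℕ} [NeZero n]

/-- The antidiagonal on which the head of an edge lies. -/
def time (e : Edge n) : ZMod n := e.1.1 + e.1.2

/-- The position of an edge among the edges pointing into an antidiagonal, from north-west to
south-east. -/
def pos (e : Edge n) : ℕ := 2 * e.1.1.val + e.2.toNat

/-- The rank of a vertex, antidiagonal by antidiagonal. -/
def vertexKey (v : ZMod n × ZMod n) : ℕ := (v.1 + v.2).val * n + v.1.val

/-- The rank of an edge as an incoming edge of its head. -/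
def inKey (e : Edge n) : ℕ := 2 * vertexKey e.1 + e.2.toNat

/-- The rank of an edge as an outgoing edge of its tail. -/
def outKey (e : Edge n) : ℕ := 2 * vertexKey (tail e) + (!e.2).toNat

theorem mul_add_lt_mul_add_iff {m a b p q : ℕ} (hp : p < m) (hq : q < m) :
    a * m + p < b * m + q ↔ a < b ∨ (a = b ∧ p < q) := by
  rcases lt_trichotomy a b with h | h | h
  · have : (a + 1) * m ≤ b * m := Nat.mul_le_mul_right m h
    constructor
    · intro _; exact Or.inl h
    · intro _; nlinarith
  · subst h; simp
  · have : (b + 1) * m ≤ a * m := Nat.mul_le_mul_right m h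
    constructor
    · intro _; nlinarith
    · omega

theorem val_sub_one (x : ZMod n) :
    (x - 1).val = if x.val = 0 then n - 1 else x.val - 1 := by
  have hn : 0 < n := Nat.pos_of_ne_zero (NeZero.ne n)
  have hx := ZMod.val_lt x
  split_ifs with h
  · have hx0 : x = 0 := (ZMod.val_eq_zero x).1 h
    have h1 : x - 1 = ((n - 1 : ℕ) : ZMod n) := by
      rw [hx0, Nat.cast_sub hn]; simp
    rw [h1, ZMod.val_natCast, Nat.mod_eq_of_lt (by omega)]
  · have h1 : x - 1 = ((x.val - 1 : ℕ) : ZMod n) := by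
      rw [Nat.cast_sub (by omega)]; simp
    rw [h1, ZMod.val_natCast, Nat.mod_eq_of_lt (by omega)]

theorem vertexKey_injective : Function.Injective (vertexKey (n := n)) := by
  intro v v' h
  have h1 := ZMod.val_lt v.1
  have h2 := ZMod.val_lt v'.1
  have h3 := (mul_add_lt_mul_add_iff (a := (v.1 + v.2).val) (b := (v'.1 + v'.2).val) h1 h2).not
  have h4 := (mul_add_lt_mul_add_iff (b := (v.1 + v.2).val) (a := (v'.1 + v'.2).val) h2 h1).not
  unfold vertexKey at h
  have h5 := h3.1 (by omega)
  have h6 := h4.1 (by omega)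
  have h7 : v.1 = v'.1 := ZMod.val_injective n (by omega)
  have h8 : v.1 + v.2 = v'.1 + v'.2 := ZMod.val_injective n (by omega)
  rw [h7] at h8
  exact Prod.ext h7 (add_left_cancel h8)

theorem inKey_injective : Function.Injective (inKey (n := n)) := by
  rintro ⟨v, k⟩ ⟨v', k'⟩ h
  unfold inKey at h
  have h1 := Bool.toNat_le k
  have h2 := Bool.toNat_le k'
  simp only at h
  have h3 : v = v' := vertexKey_injective (by omega)
  subst h3
  have h4 : k.toNat = k'.toNat := by omega
  revert h4
  cases k <;> cases k' <;> simp

theorem pos_lt (e : Edge n) : pos e < 2 * n := by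
  have h1 := Bool.toNat_le e.2
  have h2 := ZMod.val_lt e.1.1
  unfold pos; omega

omit [NeZero n] in
theorem inKey_eq (e : Edge n) : inKey e = (time e).val * (2 * n) + pos e := by
  unfold inKey vertexKey time pos; ring

theorem outKey_eq (e : Edge n) : outKey e =
    (if (time e).val = 0 then n - 1 else (time e).val - 1) * (2 * n) +
      (if pos e = 0 then 2 * n - 1 else pos e - 1) := by
  have hn : 0 < n := Nat.pos_of_ne_zero (NeZero.ne n)
  have h1 : (tail e).1 + (tail e).2 = time e - 1 := by
    obtain ⟨v, k⟩ := e
    cases k <;> simp [tail, time] <;> ring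
  have h2 : 2 * (tail e).1.val + (!e.2).toNat = (if pos e = 0 then 2 * n - 1 else pos e - 1) := by
    obtain ⟨v, k⟩ := e
    cases k
    · have : (tail (v, false)).1 = v.1 - 1 := by simp [tail]
      rw [this, val_sub_one]
      have hpos : pos (v, false) = 2 * v.1.val := by simp [pos]
      rw [hpos]
      simp only [Bool.not_false, Bool.toNat_true]
      have hv := ZMod.val_lt v.1
      by_cases hv0 : v.1.val = 0
      · rw [if_pos hv0, if_pos (by omega)]; omega
      · rw [if_neg hv0, if_neg (by omega)]; omega
    · simp [tail, pos]
  unfold outKey vertexKey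
  rw [h1, val_sub_one, ← h2]
  ring

/-- The incoming and the outgoing order of edges agree except for pairs with one edge on the seam
`time = 0`, where the cyclic order of the antidiagonals is cut, and pairs on one antidiagonal
which involve the edge with `pos = 0`, where the cyclic order within the antidiagonal is cut. -/
theorem discordant_iff (a b : Edge n) :
    (outKey a < outKey b ∧ inKey b < inKey a) ↔
      (time b = 0 ∧ time a ≠ 0) ∨ (time a = time b ∧ pos b = 0 ∧ a ≠ b) := by
  have hn : 0 < n := Nat.pos_of_ne_zero (NeZero.ne n)
  have ha := pos_lt a
  have hb := pos_lt b
  have hta := ZMod.val_lt (time a)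
  have htb := ZMod.val_lt (time b)
  have hab : a = b ↔ (time a).val = (time b).val ∧ pos a = pos b := by
    refine ⟨fun h => by simp [h], fun h => inKey_injective ?_⟩
    rw [inKey_eq, inKey_eq, h.1, h.2]
  have h0 : time b = 0 ↔ (time b).val = 0 := (ZMod.val_eq_zero _).symm
  have h0' : time a = 0 ↔ (time a).val = 0 := (ZMod.val_eq_zero _).symm
  have h1 : time a = time b ↔ (time a).val = (time b).val := (ZMod.val_injective n).eq_iff.symm
  rw [ne_eq, ne_eq, hab, h0, h0', h1, inKey_eq, inKey_eq, outKey_eq, outKey_eq,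
    mul_add_lt_mul_add_iff (by split_ifs <;> omega) (by split_ifs <;> omega),
    mul_add_lt_mul_add_iff hb ha]
  generalize (time a).val = ta at *
  generalize (time b).val = tb at *
  generalize pos a = pa at *
  generalize pos b = pb at *
  split_ifs <;> omega

variable {t : ZMod n × ZMod n → VertexType}

/-- The number of occupied horizontal edges pointing into the column `x`. -/
def columnCount (t : ZMod n × ZMod n → VertexType) (x : ZMod n) : ℕ :=
  ∑ y, (inOcc (t (x, y)) false).toNat

/-- The number of occupied vertical edges pointing into the row `y`. -/
def rowCount (t : ZMod n × ZMod n → VertexType) (y : ZMod n) : ℕ :=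
  ∑ x, (inOcc (t (x, y)) true).toNat

theorem inOcc_add_eq (s : VertexType) :
    (inOcc s false).toNat + (inOcc s true).toNat =
      (outOcc s false).toNat + (outOcc s true).toNat := by
  cases s <;> rfl

omit [NeZero n] in
theorem Consistent.east (ht : Consistent t) (x y : ZMod n) :
    inOcc (t (x + 1, y)) false = outOcc (t (x, y)) false := by
  simpa [tail] using ht ((x + 1, y), false)

omit [NeZero n] in
theorem Consistent.north (ht : Consistent t) (x y : ZMod n) :
    inOcc (t (x, y + 1)) true = outOcc (t (x, y)) true := by
  simpa [tail] using ht ((x, y + 1), true)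

theorem eq_zero_of_forall_add_one {α : Type*} {f : ZMod n → α} (hf : ∀ x, f (x + 1) = f x)
    (x : ZMod n) : f x = f 0 := by
  have h : ∀ m : ℕ, f (m : ZMod n) = f 0 := by
    intro m
    induction m with
    | zero => simp
    | succ m ih => rw [Nat.cast_succ, hf, ih]
  simpa using h x.val

/-- The number of paths crossing a column is conserved. -/
theorem Consistent.columnCount_eq (ht : Consistent t) (x : ZMod n) :
    columnCount t x = columnCount t 0 := by
  refine eq_zero_of_forall_add_one (fun x => ?_) x
  unfold columnCount
  have h1 : ∑ y, (inOcc (t (x, y)) true).toNat = ∑ y, (outOcc (t (x, y)) true).toNat := by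
    rw [← Equiv.sum_comp (Equiv.addRight (1 : ZMod n))]
    simp [ht.north]
  have h2 := Finset.sum_congr (rfl : (Finset.univ : Finset (ZMod n)) = _)
    (fun y _ => inOcc_add_eq (t (x, y)))
  rw [Finset.sum_add_distrib, Finset.sum_add_distrib, h1] at h2
  simp only [ht.east]
  omega

/-- The number of paths crossing a row is conserved. -/
theorem Consistent.rowCount_eq (ht : Consistent t) (y : ZMod n) :
    rowCount t y = rowCount t 0 := by
  refine eq_zero_of_forall_add_one (fun y => ?_) y
  unfold rowCount
  have h1 : ∑ x, (inOcc (t (x, y)) false).toNat = ∑ x, (outOcc (t (x, y)) false).toNat := by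
    rw [← Equiv.sum_comp (Equiv.addRight (1 : ZMod n))]
    simp [ht.east]
  have h2 := Finset.sum_congr (rfl : (Finset.univ : Finset (ZMod n)) = _)
    (fun x _ => inOcc_add_eq (t (x, y)))
  rw [Finset.sum_add_distrib, Finset.sum_add_distrib, h1] at h2
  simp only [ht.north]
  omega

theorem Consistent.sum_inOcc_false (ht : Consistent t) :
    ∑ v, (inOcc (t v) false).toNat = n * columnCount t 0 := by
  rw [Fintype.sum_prod_type]
  have : ∀ x, ∑ y, (inOcc (t (x, y)) false).toNat = columnCount t 0 := ht.columnCount_eq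
  simp [this, ZMod.card]

theorem Consistent.sum_inOcc_true (ht : Consistent t) :
    ∑ v, (inOcc (t v) true).toNat = n * rowCount t 0 := by
  rw [Fintype.sum_prod_type_right]
  have : ∀ y, ∑ x, (inOcc (t (x, y)) true).toNat = rowCount t 0 := ht.rowCount_eq
  simp [this, ZMod.card]

theorem Consistent.sum_outOcc (ht : Consistent t) (k : Bool) :
    ∑ v, (outOcc (t v) k).toNat = ∑ v, (inOcc (t v) k).toNat := by
  cases k
  · rw [← Equiv.sum_comp (Equiv.addRight ((1, 0) : ZMod n × ZMod n))
      (fun v => (inOcc (t v) false).toNat)]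
    refine Finset.sum_congr rfl fun v _ => ?_
    obtain ⟨x, y⟩ := v
    rw [← ht.east]; simp
  · rw [← Equiv.sum_comp (Equiv.addRight ((0, 1) : ZMod n × ZMod n))
      (fun v => (inOcc (t v) true).toNat)]
    refine Finset.sum_congr rfl fun v _ => ?_
    obtain ⟨x, y⟩ := v
    rw [← ht.north]; simp

/-- The set of occupied edges. -/
def occupied (t : ZMod n × ZMod n → VertexType) : Finset (Edge n) :=
  Finset.univ.filter fun e => inOcc (t e.1) e.2 = true

theorem mem_occupied {e : Edge n} : e ∈ occupied t ↔ inOcc (t e.1) e.2 = true := by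
  simp [occupied]

theorem Consistent.next_mem_occupied_iff (ht : Consistent t) (e : Edge n) :
    next t e ∈ occupied t ↔ e ∈ occupied t := by
  rw [mem_occupied, mem_occupied]
  unfold next
  cases h : inOcc (t e.1) e.2
  · rw [step_of_not_occ h]; simp [h]
  · rw [step_of_occ h, ht, tail_outEdge, outEdge_snd, outOcc_turn h]

omit [NeZero n] in
theorem time_outEdge (v : ZMod n × ZMod n) (k : Bool) : time (outEdge v k) = v.1 + v.2 + 1 := by
  cases k <;> simp [time, outEdge] <;> ring

theorem card_occupied_eq_sum :
    (occupied t).card = ∑ v, (inOcc (t v) false).toNat + ∑ v, (inOcc (t v) true).toNat := by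
  unfold occupied
  rw [Finset.card_filter, Fintype.sum_prod_type, ← Finset.sum_add_distrib]
  refine Finset.sum_congr rfl fun v _ => ?_
  rw [Fintype.sum_bool]
  cases inOcc (t v) false <;> cases inOcc (t v) true <;> rfl

/-- The number of occupied edges pointing into an antidiagonal. -/
theorem Consistent.card_time (ht : Consistent t) (τ : ZMod n) :
    ((occupied t).filter fun e => time e = τ).card = columnCount t 0 + rowCount t 0 := by
  have hn : 0 < n := Nat.pos_of_ne_zero (NeZero.ne n)
  have h1 : ∀ τ : ZMod n, ((occupied t).filter fun e => time e = τ + 1).card =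
      ((occupied t).filter fun e => time e = τ).card := by
    intro τ
    symm
    have hnext : ∀ e ∈ occupied t, time (next t e) = time e + 1 := by
      intro e he
      unfold next
      rw [step_of_occ (mem_occupied.1 he), time_outEdge]; rfl
    have hbij : Function.Bijective (next t) :=
      Finite.injective_iff_bijective.1 (next_injective ht)
    refine Finset.card_bij (fun e _ => next t e) ?_ (fun a _ b _ h => next_injective ht h) ?_
    · intro e he
      rw [Finset.mem_filter] at he ⊢
      exact ⟨(ht.next_mem_occupied_iff e).2 he.1, by rw [hnext e he.1, he.2]⟩
    · intro e he
      obtain ⟨e', rfl⟩ := hbij.2 e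
      rw [Finset.mem_filter, ht.next_mem_occupied_iff] at he
      refine ⟨e', Finset.mem_filter.2 ⟨he.1, ?_⟩, rfl⟩
      have := he.2
      rw [hnext e' he.1] at this
      exact add_right_cancel this
  have h2 := eq_zero_of_forall_add_one
    (f := fun τ : ZMod n => ((occupied t).filter fun e => time e = τ).card) h1
  have h3 : (occupied t).card =
      ∑ τ : ZMod n, ((occupied t).filter fun e => time e = τ).card :=
    Finset.card_eq_sum_card_fiberwise (fun _ _ => Finset.mem_coe.2 (Finset.mem_univ _))
  simp only [h2] at h3
  rw [Finset.sum_const, Finset.card_univ, ZMod.card, card_occupied_eq_sum, ht.sum_inOcc_false,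
    ht.sum_inOcc_true, smul_eq_mul, ← mul_add] at h3
  rw [h2]
  exact (Nat.eq_of_mul_eq_mul_left hn h3).symm

theorem card_pos_eq_zero :
    ((occupied t).filter fun e => pos e = 0).card = columnCount t 0 := by
  have h1 : columnCount t 0 =
      (Finset.univ.filter fun y : ZMod n => inOcc (t (0, y)) false = true).card := by
    rw [columnCount, Finset.card_filter]
    refine Finset.sum_congr rfl fun y _ => ?_
    cases inOcc (t (0, y)) false <;> rfl
  rw [h1]
  symm
  refine Finset.card_bij (fun y _ => ((0, y), false)) ?_ ?_ ?_
  · intro y hy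
    simpa [pos, mem_occupied] using hy
  · intro y _ y' _ h
    simpa using h
  · rintro ⟨⟨x, y⟩, k⟩ h
    obtain ⟨h2, h3⟩ := Finset.mem_filter.1 h
    rw [mem_occupied] at h2
    unfold pos at h3
    simp only at h2 h3
    have hx : x = 0 := (ZMod.val_eq_zero x).1 (by omega)
    have hk : k = false := by cases k; rfl; simp at h3
    subst hx hk
    exact ⟨y, by simpa using h2, rfl⟩

theorem Consistent.card_discordant (ht : Consistent t) :
    ((occupied t ×ˢ occupied t).filter fun p : Edge n × Edge n =>
      outKey p.1 < outKey p.2 ∧ inKey p.2 < inKey p.1).card =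
      (columnCount t 0 + rowCount t 0) *
        ((n - 1) * (columnCount t 0 + rowCount t 0)) +
      columnCount t 0 * (columnCount t 0 + rowCount t 0 - 1) := by
  set p := columnCount t 0 + rowCount t 0 with hp
  have hcard : (occupied t).card = n * p := by
    rw [card_occupied_eq_sum, ht.sum_inOcc_false, ht.sum_inOcc_true, ← mul_add]
  have h1 : ∀ b ∈ occupied t, ∑ a ∈ occupied t,
      (if outKey a < outKey b ∧ inKey b < inKey a then 1 else 0) =
      (if time b = 0 then (n - 1) * p else 0) + (if pos b = 0 then p - 1 else 0) := by
    intro b hb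
    rw [← Finset.card_filter]
    simp only [discordant_iff]
    rw [Finset.filter_or, Finset.card_union_of_disjoint]
    · congr 1
      · split_ifs with h
        · simp only [h, true_and]
          have h2 := Finset.card_filter_add_card_filter_not (s := occupied t)
            (fun e : Edge n => time e = 0)
          rw [ht.card_time, hcard, ← hp] at h2
          rw [Nat.sub_mul, one_mul]
          simp only [ne_eq]
          omega
        · simp [h]
      · split_ifs with h
        · simp only [h, true_and]
          have h2 : ((occupied t).filter fun a => time a = time b ∧ a ≠ b) =
              ((occupied t).filter fun a => time a = time b).erase b := by
            ext a
            simp only [Finset.mem_filter, Finset.mem_erase]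
            tauto
          rw [h2, Finset.card_erase_of_mem (by simp [hb]), ht.card_time]
        · simp [h]
    · rw [Finset.disjoint_filter]
      rintro a _ ⟨h3, h4⟩ ⟨h5, -, -⟩
      exact h4 (h5.trans h3)
  rw [Finset.card_filter, Finset.sum_product_right, Finset.sum_congr rfl h1,
    Finset.sum_add_distrib, ← Finset.sum_filter, ← Finset.sum_filter, Finset.sum_const,
    Finset.sum_const, ht.card_time, card_pos_eq_zero]
  simp [hp]

/-- Following the paths through the vertices carries the incoming to the outgoing order. At a
vertex of type `a2` this is the reason for letting the two paths turn without crossing, and for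
the flipped bit in `outKey`. -/
theorem outKey_outEdge_lt_iff {v v' : ZMod n × ZMod n} {k k' : Bool}
    (h : inOcc (t v) k = true) (h' : inOcc (t v') k' = true) :
    outKey (outEdge v (turn (t v) k)) < outKey (outEdge v' (turn (t v') k')) ↔
      inKey (v, k) < inKey (v', k') := by
  unfold outKey inKey
  simp only [tail_outEdge, outEdge_snd]
  by_cases hv : v = v'
  · subst hv
    simp only [add_lt_add_iff_left]
    revert h h'
    generalize t v = s
    cases s <;> cases k <;> cases k' <;> decide
  · have h1 : vertexKey v ≠ vertexKey v' := fun h => hv (vertexKey_injective h)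
    have h2 := Bool.toNat_le k
    have h3 := Bool.toNat_le k'
    have h4 := Bool.toNat_le (!turn (t v) k)
    have h5 := Bool.toNat_le (!turn (t v') k')
    omega

/-- The permutation of the edges given by a consistent assignment of types. -/
noncomputable def nextPerm (ht : Consistent t) : Equiv.Perm (Edge n) :=
  Equiv.ofBijective (next t) (Finite.injective_iff_bijective.1 (next_injective ht))

theorem nextPerm_apply (ht : Consistent t) (e : Edge n) : nextPerm ht e = next t e := rfl

omit [NeZero n] in
theorem even_discordant_iff (h k m : ℕ) :
    Even ((h + k) * (m * (h + k)) + h * (h + k - 1)) ↔ Even (m * (h + k) + h * k) := by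
  rcases h with _ | h
  · simp only [Nat.zero_add, zero_mul, add_zero, Nat.even_mul]
    tauto
  · have : h + 1 + k - 1 = h + k := by omega
    rw [this]
    simp only [Nat.even_add, Nat.even_mul, Nat.even_add_one]
    tauto

/-- The sign of the permutation following the paths only depends on the numbers of paths winding
around the torus in the two directions. -/
theorem sign_nextPerm (ht : Consistent t) :
    Equiv.Perm.sign (nextPerm ht) =
      (-1) ^ ((n - 1) * (columnCount t 0 + rowCount t 0) + columnCount t 0 * rowCount t 0) := by
  have h1 : ∀ x, inOcc (t (nextPerm ht x).1) (nextPerm ht x).2 = true ↔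
      inOcc (t x.1) x.2 = true := by
    intro x
    rw [← mem_occupied, ← mem_occupied]
    exact ht.next_mem_occupied_iff x
  have h2 : ∀ x, nextPerm ht x ≠ x → inOcc (t x.1) x.2 = true := by
    intro x hx
    by_contra h
    apply hx
    rw [Bool.not_eq_true] at h
    rw [nextPerm_apply, next, step_of_not_occ h]
  rw [← Equiv.Perm.sign_subtypePerm (nextPerm ht) h1 h2,
    sign_eq_neg_one_pow_discordant (fun e : {e : Edge n // inOcc (t e.1) e.2 = true} => inKey e.1)
      (fun e => outKey e.1) (inKey_injective.comp Subtype.val_injective)]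
  · have h3 : (Finset.univ.filter fun p : {e : Edge n // inOcc (t e.1) e.2 = true} ×
        {e : Edge n // inOcc (t e.1) e.2 = true} =>
        outKey p.1.1 < outKey p.2.1 ∧ inKey p.2.1 < inKey p.1.1).card =
        ((occupied t ×ˢ occupied t).filter fun p : Edge n × Edge n =>
          outKey p.1 < outKey p.2 ∧ inKey p.2 < inKey p.1).card := by
      refine Finset.card_bij (fun p _ => (p.1.1, p.2.1)) ?_ ?_ ?_
      · rintro ⟨⟨a, ha⟩, ⟨b, hb⟩⟩ h
        simpa [mem_occupied, ha, hb] using h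
      · rintro ⟨⟨a, ha⟩, ⟨b, hb⟩⟩ _ ⟨⟨a', ha'⟩, ⟨b', hb'⟩⟩ _ h
        simpa using h
      · rintro ⟨a, b⟩ h
        simp only [Finset.mem_filter, Finset.mem_product, mem_occupied] at h
        exact ⟨(⟨a, h.1.1⟩, ⟨b, h.1.2⟩), by simpa using h.2, rfl⟩
    rw [h3, ht.card_discordant]
    apply neg_one_pow_congr
    exact even_discordant_iff _ _ _
  · rintro ⟨a, ha⟩ ⟨b, hb⟩
    have := outKey_outEdge_lt_iff ha hb
    rw [← step_of_occ ha, ← step_of_occ hb] at this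
    exact this

end Sign

/-! ### The determinant of the torus as a signed sum over configurations -/

/-- A function that expands linearly in each of its arguments separately expands in all of them
simultaneously. -/
theorem expand_fin {X ι R : Type*} [Fintype ι] [CommSemiring R] (m : ℕ) (F : (Fin m → X) → R)
    (x₀ : Fin m → X) (y : Fin m → ι → X) (κ : Fin m → ι → R)
    (h : ∀ x v, F (Function.update x v (x₀ v)) = ∑ i, κ v i * F (Function.update x v (y v i))) :
    F x₀ = ∑ t : Fin m → ι, (∏ v, κ v (t v)) * F (fun v => y v (t v)) := by
  induction m with
  | zero =>
    rw [Fintype.sum_unique]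
    simp only [Finset.univ_eq_empty, Finset.prod_empty, one_mul]
    congr 1
    exact Subsingleton.elim _ _
  | succ m ih =>
    have h1 := ih (fun x => F (Fin.cons (x₀ 0) x)) (fun v => x₀ v.succ) (fun v => y v.succ)
      (fun v => κ v.succ) (fun x v => by
        have := h (Fin.cons (x₀ 0) x) v.succ
        simpa [Fin.cons_update] using this)
    have h2 : ∀ z : Fin m → X, F (Fin.cons (x₀ 0) z) = ∑ i, κ 0 i * F (Fin.cons (y 0 i) z) := by
      intro z
      have := h (Fin.cons (x₀ 0) z) 0
      simpa using this
    have h3 : F x₀ = F (Fin.cons (x₀ 0) (fun v => x₀ v.succ)) := by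
      congr 1
      exact (Fin.cons_self_tail x₀).symm
    rw [h3, h1, ← (Fin.consEquiv (fun _ : Fin (m + 1) => ι)).sum_comp, Fintype.sum_prod_type_right]
    refine Finset.sum_congr rfl fun t _ => ?_
    rw [h2, Finset.mul_sum]
    refine Finset.sum_congr rfl fun i _ => ?_
    have h4 : (Fin.cons (y 0 i) (fun v => y v.succ (t v)) : Fin (m + 1) → X) =
        fun v => y v ((Fin.cons i t : Fin (m + 1) → ι) v) := by
      funext v
      refine Fin.cases ?_ (fun v => ?_) v <;> simp
    simp only [Fin.consEquiv_apply]
    rw [Fin.prod_univ_succ, ← h4]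
    simp only [Fin.cons_zero, Fin.cons_succ]
    ring

theorem expand_fintype {V X ι R : Type*} [Fintype V] [DecidableEq V] [Fintype ι] [CommSemiring R]
    (F : (V → X) → R) (x₀ : V → X) (y : V → ι → X) (κ : V → ι → R)
    (h : ∀ x v, F (Function.update x v (x₀ v)) = ∑ i, κ v i * F (Function.update x v (y v i))) :
    F x₀ = ∑ t : V → ι, (∏ v, κ v (t v)) * F (fun v => y v (t v)) := by
  let e := Fintype.equivFin V
  have h1 := expand_fin (Fintype.card V) (fun x => F (x ∘ e)) (x₀ ∘ e.symm)
    (fun v => y (e.symm v)) (fun v => κ (e.symm v)) (fun x v => by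
      have := h (x ∘ e) (e.symm v)
      have h2 : ∀ a, Function.update (x ∘ e) (e.symm v) a = Function.update x v a ∘ e := by
        intro a
        have := Function.update_comp_equiv x e v a
        exact this.symm
      simpa [h2] using this)
  have h3 : (x₀ ∘ e.symm) ∘ e = x₀ := by funext v; simp
  simp only [h3] at h1
  rw [h1, ← (Equiv.arrowCongr e (Equiv.refl ι)).sum_comp]
  refine Finset.sum_congr rfl fun t _ => ?_
  congr 1
  · rw [← e.symm.prod_comp]
    simp
  · congr 1
    funext v
    simp

/-- The vertex weights of a free-fermionic vertex at which a path turns from west to east, south to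
north, south to east and west to north with weights `a`, `b`, `c` and `d`. -/
def vertexWeight (a b c d : ℂ) : VertexType → ℂ
  | .a1 => 1
  | .a2 => c * d - a * b
  | .b1 => b
  | .b2 => a
  | .c1 => c
  | .c2 => d

/-- The twist of a vertex: a factor `w₁` if its east edge and `w₂` if its north edge is
occupied. -/
def twist (w₁ w₂ : ℂ) (t : VertexType) : ℂ :=
  w₁ ^ (outOcc t false).toNat * w₂ ^ (outOcc t true).toNat

section Rows

variable {n : ℕ}

/-- The row of the torus matrix at the west (`k = false`) or south (`k = true`) edge of `v`. -/
def baseRow (a b c d w₁ w₂ : ℂ) (v : ZMod n × ZMod n) (k : Bool) : Edge n → ℂ :=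
  bif k then
    Pi.single (v, true) 1 + ((c * w₁) • Pi.single (outEdge v false) 1 +
      (b * w₂) • Pi.single (outEdge v true) 1)
  else
    Pi.single (v, false) 1 + ((a * w₁) • Pi.single (outEdge v false) 1 +
      (d * w₂) • Pi.single (outEdge v true) 1)

/-- The two rows at `v` when the type of `v` is prescribed to be `t`, with weight `g`. -/
def fixedRow (g : ℂ) (t : VertexType) (v : ZMod n × ZMod n) (k : Bool) : Edge n → ℂ :=
  (bif k then 1 else g) • Pi.single (step t v k) 1

/-- The determinant of the matrix with given rows, as a function of the pairs of rows at the
vertices. -/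
noncomputable def rowDet [NeZero n] (x : ZMod n × ZMod n → Bool → Edge n → ℂ) : ℂ :=
  Matrix.det (Matrix.of fun e : Edge n => x e.1 e.2)

variable [NeZero n]

/-- The determinant as a bilinear function of the pair of rows at one vertex. -/
noncomputable def pairDet (M : Matrix (Edge n) (Edge n) ℂ) (v : ZMod n × ZMod n) :
    (Edge n → ℂ) →ₗ[ℂ] (Edge n → ℂ) →ₗ[ℂ] ℂ :=
  LinearMap.mk₂ ℂ (fun r s => ((M.updateRow (v, false) r).updateRow (v, true) s).det)
    (fun r r' s => by
      simp only [Matrix.updateRow_comm M (show ((v, false) : Edge n) ≠ (v, true) by simp),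
        Matrix.det_updateRow_add])
    (fun c r s => by
      simp only [Matrix.updateRow_comm M (show ((v, false) : Edge n) ≠ (v, true) by simp),
        Matrix.det_updateRow_smul, smul_eq_mul])
    (fun r s s' => Matrix.det_updateRow_add _ _ _ _)
    (fun c r s => by rw [Matrix.det_updateRow_smul, smul_eq_mul])

theorem pairDet_self (M : Matrix (Edge n) (Edge n) ℂ) (v : ZMod n × ZMod n) (r : Edge n → ℂ) :
    pairDet M v r r = 0 := by
  change ((M.updateRow (v, false) r).updateRow (v, true) r).det = 0
  refine Matrix.det_zero_of_row_eq (i := (v, false)) (j := (v, true)) (by simp) ?_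
  rw [Matrix.updateRow_self, Matrix.updateRow_ne (by simp), Matrix.updateRow_self]

theorem pairDet_swap (M : Matrix (Edge n) (Edge n) ℂ) (v : ZMod n × ZMod n) (r s : Edge n → ℂ) :
    pairDet M v r s = -pairDet M v s r := by
  have h := pairDet_self M v (r + s)
  simp only [map_add, LinearMap.add_apply, pairDet_self, zero_add, add_zero] at h
  exact eq_neg_of_add_eq_zero_right h

theorem rowDet_update (x : ZMod n × ZMod n → Bool → Edge n → ℂ) (v : ZMod n × ZMod n)
    (r : Bool → Edge n → ℂ) :
    rowDet (Function.update x v r) =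
      pairDet (Matrix.of fun e : Edge n => x e.1 e.2) v (r false) (r true) := by
  change Matrix.det _ = Matrix.det _
  congr 1
  ext ⟨u, k⟩ e'
  by_cases hu : u = v
  · subst hu
    cases k
    · rw [Matrix.updateRow_ne (by simp), Matrix.updateRow_self]; simp
    · rw [Matrix.updateRow_self]; simp
  · rw [Matrix.updateRow_ne (by simp [hu]), Matrix.updateRow_ne (by simp [hu])]
    simp [hu]

theorem sum_vertexType {R : Type*} [AddCommMonoid R] (f : VertexType → R) :
    ∑ t, f t = f .a1 + (f .a2 + (f .b1 + (f .b2 + (f .c1 + f .c2)))) := by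
  change ∑ t ∈ {VertexType.a1, .a2, .b1, .b2, .c1, .c2}, f t = _
  rw [Finset.sum_insert (by decide), Finset.sum_insert (by decide), Finset.sum_insert (by decide),
    Finset.sum_insert (by decide), Finset.sum_insert (by decide), Finset.sum_singleton]

/-- The determinant is alternating in the two rows at a vertex, so that the pair of rows expands
into six terms, one for each vertex type. The free-fermion relation is what makes the coefficient
of `a2` a `2 × 2` minor of the other weights. -/
theorem rowDet_update_baseRow (a b c d w₁ w₂ : ℂ) (x : ZMod n × ZMod n → Bool → Edge n → ℂ)
    (v : ZMod n × ZMod n) :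
    rowDet (Function.update x v (baseRow a b c d w₁ w₂ v)) =
      ∑ t, vertexWeight a b c d t * twist w₁ w₂ t *
        rowDet (Function.update x v fun k => Pi.single (step t v k) 1) := by
  simp only [rowDet_update, sum_vertexType, baseRow, cond_true, cond_false, map_add, map_smul,
    LinearMap.add_apply, LinearMap.smul_apply, step, vertexWeight, twist, outOcc, Bool.not_true,
    Bool.not_false, Bool.toNat_true, Bool.toNat_false, smul_eq_mul, pairDet_self]
  rw [pairDet_swap _ v (Pi.single (outEdge v false) 1) (Pi.single (outEdge v true) 1)]
  ring

theorem rowDet_update_fixedRow (g : ℂ) (s : VertexType)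
    (x : ZMod n × ZMod n → Bool → Edge n → ℂ) (v : ZMod n × ZMod n) :
    rowDet (Function.update x v (fixedRow g s v)) =
      ∑ t, (if t = s then g else 0) *
        rowDet (Function.update x v fun k => Pi.single (step t v k) 1) := by
  simp only [rowDet_update, fixedRow, cond_true, cond_false, map_smul, LinearMap.smul_apply,
    smul_eq_mul, ite_mul, zero_mul, Finset.sum_ite_eq', Finset.mem_univ, if_true, one_mul]

open Classical in
/-- With the rows of one type at each vertex, the matrix is the permutation matrix of `next`, or
has two equal rows. -/
theorem rowDet_single (t : ZMod n × ZMod n → VertexType) :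
    rowDet (fun v k => Pi.single (step (t v) v k) 1) =
      if Consistent t then
        (-1) ^ ((n - 1) * (columnCount t 0 + rowCount t 0) + columnCount t 0 * rowCount t 0)
      else 0 := by
  split_ifs with ht
  · have h1 : (Matrix.of fun e : Edge n => (Pi.single (step (t e.1) e.1 e.2) 1 : Edge n → ℂ)) =
        (nextPerm ht).permMatrix ℂ := by
      ext e e'
      simp [Equiv.Perm.permMatrix, PEquiv.toMatrix_apply, nextPerm_apply, Pi.single_apply, next,
        eq_comm]
    rw [rowDet, h1, Matrix.det_permutation, sign_nextPerm]
    simp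
  · rw [consistent_iff, Function.Injective] at ht
    push Not at ht
    obtain ⟨e, e', h1, h2⟩ := ht
    refine Matrix.det_zero_of_row_eq h2 ?_
    funext e''
    change (Pi.single (next t e) 1 : Edge n → ℂ) e'' = (Pi.single (next t e') 1 : Edge n → ℂ) e''
    rw [h1]

theorem Consistent.prod_twist {t : ZMod n × ZMod n → VertexType} (ht : Consistent t)
    (w₁ w₂ : ℂ) :
    ∏ v, twist w₁ w₂ (t v) = (w₁ ^ n) ^ columnCount t 0 * (w₂ ^ n) ^ rowCount t 0 := by
  unfold twist
  rw [Finset.prod_mul_distrib, Finset.prod_pow_eq_pow_sum, Finset.prod_pow_eq_pow_sum,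
    ht.sum_outOcc, ht.sum_outOcc, ht.sum_inOcc_false, ht.sum_inOcc_true, pow_mul, pow_mul]

/-- The torus matrix, with the types of the vertices in `S` prescribed by `s`. -/
noncomputable def torusMatrix (a b c d w₁ w₂ : ℂ) (S : Finset (ZMod n × ZMod n))
    (s : ZMod n × ZMod n → VertexType) : Matrix (Edge n) (Edge n) ℂ :=
  Matrix.of fun e => if e.1 ∈ S then
    fixedRow (vertexWeight a b c d (s e.1) * twist w₁ w₂ (s e.1)) (s e.1) e.1 e.2
    else baseRow a b c d w₁ w₂ e.1 e.2

end Rows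

section Configurations

variable {n : ℕ} [NeZero n]

theorem inOcc_eq (t : VertexType) :
    inOcc t false = !(arrows t).1 ∧ inOcc t true = !(arrows t).2.2.1 := by cases t <;> decide

theorem outOcc_eq (t : VertexType) :
    outOcc t false = !(arrows t).2.1 ∧ outOcc t true = !(arrows t).2.2.2 := by cases t <;> decide

omit [NeZero n] in
theorem arrows_vertexType {R : Type*} [CommRing R] (σ : Config R) (v : R × R) :
    (west σ.1 v, east σ.1 v, south σ.1 v, north σ.1 v) = arrows (vertexType σ v) :=
  (vertexType_eq_iff σ v _).1 rfl

omit [NeZero n] in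
theorem consistent_vertexType (σ : Config (ZMod n)) : Consistent (vertexType σ) := by
  rintro ⟨v, k⟩
  cases k
  · rw [(inOcc_eq _).1, (outOcc_eq _).1, ← arrows_vertexType, ← arrows_vertexType]
    rfl
  · rw [(inOcc_eq _).2, (outOcc_eq _).2, ← arrows_vertexType, ← arrows_vertexType]
    rfl

omit [NeZero n] in
theorem vertexType_injective : Function.Injective (vertexType (R := ZMod n)) := by
  intro σ σ' h
  have h1 : ∀ v, (west σ.1 v, east σ.1 v, south σ.1 v, north σ.1 v) =
      (west σ'.1 v, east σ'.1 v, south σ'.1 v, north σ'.1 v) := by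
    intro v
    rw [arrows_vertexType, arrows_vertexType, h]
  refine Subtype.ext (Prod.ext ?_ ?_)
  · funext v
    exact (Prod.ext_iff.1 (Prod.ext_iff.1 (h1 v)).2).1
  · funext v
    exact (Prod.ext_iff.1 (Prod.ext_iff.1 (Prod.ext_iff.1 (h1 v)).2).2).2

omit [NeZero n] in
theorem exists_config {t : ZMod n × ZMod n → VertexType} (ht : Consistent t) :
    ∃ σ : Config (ZMod n), vertexType σ = t := by
  let o : Orientation (ZMod n) := (fun v => (arrows (t v)).2.1, fun v => (arrows (t v)).2.2.2)
  have h1 : ∀ v, (west o v, east o v, south o v, north o v) = arrows (t v) := by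
    intro v
    have h2 : west o v = (arrows (t v)).1 := by
      have := ht (v, false)
      rw [(inOcc_eq _).1, (outOcc_eq _).1] at this
      exact (Bool.not_inj this).symm
    have h3 : south o v = (arrows (t v)).2.2.1 := by
      have := ht (v, true)
      rw [(inOcc_eq _).2, (outOcc_eq _).2] at this
      exact (Bool.not_inj this).symm
    rw [h2, h3]
    rfl
  have h4 : IceRule o := by
    intro v
    have := h1 v
    unfold indegree outdegree
    generalize west o v = w at *
    generalize east o v = e at *
    generalize south o v = s at *
    generalize north o v = m at *
    generalize t v = u at *
    revert this
    revert w e s m u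
    decide
  exact ⟨⟨o, h4⟩, funext fun v => (vertexType_eq_iff _ _ _).2 (h1 v)⟩

open Classical in
/-- Configurations on the torus correspond to consistent assignments of types. -/
theorem sum_consistent {R : Type*} [AddCommMonoid R] (f : (ZMod n × ZMod n → VertexType) → R) :
    ∑ t, (if Consistent t then f t else 0) = ∑ σ : Config (ZMod n), f (vertexType σ) := by
  rw [← Finset.sum_filter]
  symm
  refine Finset.sum_bij (fun σ _ => vertexType σ) ?_ ?_ ?_ ?_
  · intro σ _
    simpa using consistent_vertexType σ
  · intro σ _ σ' _ h
    exact vertexType_injective h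
  · intro t ht
    obtain ⟨σ, h⟩ := exists_config (Finset.mem_filter.1 ht).2
    exact ⟨σ, Finset.mem_univ _, h⟩
  · intro σ _
    rfl

/-- The number of paths of a configuration winding around the torus horizontally. -/
noncomputable def hWind (σ : Config (ZMod n)) : ℕ := columnCount (vertexType σ) 0

/-- The number of paths of a configuration winding around the torus vertically. -/
noncomputable def vWind (σ : Config (ZMod n)) : ℕ := rowCount (vertexType σ) 0

open Classical in
/-- The sum over the configurations of types `s` on `S` of the weights `a`, with a sign and a twist
that depend on the winding numbers. -/
noncomputable def signedSum (a : VertexType → ℂ) (S : Finset (ZMod n × ZMod n))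
    (s : ZMod n × ZMod n → VertexType) (ε₁ ε₂ : ℂ) : ℂ :=
  ∑ σ : Config (ZMod n), if ∀ v ∈ S, vertexType σ v = s v then
    (-1) ^ ((n - 1) * (hWind σ + vWind σ) + hWind σ * vWind σ) *
      (ε₁ ^ hWind σ * ε₂ ^ vWind σ) * ∏ v, a (vertexType σ v) else 0

/-- The determinant of the torus matrix is a signed sum over the configurations. -/
theorem det_torusMatrix (a b c d w₁ w₂ : ℂ) (S : Finset (ZMod n × ZMod n))
    (s : ZMod n × ZMod n → VertexType) :
    (torusMatrix a b c d w₁ w₂ S s).det =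
      signedSum (vertexWeight a b c d) S s (w₁ ^ n) (w₂ ^ n) := by
  classical
  set g : VertexType → ℂ := fun t => vertexWeight a b c d t * twist w₁ w₂ t with hg
  have h1 := expand_fintype (rowDet (n := n))
    (fun v => if v ∈ S then fixedRow (g (s v)) (s v) v else baseRow a b c d w₁ w₂ v)
    (fun v t k => Pi.single (step t v k) 1)
    (fun v t => if v ∈ S then (if t = s v then g (s v) else 0) else g t)
    (by
      intro x v
      by_cases hv : v ∈ S
      · simp only [hv, if_true]
        exact rowDet_update_fixedRow _ _ _ _
      · simp only [hv, if_false]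
        exact rowDet_update_baseRow _ _ _ _ _ _ _ _)
  have h2 : (torusMatrix a b c d w₁ w₂ S s).det = rowDet (fun v =>
      if v ∈ S then fixedRow (g (s v)) (s v) v else baseRow a b c d w₁ w₂ v) := by
    unfold rowDet torusMatrix
    congr 2
    ext e e'
    by_cases h : e.1 ∈ S <;> simp [h, hg]
  rw [h2, h1]
  simp only [rowDet_single, mul_ite, mul_zero]
  rw [sum_consistent]
  unfold signedSum
  refine Finset.sum_congr rfl fun σ _ => ?_
  split_ifs with h3
  · have h4 : ∏ v, (if v ∈ S then (if vertexType σ v = s v then g (s v) else 0)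
        else g (vertexType σ v)) = ∏ v, g (vertexType σ v) := by
      refine Finset.prod_congr rfl fun v _ => ?_
      by_cases hv : v ∈ S
      · simp [hv, h3 v hv]
      · simp [hv]
    rw [h4, hg, Finset.prod_mul_distrib, (consistent_vertexType σ).prod_twist]
    unfold hWind vWind
    ring
  · push Not at h3
    obtain ⟨v, hv, hv'⟩ := h3
    rw [Finset.prod_eq_zero (Finset.mem_univ v) (by simp [hv, hv']), zero_mul]

end Configurations

/-! ### Partition functions and Boltzmann probabilities -/

section Partition

variable {n : ℕ} [NeZero n]

open Classical in
/-- The sum of the weights of the configurations with types `s` on `S`. -/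
noncomputable def restrictedSum (a : VertexType → ℝ) (S : Finset (ZMod n × ZMod n))
    (s : ZMod n × ZMod n → VertexType) : ℝ :=
  ∑ σ : Config (ZMod n), if ∀ v ∈ S, vertexType σ v = s v then weight a σ else 0

theorem restrictedSum_empty (a : VertexType → ℝ) (s : ZMod n × ZMod n → VertexType) :
    restrictedSum a ∅ s = partitionFunction n a := by
  simp [restrictedSum, partitionFunction]

theorem weight_nonneg {a : VertexType → ℝ} (ha : ∀ t, 0 ≤ a t) (σ : Config (ZMod n)) :
    0 ≤ weight a σ := Finset.prod_nonneg fun _ _ => ha _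

omit [NeZero n] in
/-- A type without turns can be taken by all the vertices at once. -/
theorem exists_config_const {t : VertexType} (ht : ∀ k, inOcc t k = outOcc t k) :
    ∃ σ : Config (ZMod n), ∀ v, vertexType σ v = t := by
  obtain ⟨σ, hσ⟩ := exists_config (n := n) (t := fun _ => t) (fun e => ht e.2)
  exact ⟨σ, fun v => by rw [hσ]⟩

theorem pow_le_partitionFunction {a : VertexType → ℝ} (ha : ∀ t, 0 ≤ a t) {t : VertexType}
    (ht : ∀ k, inOcc t k = outOcc t k) : a t ^ (n * n) ≤ partitionFunction n a := by
  obtain ⟨σ, hσ⟩ := exists_config_const (n := n) ht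
  have h : weight a σ = a t ^ (n * n) := by
    simp [weight, hσ, ZMod.card]
  rw [← h]
  exact Finset.single_le_sum (f := fun σ => weight a σ) (fun σ _ => weight_nonneg ha σ)
    (Finset.mem_univ σ)

theorem partitionFunction_pos {a : VertexType → ℝ} (ha : ∀ t, 0 < a t) :
    0 < partitionFunction n a :=
  lt_of_lt_of_le (pow_pos (ha .a1) _)
    (pow_le_partitionFunction (fun t => (ha t).le) (t := .a1) (by decide))

theorem norm_signedSum_le {a : VertexType → ℝ} (ha : ∀ t, 0 ≤ a t)
    (S : Finset (ZMod n × ZMod n)) (s : ZMod n × ZMod n → VertexType) {ε₁ ε₂ : ℂ}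
    (h₁ : ‖ε₁‖ ≤ 1) (h₂ : ‖ε₂‖ ≤ 1) :
    ‖signedSum (fun t => (a t : ℂ)) S s ε₁ ε₂‖ ≤ partitionFunction n a := by
  unfold signedSum partitionFunction
  refine norm_sum_le_of_le _ fun σ _ => ?_
  have h3 := weight_nonneg ha σ
  split_ifs
  · rw [norm_mul, norm_mul, norm_mul, norm_pow, norm_pow, norm_pow, norm_neg, norm_one, one_pow,
      one_mul]
    have h4 : ‖∏ v, ((a (vertexType σ v) : ℝ) : ℂ)‖ = weight a σ := by
      rw [← Complex.ofReal_prod, Complex.norm_real, Real.norm_eq_abs]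
      exact abs_of_nonneg h3
    rw [h4]
    have h5 : ‖ε₁‖ ^ hWind σ * ‖ε₂‖ ^ vWind σ ≤ 1 :=
      mul_le_one₀ (pow_le_one₀ (norm_nonneg _) h₁) (by positivity)
        (pow_le_one₀ (norm_nonneg _) h₂)
    calc _ ≤ 1 * weight a σ := mul_le_mul_of_nonneg_right h5 h3
      _ = _ := one_mul _
  · simpa using h3

/-- The quadratic form `(-1) ^ (h k)` of the winding numbers is half the sum of its three even
characters minus the odd one: the four sign patterns of the twists add up to twice the unsigned
sum. -/
theorem sector_identity (m h k : ℕ) (η : ℂ) (hη : η = (-1) ^ m) :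
    (-1 : ℂ) ^ (m * (h + k) + h * k) * (η ^ h * η ^ k) +
      (-1) ^ (m * (h + k) + h * k) * (η ^ h * (-η) ^ k) +
      (-1) ^ (m * (h + k) + h * k) * ((-η) ^ h * η ^ k) -
      (-1) ^ (m * (h + k) + h * k) * ((-η) ^ h * (-η) ^ k) = 2 := by
  have h1 : (-1 : ℂ) ^ (m * (h + k)) * (η ^ h * η ^ k) = 1 := by
    rw [hη, ← pow_add, pow_mul, ← mul_pow, ← mul_pow]
    simp
  have h2 : (-η) ^ h = (-1) ^ h * η ^ h := by rw [neg_pow]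
  have h3 : (-η) ^ k = (-1) ^ k * η ^ k := by rw [neg_pow]
  have h4 : (-1 : ℂ) ^ (h * k) + (-1) ^ (h * k) * (-1) ^ k + (-1) ^ (h * k) * (-1) ^ h -
      (-1) ^ (h * k) * ((-1) ^ h * (-1) ^ k) = 2 := by
    rw [pow_mul]
    rcases neg_one_pow_eq_or ℂ h with e1 | e1 <;> rcases neg_one_pow_eq_or ℂ k with e2 | e2 <;>
      rw [e1, e2] <;> norm_num
  rw [h2, h3, pow_add]
  linear_combination h4 + ((-1 : ℂ) ^ (h * k) + (-1) ^ (h * k) * (-1) ^ k +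
    (-1) ^ (h * k) * (-1) ^ h - (-1) ^ (h * k) * ((-1) ^ h * (-1) ^ k)) * h1

/-- The sum of the weights is a combination of four twisted signed sums, as the sign is the
quadratic form `(-1) ^ (h k)` of the winding numbers up to a linear one. -/
theorem restrictedSum_eq (a : VertexType → ℝ) (S : Finset (ZMod n × ZMod n))
    (s : ZMod n × ZMod n → VertexType) {η : ℂ} (hη : η = (-1) ^ (n - 1)) :
    2 * (restrictedSum a S s : ℂ) =
      signedSum (fun t => (a t : ℂ)) S s η η + signedSum (fun t => (a t : ℂ)) S s η (-η) +
        signedSum (fun t => (a t : ℂ)) S s (-η) η -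
        signedSum (fun t => (a t : ℂ)) S s (-η) (-η) := by
  unfold restrictedSum signedSum
  rw [Complex.ofReal_sum, Finset.mul_sum, ← Finset.sum_add_distrib, ← Finset.sum_add_distrib,
    ← Finset.sum_sub_distrib]
  refine Finset.sum_congr rfl fun σ _ => ?_
  split_ifs
  · have h1 := sector_identity (n - 1) (hWind σ) (vWind σ) η hη
    have h2 : ((weight a σ : ℝ) : ℂ) = ∏ v, (a (vertexType σ v) : ℂ) := by
      simp [weight]
    rw [h2]
    linear_combination (-∏ v, (a (vertexType σ v) : ℂ)) * h1
  · simp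

end Partition

theorem measurableSet_vertexType (v : ℤ × ℤ) (t : VertexType) :
    MeasurableSet {σ : Config ℤ | vertexType σ v = t} := by
  have h1 : ∀ u : ℤ × ℤ, Measurable fun σ : Config ℤ => σ.1.1 u := fun u =>
    (measurable_pi_apply u).comp (measurable_fst.comp measurable_subtype_coe)
  have h2 : ∀ u : ℤ × ℤ, Measurable fun σ : Config ℤ => σ.1.2 u := fun u =>
    (measurable_pi_apply u).comp (measurable_snd.comp measurable_subtype_coe)
  have h3 : Measurable fun σ : Config ℤ => (west σ.1 v, east σ.1 v, south σ.1 v, north σ.1 v) :=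
    (h1 _).prodMk ((h1 _).prodMk ((h2 _).prodMk (h2 _)))
  have h4 : {σ : Config ℤ | vertexType σ v = t} =
      (fun σ : Config ℤ => (west σ.1 v, east σ.1 v, south σ.1 v, north σ.1 v)) ⁻¹' {arrows t} := by
    ext σ
    exact vertexType_eq_iff σ v t
  rw [h4]
  exact h3 (measurableSet_singleton _)

theorem measurableSet_cylinder (S : Finset (ℤ × ℤ)) (t : ℤ × ℤ → VertexType) :
    MeasurableSet {σ : Config ℤ | ∀ v ∈ S, vertexType σ v = t v} := by
  have : {σ : Config ℤ | ∀ v ∈ S, vertexType σ v = t v} =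
      ⋂ v ∈ S, {σ : Config ℤ | vertexType σ v = t v} := by ext; simp
  rw [this]
  exact Finset.measurableSet_biInter S fun v _ => measurableSet_vertexType v (t v)

section Boltzmann

variable {n : ℕ} [NeZero n]

/-- Reduction of a vertex of the square lattice modulo `n`. -/
def toTorus (n : ℕ) (v : ℤ × ℤ) : ZMod n × ZMod n := (v.1, v.2)

omit [NeZero n] in
theorem vertexType_periodize (σ : Config (ZMod n)) (v : ℤ × ℤ) :
    vertexType (periodize σ) v = vertexType σ (toTorus n v) := by
  rw [vertexType_eq_iff, ← arrows_vertexType]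
  simp [periodize, west, east, south, north, toTorus]

open Classical in
theorem boltzmann_real {a : VertexType → ℝ} (ha : ∀ t, 0 ≤ a t) {E : Set (Config ℤ)}
    (hE : MeasurableSet E) :
    (boltzmann n a).real E =
      (∑ σ : Config (ZMod n), if periodize σ ∈ E then weight a σ else 0) /
        partitionFunction n a := by
  have hZ : 0 ≤ partitionFunction n a := Finset.sum_nonneg fun σ _ => weight_nonneg ha σ
  have h1 : ∀ σ : Config (ZMod n), 0 ≤ weight a σ / partitionFunction n a := fun σ =>
    div_nonneg (weight_nonneg ha σ) hZ
  unfold boltzmann Measure.real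
  rw [Measure.finsetSum_apply, ENNReal.toReal_sum]
  · rw [Finset.sum_div]
    refine Finset.sum_congr rfl fun σ _ => ?_
    rw [Measure.smul_apply, Measure.dirac_apply' _ hE, smul_eq_mul, ENNReal.toReal_mul,
      ENNReal.toReal_ofReal (h1 σ)]
    by_cases h : periodize σ ∈ E <;> simp [h]
  · intro σ _
    rw [Measure.smul_apply, Measure.dirac_apply' _ hE, smul_eq_mul]
    by_cases h : periodize σ ∈ E <;> simp [h]

theorem isProbabilityMeasure_boltzmann {a : VertexType → ℝ} (ha : ∀ t, 0 < a t) :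
    IsProbabilityMeasure (boltzmann n a) := by
  have h1 : (boltzmann n a).real Set.univ = 1 := by
    rw [boltzmann_real (fun t => (ha t).le) MeasurableSet.univ]
    simp only [Set.mem_univ, if_true]
    exact div_self (partitionFunction_pos ha).ne'
  constructor
  rw [Measure.real] at h1
  exact (ENNReal.toReal_eq_one_iff _).1 h1

theorem boltzmann_cylinder {a : VertexType → ℝ} (ha : ∀ t, 0 ≤ a t) (S : Finset (ℤ × ℤ))
    (t : ℤ × ℤ → VertexType) (s : ZMod n × ZMod n → VertexType)
    (hs : ∀ v ∈ S, s (toTorus n v) = t v) :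
    (boltzmann n a).real {σ | ∀ v ∈ S, vertexType σ v = t v} =
      restrictedSum a (S.image (toTorus n)) s / partitionFunction n a := by
  classical
  rw [boltzmann_real ha (measurableSet_cylinder S t)]
  congr 1
  refine Finset.sum_congr rfl fun σ _ => ?_
  simp only [Set.mem_ofPred_eq, vertexType_periodize, Finset.forall_mem_image]
  have : (∀ v ∈ S, vertexType σ (toTorus n v) = t v) ↔
      ∀ v ∈ S, vertexType σ (toTorus n v) = s (toTorus n v) :=
    forall₂_congr fun v hv => by rw [hs v hv]
  simp only [this]

end Boltzmann

/-! ### Fourier analysis of the torus matrix -/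

/-- The determinant of the symbol of the torus matrix. -/
def symbolDet (a b c d z₁ z₂ : ℂ) : ℂ := (1 + a * z₁) * (1 + b * z₂) - c * d * z₁ * z₂

/-- The symbol of the torus matrix. -/
def symbol (a b c d z₁ z₂ : ℂ) : Matrix Bool Bool ℂ := fun k k' =>
  bif k then (bif k' then 1 + b * z₂ else c * z₁) else (bif k' then d * z₂ else 1 + a * z₁)

/-- The adjugate of the symbol of the torus matrix. -/
def symbolAdj (a b c d z₁ z₂ : ℂ) (k k' : Bool) : ℂ :=
  bif k then (bif k' then 1 + a * z₁ else -(c * z₁)) else (bif k' then -(d * z₂) else 1 + b * z₂)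

theorem det_symbol (a b c d z₁ z₂ : ℂ) :
    (symbol a b c d z₁ z₂).det = symbolDet a b c d z₁ z₂ := by
  rw [← Matrix.det_submatrix_equiv_self finTwoEquiv, Matrix.det_fin_two]
  simp [symbol, symbolDet, finTwoEquiv]
  ring

section Fourier

variable {n : ℕ} [NeZero n]

/-- The character of the torus with frequency `j`. -/
noncomputable def character (j v : ZMod n × ZMod n) : ℂ :=
  ZMod.stdAddChar (j.1 * v.1) * ZMod.stdAddChar (j.2 * v.2)

theorem character_add (j v v' : ZMod n × ZMod n) :
    character j (v + v') = character j v * character j v' := by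
  simp only [character, Prod.fst_add, Prod.snd_add, mul_add, AddChar.map_add_eq_mul]
  ring

theorem character_comm (j v : ZMod n × ZMod n) : character j v = character v j := by
  unfold character
  rw [mul_comm j.1, mul_comm j.2]

theorem character_east (j : ZMod n × ZMod n) : character j (1, 0) = ZMod.stdAddChar j.1 := by
  simp [character]

theorem character_north (j : ZMod n × ZMod n) : character j (0, 1) = ZMod.stdAddChar j.2 := by
  simp [character]

theorem sum_character (v : ZMod n × ZMod n) :
    ∑ j, character j v = if v = 0 then (n : ℂ) ^ 2 else 0 := by
  unfold character
  rw [Fintype.sum_prod_type]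
  simp only
  rw [← Fintype.sum_mul_sum, AddChar.sum_mulShift _ (ZMod.isPrimitive_stdAddChar n),
    AddChar.sum_mulShift _ (ZMod.isPrimitive_stdAddChar n), ZMod.card]
  obtain ⟨x, y⟩ := v
  by_cases hx : x = 0 <;> by_cases hy : y = 0 <;> simp [hx, hy, sq]

theorem sum_character_left (j : ZMod n × ZMod n) :
    ∑ v, character j v = if j = 0 then (n : ℂ) ^ 2 else 0 := by
  rw [← sum_character j]
  exact Finset.sum_congr rfl fun v _ => character_comm j v

theorem baseRow_dot (a b c d w₁ w₂ : ℂ) (v : ZMod n × ZMod n) (k : Bool) (φ : Edge n → ℂ) :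
    ∑ e, baseRow a b c d w₁ w₂ v k e * φ e = φ (v, k) +
      (bif k then c else a) * w₁ * φ (v + (1, 0), false) +
      (bif k then b else d) * w₂ * φ (v + (0, 1), true) := by
  cases k <;>
  · simp only [baseRow, cond_true, cond_false, Pi.add_apply, Pi.smul_apply, smul_eq_mul, add_mul,
      Finset.sum_add_distrib, outEdge, mul_assoc]
    simp only [← Finset.mul_sum, Pi.single_apply, ite_mul, one_mul, zero_mul,
      Finset.sum_ite_eq', Finset.mem_univ, if_true]
    ring

theorem torusMatrix_empty_mul (a b c d w₁ w₂ : ℂ) (s : ZMod n × ZMod n → VertexType)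
    {ι : Type*} (Φ : Matrix (Edge n) ι ℂ) (e : Edge n) (i : ι) :
    (torusMatrix a b c d w₁ w₂ ∅ s * Φ) e i = Φ e i +
      (bif e.2 then c else a) * w₁ * Φ (e.1 + (1, 0), false) i +
      (bif e.2 then b else d) * w₂ * Φ (e.1 + (0, 1), true) i := by
  rw [Matrix.mul_apply]
  refine Eq.trans (Finset.sum_congr rfl fun e' _ => ?_)
    (baseRow_dot a b c d w₁ w₂ e.1 e.2 fun e => Φ e i)
  simp [torusMatrix]

/-- The matrix of plane waves. -/
noncomputable def planeWaves (n : ℕ) [NeZero n] : Matrix (Edge n) (Edge n) ℂ :=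
  fun e j => if e.2 = j.2 then character j.1 e.1 else 0

theorem det_planeWaves_ne_zero : (planeWaves n).det ≠ 0 := by
  have hn : (n : ℂ) ≠ 0 := Nat.cast_ne_zero.2 (NeZero.ne n)
  let F' : Matrix (Edge n) (Edge n) ℂ :=
    fun j e => if e.2 = j.2 then character (-j.1) e.1 else 0
  have h1 : F' * planeWaves n = ((n : ℂ) ^ 2) • (1 : Matrix (Edge n) (Edge n) ℂ) := by
    ext ⟨j, k⟩ ⟨j', k'⟩
    rw [Matrix.mul_apply, Fintype.sum_prod_type, Matrix.smul_apply, Matrix.one_apply]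
    simp only [F', planeWaves, ite_mul, mul_ite, mul_zero, zero_mul, Fintype.sum_bool]
    have h2 : ∀ v, character (-j) v * character j' v = character (j' - j) v := by
      intro v
      rw [character_comm, character_comm j', ← character_add, character_comm, neg_add_eq_sub]
    simp only [h2]
    have h3 : (j' - j = 0) ↔ j = j' := by rw [sub_eq_zero, eq_comm]
    cases k <;> cases k' <;> simp [sum_character_left, h3]
  intro h
  have h2 := congrArg Matrix.det h1
  rw [Matrix.det_mul, h, mul_zero, Matrix.det_smul, Matrix.det_one, mul_one] at h2
  exact pow_ne_zero _ (pow_ne_zero _ hn) h2.symm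

/-- The determinant of the torus matrix is the product of the determinants of its symbol. -/
theorem det_torusMatrix_empty (a b c d w₁ w₂ : ℂ) (s : ZMod n × ZMod n → VertexType) :
    (torusMatrix a b c d w₁ w₂ ∅ s).det = ∏ j : ZMod n × ZMod n,
      symbolDet a b c d (w₁ * ZMod.stdAddChar j.1) (w₂ * ZMod.stdAddChar j.2) := by
  let B : ZMod n × ZMod n → Matrix Bool Bool ℂ := fun j =>
    symbol a b c d (w₁ * ZMod.stdAddChar j.1) (w₂ * ZMod.stdAddChar j.2)
  let D : Matrix (Edge n) (Edge n) ℂ :=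
    (Matrix.blockDiagonal B).submatrix (Equiv.prodComm _ _) (Equiv.prodComm _ _)
  have h1 : torusMatrix a b c d w₁ w₂ ∅ s * planeWaves n = planeWaves n * D := by
    ext ⟨v, k⟩ ⟨j, k'⟩
    rw [torusMatrix_empty_mul, Matrix.mul_apply, Fintype.sum_prod_type]
    simp only [planeWaves, D, Matrix.submatrix_apply, Equiv.prodComm_apply, Prod.swap_prod_mk,
      Matrix.blockDiagonal_apply, ite_mul, zero_mul, mul_ite, mul_zero, Fintype.sum_bool, B,
      character_add, character_east, character_north]
    cases k <;> cases k' <;> simp [symbol] <;> ring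
  have h2 := congrArg Matrix.det h1
  rw [Matrix.det_mul, Matrix.det_mul, mul_comm] at h2
  rw [mul_left_cancel₀ det_planeWaves_ne_zero h2]
  simp only [D]
  rw [Matrix.det_submatrix_equiv_self, Matrix.det_blockDiagonal]
  exact Finset.prod_congr rfl fun j _ => det_symbol _ _ _ _ _ _

/-- The entries of the inverse of the torus matrix, as a function of the displacement. -/
noncomputable def green (n : ℕ) [NeZero n] (a b c d w₁ w₂ : ℂ) (v : ZMod n × ZMod n)
    (k k' : Bool) : ℂ :=
  (∑ j : ZMod n × ZMod n, character j v *
    (symbolAdj a b c d (w₁ * ZMod.stdAddChar j.1) (w₂ * ZMod.stdAddChar j.2) k k' /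
      symbolDet a b c d (w₁ * ZMod.stdAddChar j.1) (w₂ * ZMod.stdAddChar j.2))) / (n : ℂ) ^ 2

/-- The Fourier series `green` inverts the torus matrix, if the symbol is invertible at all
frequencies. -/
theorem torusMatrix_mul_green {a b c d w₁ w₂ : ℂ} (s : ZMod n × ZMod n → VertexType)
    (hΔ : ∀ j : ZMod n × ZMod n,
      symbolDet a b c d (w₁ * ZMod.stdAddChar j.1) (w₂ * ZMod.stdAddChar j.2) ≠ 0) :
    torusMatrix a b c d w₁ w₂ ∅ s *
      (Matrix.of fun e e' : Edge n => green n a b c d w₁ w₂ (e.1 - e'.1) e.2 e'.2) = 1 := by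
  have hn : (n : ℂ) ≠ 0 := Nat.cast_ne_zero.2 (NeZero.ne n)
  ext ⟨v, k⟩ ⟨v', k'⟩
  rw [torusMatrix_empty_mul]
  simp only [Matrix.of_apply, green, add_sub_right_comm v, character_add, character_east,
    character_north]
  rw [mul_div_assoc', mul_div_assoc', ← add_div, ← add_div, Finset.mul_sum, Finset.mul_sum,
    ← Finset.sum_add_distrib, ← Finset.sum_add_distrib]
  have h1 : ∀ j : ZMod n × ZMod n, character j (v - v') *
        (symbolAdj a b c d (w₁ * ZMod.stdAddChar j.1) (w₂ * ZMod.stdAddChar j.2) k k' /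
          symbolDet a b c d (w₁ * ZMod.stdAddChar j.1) (w₂ * ZMod.stdAddChar j.2)) +
      (bif k then c else a) * w₁ * (character j (v - v') * ZMod.stdAddChar j.1 *
        (symbolAdj a b c d (w₁ * ZMod.stdAddChar j.1) (w₂ * ZMod.stdAddChar j.2) false k' /
          symbolDet a b c d (w₁ * ZMod.stdAddChar j.1) (w₂ * ZMod.stdAddChar j.2))) +
      (bif k then b else d) * w₂ * (character j (v - v') * ZMod.stdAddChar j.2 *
        (symbolAdj a b c d (w₁ * ZMod.stdAddChar j.1) (w₂ * ZMod.stdAddChar j.2) true k' /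
          symbolDet a b c d (w₁ * ZMod.stdAddChar j.1) (w₂ * ZMod.stdAddChar j.2))) =
      character j (v - v') * if k = k' then 1 else 0 := by
    intro j
    have h2 := hΔ j
    set z₁ := w₁ * ZMod.stdAddChar j.1 with hz₁
    set z₂ := w₂ * ZMod.stdAddChar j.2 with hz₂
    have h3 : symbolAdj a b c d z₁ z₂ k k' + (bif k then c else a) * z₁ *
        symbolAdj a b c d z₁ z₂ false k' + (bif k then b else d) * z₂ *
        symbolAdj a b c d z₁ z₂ true k' = symbolDet a b c d z₁ z₂ * if k = k' then 1 else 0 := by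
      unfold symbolAdj symbolDet
      cases k <;> cases k' <;> simp <;> ring
    calc _ = character j (v - v') * ((symbolAdj a b c d z₁ z₂ k k' + (bif k then c else a) * z₁ *
        symbolAdj a b c d z₁ z₂ false k' + (bif k then b else d) * z₂ *
        symbolAdj a b c d z₁ z₂ true k') / symbolDet a b c d z₁ z₂) := by
          rw [hz₁, hz₂]; ring
      _ = _ := by rw [h3, mul_div_cancel_left₀ _ h2]
  rw [Finset.sum_congr rfl fun j _ => h1 j, ← Finset.sum_mul, sum_character, Matrix.one_apply]
  simp only [sub_eq_zero, Prod.mk.injEq]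
  by_cases hv : v = v' <;> by_cases hk : k = k' <;> simp [hv, hk, hn]

/-- Prescribing types on `S` multiplies the determinant of the torus matrix by a minor of the
inverse. -/
theorem det_torusMatrix_eq_mul {a b c d w₁ w₂ : ℂ} (S : Finset (ZMod n × ZMod n))
    (s : ZMod n × ZMod n → VertexType)
    (hΔ : ∀ j : ZMod n × ZMod n,
      symbolDet a b c d (w₁ * ZMod.stdAddChar j.1) (w₂ * ZMod.stdAddChar j.2) ≠ 0) :
    (torusMatrix a b c d w₁ w₂ S s).det = (torusMatrix a b c d w₁ w₂ ∅ s).det *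
      Matrix.det (Matrix.of fun e e' : {e : Edge n // e.1 ∈ S} =>
        (bif e.1.2 then 1 else vertexWeight a b c d (s e.1.1) * twist w₁ w₂ (s e.1.1)) *
          green n a b c d w₁ w₂ ((step (s e.1.1) e.1.1 e.1.2).1 - e'.1.1)
            (step (s e.1.1) e.1.1 e.1.2).2 e'.1.2) := by
  have hTG := torusMatrix_mul_green s hΔ
  set G : Matrix (Edge n) (Edge n) ℂ :=
    Matrix.of fun e e' : Edge n => green n a b c d w₁ w₂ (e.1 - e'.1) e.2 e'.2 with hG
  have h1 : (torusMatrix a b c d w₁ w₂ ∅ s).det * G.det = 1 := by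
    rw [← Matrix.det_mul, hTG, Matrix.det_one]
  have hrow : ∀ e : Edge n, e.1 ∉ S → ∀ e',
      (torusMatrix a b c d w₁ w₂ S s * G) e e' = (1 : Matrix (Edge n) (Edge n) ℂ) e e' := by
    intro e he e'
    rw [← hTG, Matrix.mul_apply, Matrix.mul_apply]
    simp [torusMatrix, he]
  have h2 := Matrix.twoBlockTriangular_det (torusMatrix a b c d w₁ w₂ S s * G)
    (fun e => e.1 ∈ S) (by
      intro e he e' he'
      rw [hrow e he, Matrix.one_apply_ne]
      rintro rfl
      exact he he')
  have h3 : (torusMatrix a b c d w₁ w₂ S s * G).toSquareBlockProp (fun e => ¬ e.1 ∈ S) = 1 := by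
    ext ⟨e, he⟩ ⟨e', he'⟩
    simp [Matrix.toSquareBlockProp, hrow e he, Matrix.one_apply]
  rw [h3, Matrix.det_one, mul_one, Matrix.det_mul] at h2
  have h4 : (torusMatrix a b c d w₁ w₂ S s * G).toSquareBlockProp (fun e => e.1 ∈ S) =
      Matrix.of fun e e' : {e : Edge n // e.1 ∈ S} =>
        (bif e.1.2 then 1 else vertexWeight a b c d (s e.1.1) * twist w₁ w₂ (s e.1.1)) *
          green n a b c d w₁ w₂ ((step (s e.1.1) e.1.1 e.1.2).1 - e'.1.1)
            (step (s e.1.1) e.1.1 e.1.2).2 e'.1.2 := by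
    ext ⟨e, he⟩ ⟨e', he'⟩
    change (torusMatrix a b c d w₁ w₂ S s * G) e e' = _
    rw [Matrix.mul_apply]
    have h5 : ∀ e'', torusMatrix a b c d w₁ w₂ S s e e'' =
        (bif e.2 then 1 else vertexWeight a b c d (s e.1) * twist w₁ w₂ (s e.1)) *
          if e'' = step (s e.1) e.1 e.2 then 1 else 0 := by
      intro e''
      simp [torusMatrix, he, fixedRow, Pi.single_apply]
    simp only [h5, mul_assoc]
    rw [← Finset.mul_sum]
    simp [hG]
  rw [← h4, ← h2]
  calc _ = (torusMatrix a b c d w₁ w₂ S s).det *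
        ((torusMatrix a b c d w₁ w₂ ∅ s).det * G.det) := by rw [h1, mul_one]
    _ = _ := by ring

omit [NeZero n] in
theorem step_toTorus (t : VertexType) (u : ℤ × ℤ) (k : Bool) :
    step t (toTorus n u) k = (toTorus n (step t u k).1, (step t u k).2) := by
  cases t <;> cases k <;> simp [step, outEdge, toTorus]

/-- The minor of the inverse of the torus matrix, in coordinates of the square lattice. -/
noncomputable def greenMinor (n : ℕ) [NeZero n] (a b c d w₁ w₂ : ℂ) (S : Finset (ℤ × ℤ))
    (t : ℤ × ℤ → VertexType) : Matrix (S × Bool) (S × Bool) ℂ :=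
  Matrix.of fun e e' =>
    (bif e.2 then 1 else vertexWeight a b c d (t e.1) * twist w₁ w₂ (t e.1)) *
      green n a b c d w₁ w₂ (toTorus n ((step (t e.1) e.1.1 e.2).1 - e'.1.1))
        (step (t e.1) e.1.1 e.2).2 e'.2

theorem det_torusMatrix_eq_mul_greenMinor {a b c d w₁ w₂ : ℂ} (S : Finset (ℤ × ℤ))
    (hS : Set.InjOn (toTorus n) S) (t : ℤ × ℤ → VertexType) (s : ZMod n × ZMod n → VertexType)
    (hs : ∀ v ∈ S, s (toTorus n v) = t v)
    (hΔ : ∀ j : ZMod n × ZMod n,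
      symbolDet a b c d (w₁ * ZMod.stdAddChar j.1) (w₂ * ZMod.stdAddChar j.2) ≠ 0) :
    (torusMatrix a b c d w₁ w₂ (S.image (toTorus n)) s).det =
      (torusMatrix a b c d w₁ w₂ ∅ s).det * (greenMinor n a b c d w₁ w₂ S t).det := by
  classical
  rw [det_torusMatrix_eq_mul _ s hΔ]
  congr 1
  let f : S × Bool → {e : Edge n // e.1 ∈ S.image (toTorus n)} := fun e =>
    ⟨(toTorus n e.1.1, e.2), Finset.mem_image_of_mem _ e.1.2⟩
  have hf : Function.Bijective f := by
    constructor
    · rintro ⟨⟨u, hu⟩, k⟩ ⟨⟨u', hu'⟩, k'⟩ h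
      simp only [f, Subtype.mk.injEq, Prod.mk.injEq] at h
      have := hS hu hu' h.1
      subst this
      simp [h.2]
    · rintro ⟨⟨v, k⟩, h⟩
      obtain ⟨u, hu, rfl⟩ := Finset.mem_image.1 h
      exact ⟨(⟨u, hu⟩, k), rfl⟩
  rw [← Matrix.det_submatrix_equiv_self (Equiv.ofBijective f hf)]
  congr 1
  ext ⟨⟨u, hu⟩, k⟩ ⟨⟨u', hu'⟩, k'⟩
  simp only [Matrix.submatrix_apply, Equiv.ofBijective_apply, f, Matrix.of_apply, greenMinor,
    hs u hu, step_toTorus]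
  congr 2
  simp [toTorus]

end Fourier

/-! ### Averages over roots of unity -/

section Roots

variable {n : ℕ} [NeZero n]

theorem norm_stdAddChar (j : ZMod n) : ‖(ZMod.stdAddChar j : ℂ)‖ = 1 :=
  AddChar.norm_apply ZMod.stdAddChar j

theorem stdAddChar_ne_zero (j : ZMod n) : (ZMod.stdAddChar j : ℂ) ≠ 0 := by
  rw [← norm_ne_zero_iff, norm_stdAddChar]; exact one_ne_zero

theorem stdAddChar_pow_card (j : ZMod n) : (ZMod.stdAddChar j : ℂ) ^ n = 1 := by
  rw [← AddChar.map_nsmul_eq_pow]; simp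

theorem stdAddChar_zpow (j : ZMod n) (b : ℤ) :
    (ZMod.stdAddChar j : ℂ) ^ b = ZMod.stdAddChar (j * (b : ZMod n)) := by
  rw [← AddChar.map_zsmul_eq_zpow, zsmul_eq_mul, mul_comm]

theorem sum_zpow_roots (w : ℂ) (b : ℤ) :
    ∑ j : ZMod n, (w * ZMod.stdAddChar j) ^ b = if (n : ℤ) ∣ b then (n : ℂ) * w ^ b else 0 := by
  simp only [mul_zpow, stdAddChar_zpow]
  rw [← Finset.mul_sum, AddChar.sum_mulShift _ (ZMod.isPrimitive_stdAddChar n), ZMod.card]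
  simp only [ZMod.intCast_zmod_eq_zero_iff_dvd]
  split_ifs <;> simp [mul_comm]

/-- The average of `z ^ b / (A + B z)` over the `n`-th roots `z` of `w ^ n`. -/
noncomputable def rootAvg (n : ℕ) [NeZero n] (w : ℂ) (b : ℤ) (A B : ℂ) : ℂ :=
  (∑ j : ZMod n, (w * ZMod.stdAddChar j) ^ b / (A + B * (w * ZMod.stdAddChar j))) / n

/-- Exchanging the roles of `A` and `B` by inverting the roots. -/
theorem rootAvg_swap {w : ℂ} (hw : w ≠ 0) (b : ℤ) (A B : ℂ) :
    rootAvg n w b A B = rootAvg n w⁻¹ (1 - b) B A := by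
  unfold rootAvg
  congr 1
  rw [← Equiv.sum_comp (Equiv.neg (ZMod n))]
  refine Finset.sum_congr rfl fun j _ => ?_
  have h1 : (ZMod.stdAddChar (Equiv.neg (ZMod n) j) : ℂ) = (ZMod.stdAddChar j : ℂ)⁻¹ := by
    rw [Equiv.neg_apply, AddChar.map_neg_eq_inv]
  rw [h1]
  have h2 : w * (ZMod.stdAddChar j : ℂ)⁻¹ = (w⁻¹ * ZMod.stdAddChar j)⁻¹ := by
    rw [mul_inv, inv_inv]
  rw [h2]
  have hz : w⁻¹ * (ZMod.stdAddChar j : ℂ) ≠ 0 := mul_ne_zero (inv_ne_zero hw) (stdAddChar_ne_zero j)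
  generalize w⁻¹ * (ZMod.stdAddChar j : ℂ) = z at *
  have h3 : A + B * z⁻¹ = (B + A * z) * z⁻¹ := by field_simp; ring
  rw [h3, zpow_sub₀ hz, zpow_one, inv_zpow, div_mul_eq_div_div, div_inv_eq_mul]
  ring

theorem rootAvg_neg {w A B : ℂ} (hw : w ≠ 0) (hA : A ≠ 0) (hε : w ^ n * (-B / A) ^ n ≠ 1) {m : ℕ}
    (hm : m < n) :
    rootAvg n w (-m) A B = (-B / A) ^ m / (1 - w ^ n * (-B / A) ^ n) / A := by
  set t := -B / A with ht
  have hn : (n : ℂ) ≠ 0 := Nat.cast_ne_zero.2 (NeZero.ne n)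
  have hε' : 1 - w ^ n * t ^ n ≠ 0 := sub_ne_zero.2 (Ne.symm hε)
  have h1 : ∀ j : ZMod n, (w * ZMod.stdAddChar j) ^ (-m : ℤ) / (A + B * (w * ZMod.stdAddChar j)) =
      (∑ l ∈ Finset.range n, t ^ l * (w * ZMod.stdAddChar j) ^ ((l : ℤ) - m)) /
        (1 - w ^ n * t ^ n) / A := by
    intro j
    have hzn : (w * (ZMod.stdAddChar j : ℂ)) ^ n = w ^ n := by
      rw [mul_pow, stdAddChar_pow_card, mul_one]
    have hz : w * (ZMod.stdAddChar j : ℂ) ≠ 0 := mul_ne_zero hw (stdAddChar_ne_zero j)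
    generalize w * (ZMod.stdAddChar j : ℂ) = z at *
    have h2 := mul_neg_geom_sum (t * z) n
    rw [mul_pow, hzn, mul_comm (t ^ n)] at h2
    have h3 : A + B * z = A * (1 - t * z) := by rw [ht]; field_simp; ring
    have h4 : ∑ l ∈ Finset.range n, t ^ l * z ^ ((l : ℤ) - m) =
        z ^ (-m : ℤ) * ∑ l ∈ Finset.range n, (t * z) ^ l := by
      rw [Finset.mul_sum]
      refine Finset.sum_congr rfl fun l _ => ?_
      rw [mul_pow, sub_eq_neg_add, zpow_add₀ hz, zpow_natCast]
      ring
    have h5 : 1 - t * z ≠ 0 := by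
      intro h
      rw [h, zero_mul] at h2
      exact hε' h2.symm
    rw [h3, h4, ← h2]
    have h6 : ∑ l ∈ Finset.range n, (t * z) ^ l ≠ 0 := by
      intro h
      rw [h, mul_zero] at h2
      exact hε' h2.symm
    field_simp
  unfold rootAvg
  rw [Finset.sum_congr rfl fun j _ => h1 j, ← Finset.sum_div, ← Finset.sum_div, Finset.sum_comm]
  simp only [← Finset.mul_sum, sum_zpow_roots]
  rw [Finset.sum_eq_single m]
  · simp
    field_simp
  · intro l hl hlm
    rw [if_neg, mul_zero]
    rintro ⟨q, hq⟩
    have hl' := Finset.mem_range.1 hl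
    have h3 : q = 0 := by
      by_contra hq0
      rcases lt_or_gt_of_ne hq0 with h | h
      · have : (n : ℤ) * q ≤ -n := by nlinarith
        omega
      · have : (n : ℤ) ≤ n * q := by nlinarith
        omega
    rw [h3] at hq
    omega
  · intro h
    exact absurd (Finset.mem_range.2 hm) h

theorem rootAvg_pos {w A B : ℂ} (hw : w ≠ 0) (hA : A ≠ 0) (hε : w ^ n * (-B / A) ^ n ≠ 1) {m : ℕ}
    (hm : m < n) :
    rootAvg n w (n - m) A B = w ^ n * ((-B / A) ^ m / (1 - w ^ n * (-B / A) ^ n) / A) := by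
  rw [← rootAvg_neg hw hA hε hm]
  unfold rootAvg
  rw [mul_div_assoc', Finset.mul_sum]
  congr 1
  refine Finset.sum_congr rfl fun j _ => ?_
  have hzn : (w * (ZMod.stdAddChar j : ℂ)) ^ n = w ^ n := by
    rw [mul_pow, stdAddChar_pow_card, mul_one]
  have hz : w * (ZMod.stdAddChar j : ℂ) ≠ 0 := mul_ne_zero hw (stdAddChar_ne_zero j)
  rw [sub_eq_add_neg, zpow_add₀ hz, zpow_natCast, hzn]
  ring

theorem prod_add_roots (w A B : ℂ) :
    ∏ j : ZMod n, (A + B * (w * ZMod.stdAddChar j)) = A ^ n - w ^ n * (-B) ^ n := by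
  have hn : 0 < n := Nat.pos_of_ne_zero (NeZero.ne n)
  have h1 := Complex.isPrimitiveRoot_exp n hn.ne'
  have h2 := h1.pow_sub_pow_eq_prod_sub_mul A (-(B * w)) hn
  have h3 : Finset.univ.image (fun j : ZMod n => (ZMod.stdAddChar j : ℂ)) =
      Polynomial.nthRootsFinset n (1 : ℂ) := by
    refine Finset.eq_of_subset_of_card_le ?_ ?_
    · intro z hz
      obtain ⟨j, -, rfl⟩ := Finset.mem_image.1 hz
      rw [Polynomial.mem_nthRootsFinset hn]
      exact stdAddChar_pow_card j
    · rw [h1.card_nthRootsFinset, Finset.card_image_of_injective _ ZMod.injective_stdAddChar,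
        Finset.card_univ, ZMod.card]
  rw [← h3, Finset.prod_image (fun _ _ _ _ h => ZMod.injective_stdAddChar h)] at h2
  have h4 : (-(B * w)) ^ n = w ^ n * (-B) ^ n := by rw [← mul_pow]; ring
  rw [h4] at h2
  rw [h2]
  refine Finset.prod_congr rfl fun j _ => ?_
  ring

theorem norm_rootAvg_le_aux {w A B : ℂ} {g : ℝ} (hw : w ≠ 0) (hg : 0 < g) (hA : A ≠ 0)
    (hBA : ‖B‖ ≤ ‖A‖) (hε : ‖w ^ n‖ ≤ 2) (hgap : g * ‖A‖ ^ n ≤ ‖A ^ n - w ^ n * (-B) ^ n‖)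
    {b : ℤ} (hb : |b| < n) : ‖rootAvg n w b A B‖ ≤ 2 / (g * ‖A‖) := by
  have hA' : 0 < ‖A‖ := norm_pos_iff.2 hA
  set t := -B / A with ht
  have ht1 : ‖t‖ ≤ 1 := by
    rw [ht, norm_div, norm_neg]; exact (div_le_one hA').2 hBA
  have h1 : A ^ n - w ^ n * (-B) ^ n = A ^ n * (1 - w ^ n * t ^ n) := by
    rw [ht, div_pow]; field_simp
  rw [h1, norm_mul, norm_pow, mul_comm] at hgap
  have h2 : g ≤ ‖1 - w ^ n * t ^ n‖ := le_of_mul_le_mul_left hgap (by positivity)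
  have h3 : w ^ n * t ^ n ≠ 1 := by
    intro h
    rw [h, sub_self, norm_zero] at h2
    exact absurd hg (not_lt.2 h2)
  have h4 : ∀ m : ℕ, ‖t ^ m / (1 - w ^ n * t ^ n) / A‖ ≤ 1 / (g * ‖A‖) := by
    intro m
    rw [norm_div, norm_div, norm_pow, div_div]
    have : ‖t‖ ^ m ≤ 1 := pow_le_one₀ (norm_nonneg _) ht1
    gcongr
  have h5 : (0 : ℝ) ≤ 1 / (g * ‖A‖) := by positivity
  have h6 : 2 / (g * ‖A‖) = 2 * (1 / (g * ‖A‖)) := by ring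
  rw [abs_lt] at hb
  rcases le_or_gt b 0 with hb0 | hb0
  · obtain ⟨m, hm⟩ := Int.eq_ofNat_of_zero_le (neg_nonneg.2 hb0)
    have hb' : b = -(m : ℤ) := by omega
    rw [hb', rootAvg_neg hw hA h3 (by omega), h6]
    linarith [h4 m]
  · obtain ⟨m, hm⟩ := Int.eq_ofNat_of_zero_le (show 0 ≤ (n : ℤ) - b by omega)
    have hb' : b = (n : ℤ) - m := by omega
    rw [hb', rootAvg_pos hw hA h3 (by omega), norm_mul, h6]
    exact mul_le_mul hε (h4 m) (norm_nonneg _) (by norm_num)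

omit [NeZero n] in
theorem gap_swap {w A B : ℂ} {g : ℝ} (hw : w ≠ 0) (hε : ‖w ^ n‖ ≤ 2)
    (hgap : g * ‖B‖ ^ n ≤ ‖A ^ n - w ^ n * (-B) ^ n‖) :
    g / 2 * ‖B‖ ^ n ≤ ‖B ^ n - w⁻¹ ^ n * (-A) ^ n‖ := by
  have h1 : B ^ n - w⁻¹ ^ n * (-A) ^ n = -((-1) ^ n * (w ^ n)⁻¹) * (A ^ n - w ^ n * (-B) ^ n) := by
    have h2 : ((-1 : ℂ) ^ n) * (-1) ^ n = 1 := by rw [← mul_pow]; simp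
    have hwn : w ^ n ≠ 0 := pow_ne_zero _ hw
    rw [inv_pow, neg_pow A, neg_pow B]
    field_simp
    linear_combination (-(B ^ n * w ^ n)) * h2
  have hwn : 0 < ‖w ^ n‖ := norm_pos_iff.2 (pow_ne_zero _ hw)
  rw [h1, norm_mul, norm_neg, norm_mul, norm_pow, norm_neg, norm_one, one_pow, one_mul, norm_inv]
  calc g / 2 * ‖B‖ ^ n = 2⁻¹ * (g * ‖B‖ ^ n) := by ring
    _ ≤ 2⁻¹ * ‖A ^ n - w ^ n * (-B) ^ n‖ := by gcongr
    _ ≤ _ := by gcongr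

/-- The averages over twisted roots of unity are bounded as soon as the product `A ^ n - w ^ n
(-B) ^ n` of the denominators is not small. -/
theorem norm_rootAvg_le {w A B : ℂ} {g : ℝ} (hw : w ≠ 0) (hg : 0 < g) (hAB : 0 < max ‖A‖ ‖B‖)
    (hε : ‖w ^ n‖ ≤ 2) (hε' : 1 / 2 ≤ ‖w ^ n‖)
    (hgap : g * max ‖A‖ ‖B‖ ^ n ≤ ‖A ^ n - w ^ n * (-B) ^ n‖)
    {b : ℤ} (hb : |b| + 1 < n) : ‖rootAvg n w b A B‖ ≤ 4 / (g * max ‖A‖ ‖B‖) := by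
  rcases le_or_gt ‖B‖ ‖A‖ with h | h
  · rw [max_eq_left h] at *
    refine (norm_rootAvg_le_aux hw hg (norm_pos_iff.1 hAB) h hε hgap (by omega)).trans ?_
    gcongr
    norm_num
  · rw [max_eq_right h.le] at *
    rw [rootAvg_swap hw]
    have h1 : |1 - b| < n := by
      have := abs_sub_comm 1 b
      rw [abs_lt]
      have h2 : |b| < (n : ℤ) - 1 := by omega
      rw [abs_lt] at h2
      constructor <;> omega
    have h2 : ‖w⁻¹ ^ n‖ ≤ 2 := by
      rw [inv_pow, norm_inv]
      exact (inv_anti₀ (by norm_num) hε').trans (by norm_num)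
    refine (norm_rootAvg_le_aux (inv_ne_zero hw) (half_pos hg) (norm_pos_iff.1 hAB) h.le h2
      (gap_swap hw hε hgap) h1).trans (le_of_eq ?_)
    field_simp
    norm_num

end Roots

/-- The average of `z ^ b / (A + B z)` over the unit circle. -/
noncomputable def circleAvg (b : ℤ) (A B : ℂ) : ℂ :=
  if ‖B‖ < ‖A‖ then (if b ≤ 0 then (-B / A) ^ (-b).toNat / A else 0)
  else (if 1 ≤ b then (-A / B) ^ (b - 1).toNat / B else 0)

theorem tendsto_mul_pow_atTop_zero {ε t : ℕ → ℂ} {t₀ : ℂ} (hε : ∀ n, ‖ε n‖ ≤ 2)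
    (ht : Tendsto t atTop (𝓝 t₀)) (ht₀ : ‖t₀‖ < 1) (l : ℕ) :
    Tendsto (fun n => ε n * t n ^ (n + 1 - l)) atTop (𝓝 0) := by
  obtain ⟨r, hr1, hr2⟩ := exists_between ht₀
  have hr0 : 0 ≤ r := (norm_nonneg _).trans hr1.le
  have h1 : ∀ᶠ n in atTop, ‖t n‖ < r := (ht.norm).eventually_lt_const hr1
  have h2 : Tendsto (fun n : ℕ => 2 * r ^ (n + 1 - l)) atTop (𝓝 (2 * 0)) := by
    refine Tendsto.const_mul _ ((tendsto_pow_atTop_nhds_zero_of_lt_one hr0 hr2).comp ?_)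
    exact (tendsto_sub_atTop_nat l).comp (tendsto_add_atTop_nat 1)
  rw [mul_zero] at h2
  refine squeeze_zero_norm' ?_ h2
  filter_upwards [h1] with n hn
  rw [norm_mul, norm_pow]
  exact mul_le_mul (hε n) (pow_le_pow_left₀ (norm_nonneg _) hn.le _) (by positivity) (by norm_num)

theorem tendsto_rootAvg_aux {w A B : ℕ → ℂ} {A₀ B₀ : ℂ} (hw : ∀ n, w n ≠ 0)
    (hε : ∀ n, ‖w n ^ (n + 1)‖ ≤ 2) (hA : Tendsto A atTop (𝓝 A₀)) (hB : Tendsto B atTop (𝓝 B₀))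
    (hBA : ‖B₀‖ < ‖A₀‖) (b : ℤ) :
    Tendsto (fun n => rootAvg (n + 1) (w n) b (A n) (B n)) atTop
      (𝓝 (if b ≤ 0 then (-B₀ / A₀) ^ (-b).toNat / A₀ else 0)) := by
  have hA₀ : A₀ ≠ 0 := norm_pos_iff.1 ((norm_nonneg _).trans_lt hBA)
  set t : ℕ → ℂ := fun n => -B n / A n with ht
  have htt : Tendsto t atTop (𝓝 (-B₀ / A₀)) := hB.neg.div hA hA₀
  have ht₀ : ‖-B₀ / A₀‖ < 1 := by
    rw [norm_div, norm_neg]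
    exact (div_lt_one (norm_pos_iff.2 hA₀)).2 hBA
  have hpow := tendsto_mul_pow_atTop_zero hε htt ht₀ 0
  have hden : Tendsto (fun n => 1 - w n ^ (n + 1) * t n ^ (n + 1)) atTop (𝓝 1) := by
    have := hpow.const_sub 1
    simpa using this
  have hA' : ∀ᶠ n in atTop, A n ≠ 0 := hA.eventually_ne hA₀
  have hne : ∀ᶠ n in atTop, 1 - w n ^ (n + 1) * t n ^ (n + 1) ≠ 0 := hden.eventually_ne one_ne_zero
  split_ifs with hb
  · obtain ⟨m, hm⟩ := Int.eq_ofNat_of_zero_le (neg_nonneg.2 hb)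
    have hb' : b = -(m : ℤ) := by omega
    have h1 : Tendsto (fun n => t n ^ m / (1 - w n ^ (n + 1) * t n ^ (n + 1)) / A n) atTop
        (𝓝 ((-B₀ / A₀) ^ m / 1 / A₀)) := ((htt.pow m).div hden one_ne_zero).div hA hA₀
    rw [hm, Int.toNat_natCast]
    rw [div_one] at h1
    refine h1.congr' ?_
    filter_upwards [hA', hne, eventually_ge_atTop m] with n h2 h3 h4
    rw [hb', rootAvg_neg (hw n) h2 (fun h => h3 (sub_eq_zero.2 h.symm)) (by omega)]
  · obtain ⟨m, hm⟩ := Int.eq_ofNat_of_zero_le (show 0 ≤ b by omega)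
    have hb' : b = (m : ℤ) := by omega
    have h1 : Tendsto (fun n => w n ^ (n + 1) * t n ^ (n + 1 - m) /
        (1 - w n ^ (n + 1) * t n ^ (n + 1)) / A n) atTop (𝓝 (0 / 1 / A₀)) :=
      ((tendsto_mul_pow_atTop_zero hε htt ht₀ m).div hden one_ne_zero).div hA hA₀
    rw [zero_div, zero_div] at h1
    refine h1.congr' ?_
    filter_upwards [hA', hne, eventually_ge_atTop m] with n h2 h3 h4
    have h5 : b = ((n + 1 : ℕ) : ℤ) - ((n + 1 - m : ℕ) : ℤ) := by omega
    rw [h5, rootAvg_pos (hw n) h2 (fun h => h3 (sub_eq_zero.2 h.symm)) (by omega)]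
    ring

/-- The averages over roots of unity tend to the average over the circle. -/
theorem tendsto_rootAvg {w A B : ℕ → ℂ} {A₀ B₀ : ℂ} (hw : ∀ n, w n ≠ 0)
    (hε : ∀ n, ‖w n ^ (n + 1)‖ ≤ 2) (hε' : ∀ n, 1 / 2 ≤ ‖w n ^ (n + 1)‖)
    (hA : Tendsto A atTop (𝓝 A₀)) (hB : Tendsto B atTop (𝓝 B₀)) (hBA : ‖B₀‖ ≠ ‖A₀‖) (b : ℤ) :
    Tendsto (fun n => rootAvg (n + 1) (w n) b (A n) (B n)) atTop (𝓝 (circleAvg b A₀ B₀)) := by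
  unfold circleAvg
  split_ifs with h h1 h2
  · simpa [h1] using tendsto_rootAvg_aux hw hε hA hB h b
  · simpa [h1] using tendsto_rootAvg_aux hw hε hA hB h b
  all_goals
    have h3 : ‖A₀‖ < ‖B₀‖ := lt_of_le_of_ne (not_lt.1 h) (Ne.symm hBA)
    have h4 := tendsto_rootAvg_aux (w := fun n => (w n)⁻¹) (fun n => inv_ne_zero (hw n))
      (fun n => by
        rw [inv_pow, norm_inv]
        exact (inv_anti₀ (by norm_num) (hε' n)).trans (by norm_num)) hB hA h3 (1 - b)
    simp only [← rootAvg_swap (hw _)] at h4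
  · have h5 : 1 - b ≤ 0 := by omega
    rw [if_pos h5, neg_sub] at h4
    exact h4
  · have h5 : ¬ (1 - b ≤ 0) := by omega
    rwa [if_neg h5] at h4

/-! ### Riemann sums over the circle -/

/-- The point of the unit circle with angle `2 π x`. -/
noncomputable def circlePt (x : ℝ) : ℂ := Complex.exp (2 * Real.pi * x * Complex.I)

theorem norm_circlePt (x : ℝ) : ‖circlePt x‖ = 1 := by
  have : (2 * Real.pi * x * Complex.I : ℂ) = ((2 * Real.pi * x : ℝ) : ℂ) * Complex.I := by
    push_cast; ring
  rw [circlePt, this, Complex.norm_exp_ofReal_mul_I]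

theorem continuous_circlePt : Continuous circlePt := by
  unfold circlePt; fun_prop

theorem stdAddChar_eq_circlePt {n : ℕ} [NeZero n] (j : ZMod n) :
    (ZMod.stdAddChar j : ℂ) = circlePt (j.val / n) := by
  have h : j = ((j.val : ℤ) : ZMod n) := by simp
  conv_lhs => rw [h]
  rw [ZMod.stdAddChar_coe, circlePt]
  congr 1
  push_cast
  ring

theorem sum_zmod_eq_sum_range {n : ℕ} [NeZero n] (f : ℕ → ℂ) :
    ∑ j : ZMod n, f j.val = ∑ i ∈ Finset.range n, f i := by
  refine Finset.sum_bij (fun j _ => j.val) ?_ ?_ ?_ ?_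
  · intro j _; exact Finset.mem_range.2 (ZMod.val_lt j)
  · intro j _ j' _ h; exact ZMod.val_injective n h
  · intro i hi
    exact ⟨(i : ZMod n), Finset.mem_univ _, ZMod.val_cast_of_lt (Finset.mem_range.1 hi)⟩
  · intro j _; rfl

/-- A Riemann sum as the integral of a step function. -/
theorem integral_floor {n : ℕ} (hn : 0 < n) (f : ℕ → ℂ) :
    ∫ x in (0 : ℝ)..1, f ⌊(n : ℝ) * x⌋₊ = (∑ i ∈ Finset.range n, f i) / n := by
  have hn' : (0 : ℝ) < n := Nat.cast_pos.2 hn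
  have key : ∀ k : ℕ, Set.EqOn (fun x : ℝ => f ⌊(n : ℝ) * x⌋₊) (fun _ => f k)
      (Set.Ioo (k / n : ℝ) ((k + 1 : ℕ) / n)) := by
    intro k x hx
    have h1 : (k : ℝ) ≤ n * x := by
      have := (div_lt_iff₀ hn').1 hx.1; linarith
    have h2 : n * x < (k : ℝ) + 1 := by
      have := (lt_div_iff₀ hn').1 hx.2; push_cast at this; linarith
    have h3 : ⌊(n : ℝ) * x⌋₊ = k := (Nat.floor_eq_iff (h1.trans' (Nat.cast_nonneg k))).2 ⟨h1, h2⟩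
    simp only [h3]
  have hle : ∀ k : ℕ, (k / n : ℝ) ≤ ((k + 1 : ℕ) / n : ℝ) := by
    intro k; push_cast; gcongr; linarith
  have hint : ∀ k : ℕ, ∫ x in (k / n : ℝ)..((k + 1 : ℕ) / n : ℝ), f ⌊(n : ℝ) * x⌋₊ = f k / n := by
    intro k
    rw [intervalIntegral.integral_congr_Ioo_of_le (hle k) (key k), intervalIntegral.integral_const]
    rw [Complex.real_smul]
    push_cast
    field_simp
    ring
  have hii : ∀ k < n, IntervalIntegrable (fun x : ℝ => f ⌊(n : ℝ) * x⌋₊) volume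
      ((fun k : ℕ => (k / n : ℝ)) k) ((fun k : ℕ => (k / n : ℝ)) (k + 1)) := by
    intro k _
    have h1 : IntervalIntegrable (fun _ : ℝ => f k) volume (k / n : ℝ) ((k + 1 : ℕ) / n : ℝ) :=
      intervalIntegrable_const
    refine h1.congr_uIoo ?_
    rw [Set.uIoo_of_le (hle k)]
    exact (key k).symm
  have h2 := intervalIntegral.sum_integral_adjacent_intervals hii
  simp only [Nat.cast_zero, zero_div, div_self hn'.ne'] at h2
  rw [← h2, Finset.sum_div]
  exact Finset.sum_congr rfl fun k _ => hint k

/-- Averages over the `n`-th roots of unity, rotated by angles tending to zero, tend to the average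
over the circle. -/
theorem tendsto_avg_roots {H : ℕ → ℂ → ℂ} {w : ℕ → ℂ} {h : ℝ → ℂ} {C : ℝ}
    (hw : Tendsto w atTop (𝓝 1))
    (hC : ∀ᶠ n in atTop, ∀ j : ZMod (n + 1), ‖H n (w n * ZMod.stdAddChar j)‖ ≤ C)
    (hH : ∀ᵐ x : ℝ, ∀ z : ℕ → ℂ, Tendsto z atTop (𝓝 (circlePt x)) →
      Tendsto (fun n => H n (z n)) atTop (𝓝 (h x))) :
    Tendsto (fun n : ℕ => (∑ j : ZMod (n + 1), H n (w n * ZMod.stdAddChar j)) / ((n + 1 : ℕ) : ℂ))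
      atTop (𝓝 (∫ x in (0 : ℝ)..1, h x)) := by
  have h1 : ∀ n : ℕ, (∑ j : ZMod (n + 1), H n (w n * ZMod.stdAddChar j)) / ((n + 1 : ℕ) : ℂ) =
      ∫ x in (0 : ℝ)..1,
        H n (w n * circlePt ((⌊((n + 1 : ℕ) : ℝ) * x⌋₊ : ℝ) / ((n + 1 : ℕ) : ℝ))) := by
    intro n
    rw [integral_floor (Nat.succ_pos n)
      (fun k : ℕ => H n (w n * circlePt ((k : ℝ) / ((n + 1 : ℕ) : ℝ)))), ← sum_zmod_eq_sum_range]
    simp only [stdAddChar_eq_circlePt]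
  simp only [h1]
  refine intervalIntegral.tendsto_integral_filter_of_dominated_convergence (fun _ => C) ?_ ?_
    intervalIntegrable_const ?_
  · refine Eventually.of_forall fun n => ?_
    refine Measurable.aestronglyMeasurable ?_
    exact (measurable_from_nat (f := fun k : ℕ =>
      H n (w n * circlePt ((k : ℝ) / ((n + 1 : ℕ) : ℝ))))).comp
      (Nat.measurable_floor.comp (measurable_const_mul _))
  · filter_upwards [hC] with n hn
    have hne : ∀ᵐ x : ℝ, x ≠ 1 := by simp [ae_iff]
    filter_upwards [hne] with x hx1 hx
    rw [Set.uIoc_of_le zero_le_one] at hx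
    have hlt : ⌊((n + 1 : ℕ) : ℝ) * x⌋₊ < n + 1 := by
      rw [Nat.floor_lt (by have := hx.1.le; positivity)]
      have : x < 1 := lt_of_le_of_ne hx.2 hx1
      have hn0 : (0 : ℝ) < ((n + 1 : ℕ) : ℝ) := by positivity
      nlinarith
    have := hn ((⌊((n + 1 : ℕ) : ℝ) * x⌋₊ : ℕ) : ZMod (n + 1))
    rwa [stdAddChar_eq_circlePt, ZMod.val_cast_of_lt hlt] at this
  · filter_upwards [hH] with x hx hx01
    rw [Set.uIoc_of_le zero_le_one] at hx01
    refine hx _ ?_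
    have h2 : Tendsto (fun n : ℕ => (⌊x * ((n + 1 : ℕ) : ℝ)⌋₊ : ℝ) / ((n + 1 : ℕ) : ℝ)) atTop
        (𝓝 x) := (tendsto_nat_floor_mul_div_atTop hx01.1.le).comp
          (tendsto_natCast_atTop_atTop.comp (tendsto_add_atTop_nat 1))
    have h3 := hw.mul ((continuous_circlePt.tendsto x).comp h2)
    rw [one_mul] at h3
    refine h3.congr fun n => ?_
    simp only [Function.comp_apply]
    rw [mul_comm x]

/-! ### Twists away from the zeros of a family of linear factors -/

/-- By the pigeonhole principle some point of an interval is far from the values of `f` on `s`. -/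
theorem exists_far_from_finset {ι : Type*} (s : Finset ι) (f : ι → ℝ) (N : ℕ) (hN : s.card ≤ N)
    {lo hi : ℝ} (h : lo < hi) :
    ∃ r, lo ≤ r ∧ r ≤ hi ∧ ∀ i ∈ s, (hi - lo) / (2 * (N + 1)) ≤ |f i - r| := by
  by_contra hcon
  push Not at hcon
  set δ := (hi - lo) / (N + 1) with hδ
  have hN1 : (0 : ℝ) < N + 1 := by positivity
  have hδ0 : 0 < δ := div_pos (sub_pos.2 h) hN1
  have hδ2 : (hi - lo) / (2 * (N + 1)) = δ / 2 := by rw [hδ]; field_simp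
  have h1 : ∀ k : Fin (N + 1), ∃ i ∈ s, |f i - (lo + (k + 1 / 2) * δ)| < δ / 2 := by
    intro k
    rw [← hδ2]
    have hk : ((k : ℕ) : ℝ) + 1 ≤ N + 1 := by exact_mod_cast k.2
    refine hcon _ ?_ ?_
    · have : 0 ≤ ((k : ℕ) + 1 / 2 : ℝ) * δ := by positivity
      linarith
    · have h2 : ((k : ℕ) + 1 / 2 : ℝ) * δ ≤ (N + 1) * δ := by
        apply mul_le_mul_of_nonneg_right _ hδ0.le; linarith
      have h3 : (N + 1 : ℝ) * δ = hi - lo := by rw [hδ]; field_simp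
      linarith
  choose i hi1 hi2 using h1
  have hinj : Function.Injective i := by
    intro k k' hkk
    by_contra hne
    have h2 := hi2 k
    have h3 := hi2 k'
    rw [← hkk] at h3
    rw [abs_lt] at h2 h3
    have h4 : ((k : ℕ) : ℝ) - (k' : ℕ) < 1 := by
      have : ((k : ℕ) - (k' : ℕ) : ℝ) * δ < 1 * δ := by linarith
      exact lt_of_mul_lt_mul_right this hδ0.le
    have h5 : ((k' : ℕ) : ℝ) - (k : ℕ) < 1 := by
      have : ((k' : ℕ) - (k : ℕ) : ℝ) * δ < 1 * δ := by linarith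
      exact lt_of_mul_lt_mul_right this hδ0.le
    have h6 : (k : ℕ) < k' + 1 := by
      have : ((k : ℕ) : ℝ) < (k' : ℕ) + 1 := by linarith
      exact_mod_cast this
    have h7 : (k' : ℕ) < k + 1 := by
      have : ((k' : ℕ) : ℝ) < (k : ℕ) + 1 := by linarith
      exact_mod_cast this
    exact hne (Fin.ext (by omega))
  have h2 := Finset.card_le_card_of_injOn i (s := Finset.univ) (t := s) (fun k _ => hi1 k)
    hinj.injOn
  rw [Finset.card_univ, Fintype.card_fin] at h2
  omega

/-- A twist `ε` keeps `a - ε b` away from zero if it is not close to the zero `a / b`; this zero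
matters only if `a` and `b` are comparable. -/
theorem gap_of_far {a b ε : ℂ} {g : ℝ} (hg0 : 0 ≤ g) (hg : g ≤ 1) (hε₁ : 1 / 2 ≤ ‖ε‖)
    (hε₂ : ‖ε‖ ≤ 2) (hfar : max ‖a‖ ‖b‖ < 4 * min ‖a‖ ‖b‖ → g ≤ ‖ε - a / b‖) :
    g / 4 * max ‖a‖ ‖b‖ ≤ ‖a - ε * b‖ := by
  have ha := norm_nonneg a
  have hb := norm_nonneg b
  have hεb : ‖ε * b‖ = ‖ε‖ * ‖b‖ := norm_mul _ _
  by_cases hbad : max ‖a‖ ‖b‖ < 4 * min ‖a‖ ‖b‖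
  · have h1 := hfar hbad
    have hb0 : 0 < ‖b‖ := by
      have h3 := min_le_right ‖a‖ ‖b‖
      have h4 := le_max_left ‖a‖ ‖b‖
      linarith
    have h2 : a - ε * b = -(b * (ε - a / b)) := by
      have : b ≠ 0 := norm_pos_iff.1 hb0
      field_simp
      ring
    rw [h2, norm_neg, norm_mul]
    have h3 : max ‖a‖ ‖b‖ / 4 ≤ ‖b‖ := by
      have h3 := min_le_right ‖a‖ ‖b‖
      linarith
    calc g / 4 * max ‖a‖ ‖b‖ = max ‖a‖ ‖b‖ / 4 * g := by ring
      _ ≤ ‖b‖ * ‖ε - a / b‖ := by gcongr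
  · rw [not_lt] at hbad
    have h1 := norm_sub_norm_le a (ε * b)
    have h2 := norm_sub_norm_le (ε * b) a
    rw [norm_sub_rev] at h2
    rw [hεb] at h1 h2
    rcases le_total ‖b‖ ‖a‖ with h | h
    · rw [min_eq_right h, max_eq_left h] at *
      nlinarith
    · rw [min_eq_left h, max_eq_right h] at *
      nlinarith

/-- Upper bound for a linear factor, normalized by `ε` when the linear term dominates. -/
theorem norm_factor_le {a b ε : ℂ} (hε₁ : 1 / 2 ≤ ‖ε‖) (hε₂ : ‖ε‖ ≤ 2) :
    ‖a - ε * b‖ ≤ ‖ε‖ ^ (if ‖a‖ < ‖b‖ then 1 else 0) *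
      (max ‖a‖ ‖b‖ + 2 * min ‖a‖ ‖b‖) := by
  have h1 : ‖a - ε * b‖ ≤ ‖a‖ + ‖ε‖ * ‖b‖ := (norm_sub_le _ _).trans (by rw [norm_mul])
  have ha := norm_nonneg a
  have hb := norm_nonneg b
  split_ifs with h
  · rw [max_eq_right h.le, min_eq_left h.le, pow_one]
    nlinarith
  · rw [not_lt] at h
    rw [max_eq_left h, min_eq_right h, pow_zero, one_mul]
    nlinarith

/-- A factor at an arbitrary twist is at most a factor at a reference twist with a gap, up to a
multiplicative error which is exponential in the ratio of the two terms. -/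
theorem factor_ratio_le {a b ε' : ℂ} {g : ℝ} (hg : 0 < g) (hε' : ‖ε'‖ = 1)
    (hab : 0 < max ‖a‖ ‖b‖) (hgap : g * max ‖a‖ ‖b‖ ≤ ‖a - ε' * b‖) :
    max ‖a‖ ‖b‖ + 2 * min ‖a‖ ‖b‖ ≤
      Real.exp ((4 + 4 * |Real.log (3 / g)|) * (min ‖a‖ ‖b‖ / max ‖a‖ ‖b‖)) * ‖a - ε' * b‖ := by
  set M := max ‖a‖ ‖b‖ with hM
  set y := min ‖a‖ ‖b‖ / M with hy
  have hmin : min ‖a‖ ‖b‖ = y * M := by rw [hy]; field_simp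
  have hy0 : 0 ≤ y := div_nonneg (le_min (norm_nonneg _) (norm_nonneg _)) hab.le
  have hy1 : y ≤ 1 := (div_le_one hab).2 min_le_max
  have hlog := abs_nonneg (Real.log (3 / g))
  rw [hmin]
  by_cases hy4 : y ≤ 1 / 4
  · have h1 : (1 - y) * M ≤ ‖a - ε' * b‖ := by
      have h1 := norm_sub_norm_le a (ε' * b)
      have h2 := norm_sub_norm_le (ε' * b) a
      rw [norm_sub_rev] at h2
      rw [norm_mul, hε', one_mul] at h1 h2
      have h3 : max ‖a‖ ‖b‖ - min ‖a‖ ‖b‖ ≤ ‖a - ε' * b‖ := by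
        rcases le_total ‖b‖ ‖a‖ with h | h
        · rw [min_eq_right h, max_eq_left h]; exact h1
        · rw [min_eq_left h, max_eq_right h]; exact h2
      rw [hmin, ← hM] at h3
      linarith
    have h2 : 1 + 4 * y ≤ Real.exp ((4 + 4 * |Real.log (3 / g)|) * y) := by
      have := Real.add_one_le_exp ((4 + 4 * |Real.log (3 / g)|) * y)
      nlinarith
    calc M + 2 * (y * M) ≤ (1 + 4 * y) * ((1 - y) * M) := by nlinarith [mul_nonneg hy0 hab.le]
      _ ≤ _ := by gcongr
  · rw [not_le] at hy4
    have h1 : 3 / g ≤ Real.exp ((4 + 4 * |Real.log (3 / g)|) * y) := by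
      rw [← Real.log_le_iff_le_exp (by positivity)]
      have := le_abs_self (Real.log (3 / g))
      nlinarith
    calc M + 2 * (y * M) ≤ 3 / g * (g * M) := by
          have : 3 / g * (g * M) = 3 * M := by field_simp
          nlinarith [mul_nonneg hy0 hab.le]
      _ ≤ _ := by gcongr

/-- If all but a bounded number of the linear factors `a j - ε b j` are dominated by one of their
two terms, then close to every twist of modulus one there is a circle of twists on which no
factor is small, and on this circle the product of the factors is bounded by its value at a
reference twist of modulus one, up to a power of `ε`. -/
theorem exists_good_circle (C₀ : ℝ) : ∃ g K : ℝ, 0 < g ∧ 0 < K ∧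
    ∀ (ι : Type) [Fintype ι] (a b : ι → ℂ), (∀ j, 0 < max ‖a j‖ ‖b j‖) →
      ∑ j, min ‖a j‖ ‖b j‖ / max ‖a j‖ ‖b j‖ ≤ C₀ →
      ∃ (m : ℕ) (ε' : ℂ), ‖ε'‖ = 1 ∧ ∀ ε₀ : ℂ, ‖ε₀‖ = 1 → ∃ R : ℝ, 0 < R ∧ R ≤ 1 / 4 ∧
        ∀ ε : ℂ, ‖ε - ε₀‖ = R → (∀ j, g * max ‖a j‖ ‖b j‖ ≤ ‖a j - ε * b j‖) ∧
          ∏ j, ‖a j - ε * b j‖ ≤ K * ‖ε‖ ^ m * ∏ j, ‖a j - ε' * b j‖ := by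
  classical
  set N := ⌈4 * C₀⌉₊ with hN
  set g : ℝ := (1 / 8) / (2 * (N + 1)) with hg
  have hN1 : (0 : ℝ) < N + 1 := by positivity
  have hg0 : 0 < g := by positivity
  have hg1 : g ≤ 1 := by
    rw [hg, div_le_one (by positivity)]
    have : (0 : ℝ) ≤ N := Nat.cast_nonneg N
    linarith
  set c := 4 + 4 * |Real.log (3 / (g / 4))| with hc
  have hc0 : 0 ≤ c := by positivity
  refine ⟨g / 4, Real.exp (c * C₀), by positivity, Real.exp_pos _, ?_⟩
  intro ι _ a b hab hsum
  -- each factor with two comparable terms contributes at least `1 / 4` to the sum, hence there are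
  -- at most `4 C₀` of them
  set bad := Finset.univ.filter fun j => max ‖a j‖ ‖b j‖ < 4 * min ‖a j‖ ‖b j‖ with hbad
  have hcard : bad.card ≤ N := by
    have h1 : (bad.card : ℝ) ≤ 4 * C₀ := by
      have h2 : ∑ j ∈ bad, (1 / 4 : ℝ) ≤ ∑ j ∈ bad, min ‖a j‖ ‖b j‖ / max ‖a j‖ ‖b j‖ := by
        refine Finset.sum_le_sum fun j hj => ?_
        have := (Finset.mem_filter.1 hj).2
        rw [le_div_iff₀ (hab j)]
        linarith
      have h3 : ∑ j ∈ bad, min ‖a j‖ ‖b j‖ / max ‖a j‖ ‖b j‖ ≤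
          ∑ j, min ‖a j‖ ‖b j‖ / max ‖a j‖ ‖b j‖ :=
        Finset.sum_le_sum_of_subset_of_nonneg (Finset.subset_univ _) fun j _ _ =>
          div_nonneg (le_min (norm_nonneg _) (norm_nonneg _)) (hab j).le
      rw [Finset.sum_const, nsmul_eq_mul] at h2
      linarith
    have h4 : (bad.card : ℝ) ≤ N := h1.trans (Nat.le_ceil _)
    exact_mod_cast h4
  have hfar : ∀ ε : ℂ, 1 / 2 ≤ ‖ε‖ → ‖ε‖ ≤ 2 → (∀ j ∈ bad, g ≤ ‖ε - a j / b j‖) →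
      ∀ j, g / 4 * max ‖a j‖ ‖b j‖ ≤ ‖a j - ε * b j‖ := by
    intro ε h1 h2 h3 j
    refine gap_of_far hg0.le hg1 h1 h2 fun hj => h3 j ?_
    exact Finset.mem_filter.2 ⟨Finset.mem_univ _, hj⟩
  -- the reference twist, chosen through its real part
  obtain ⟨x, hx1, hx2, hx3⟩ := exists_far_from_finset bad (fun j => (a j / b j).re) N hcard
    (show (-1 / 2 : ℝ) < 1 / 2 by norm_num)
  set ε' : ℂ := ⟨x, Real.sqrt (1 - x ^ 2)⟩ with hε'
  have hε'1 : ‖ε'‖ = 1 := by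
    have h1 : 0 ≤ 1 - x ^ 2 := by nlinarith
    have h2 : ‖ε'‖ ^ 2 = 1 := by
      rw [← Complex.normSq_eq_norm_sq, Complex.normSq_apply]
      simp only [hε']
      rw [Real.mul_self_sqrt h1]
      ring
    nlinarith [norm_nonneg ε']
  have hgap' := hfar ε' (by rw [hε'1]; norm_num) (by rw [hε'1]; norm_num) (by
    intro j hj
    have h1 := hx3 j hj
    have h2 := Complex.abs_re_le_norm (ε' - a j / b j)
    rw [Complex.sub_re, abs_sub_comm] at h2
    refine le_trans ?_ h2
    refine le_trans ?_ h1
    rw [hg]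
    gcongr
    norm_num)
  refine ⟨∑ j, (if ‖a j‖ < ‖b j‖ then 1 else 0), ε', hε'1, ?_⟩
  intro ε₀ hε₀
  -- the radius of the circle avoids the distances of `ε₀` from the zeros of the bad factors
  obtain ⟨R, hR1, hR2, hR3⟩ := exists_far_from_finset bad (fun j => ‖a j / b j - ε₀‖) N hcard
    (show (1 / 8 : ℝ) < 1 / 4 by norm_num)
  refine ⟨R, by linarith, hR2, ?_⟩
  intro ε hε
  have hεlo : 1 / 2 ≤ ‖ε‖ := by
    have := norm_sub_norm_le ε₀ ε
    rw [norm_sub_rev, hε, hε₀] at this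
    linarith
  have hεhi : ‖ε‖ ≤ 2 := by
    have := norm_sub_norm_le ε ε₀
    rw [hε, hε₀] at this
    linarith
  refine ⟨hfar ε hεlo hεhi ?_, ?_⟩
  · intro j hj
    have h1 := hR3 j hj
    have h2 := abs_norm_sub_norm_le (a j / b j - ε₀) (ε - ε₀)
    rw [hε, sub_sub_sub_cancel_right, norm_sub_rev (a j / b j) ε] at h2
    refine le_trans ?_ h2
    refine le_trans ?_ h1
    rw [hg]
    gcongr
    norm_num
  · have h1 : ∀ j, ‖a j - ε * b j‖ ≤ ‖ε‖ ^ (if ‖a j‖ < ‖b j‖ then 1 else 0) *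
        (Real.exp (c * (min ‖a j‖ ‖b j‖ / max ‖a j‖ ‖b j‖)) * ‖a j - ε' * b j‖) := by
      intro j
      refine (norm_factor_le hεlo hεhi).trans ?_
      gcongr
      exact factor_ratio_le (by positivity) hε'1 (hab j) (hgap' j)
    refine (Finset.prod_le_prod (fun j _ => norm_nonneg _) fun j _ => h1 j).trans ?_
    rw [Finset.prod_mul_distrib, Finset.prod_mul_distrib, Finset.prod_pow_eq_pow_sum,
      ← Real.exp_sum, ← Finset.mul_sum]
    have h2 : Real.exp (c * ∑ j, min ‖a j‖ ‖b j‖ / max ‖a j‖ ‖b j‖) ≤ Real.exp (c * C₀) := by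
      gcongr
    have h3 : 0 ≤ ∏ j, ‖a j - ε' * b j‖ := Finset.prod_nonneg fun _ _ => norm_nonneg _
    calc _ ≤ ‖ε‖ ^ (∑ j, (if ‖a j‖ < ‖b j‖ then 1 else 0)) *
          (Real.exp (c * C₀) * ∏ j, ‖a j - ε' * b j‖) := by gcongr
      _ = _ := by ring

/-! ### Exponential sums over the modes -/

theorem sin_pi_ge {n : ℕ} (hn : 0 < n) {κ : ℝ} (h0 : 0 ≤ κ) (h1 : κ < 1) {k : ℕ} (hk : k < n) :
    2 * (k : ℝ) / n ≤ |Real.sin (Real.pi * ((κ + k) / n))| ∨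
      2 * ((n - 1 - k : ℕ) : ℝ) / n ≤ |Real.sin (Real.pi * ((κ + k) / n))| := by
  have hn' : (0 : ℝ) < n := Nat.cast_pos.2 hn
  have hπ := Real.pi_pos
  have hk' : (k : ℝ) + 1 ≤ n := by exact_mod_cast hk
  set y := (κ + k) / n with hy
  have hky : (k : ℝ) / n ≤ y := by rw [hy]; gcongr; linarith
  have hky' : ((n - 1 - k : ℕ) : ℝ) / n ≤ 1 - y := by
    have h3 : ((n - 1 - k : ℕ) : ℝ) = n - 1 - k := by
      rw [Nat.cast_sub (by omega), Nat.cast_sub (by omega)]; simp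
    rw [h3, hy, div_le_iff₀ hn', sub_mul, div_mul_cancel₀ _ hn'.ne']
    linarith
  have hy0 : 0 ≤ y := by positivity
  have hy1 : y ≤ 1 := by
    have : (0 : ℝ) ≤ ((n - 1 - k : ℕ) : ℝ) / n := by positivity
    linarith
  rcases le_total y (1 / 2) with h | h
  · left
    have h3 := Real.mul_le_sin (x := Real.pi * y) (by positivity) (by nlinarith)
    have h4 : 2 / Real.pi * (Real.pi * y) = 2 * y := by field_simp
    rw [h4] at h3
    refine le_trans ?_ (h3.trans (le_abs_self _))
    rw [mul_div_assoc]
    linarith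
  · right
    have h3 := Real.mul_le_sin (x := Real.pi * (1 - y)) (by nlinarith) (by nlinarith)
    have h4 : 2 / Real.pi * (Real.pi * (1 - y)) = 2 * (1 - y) := by field_simp
    have h5 : Real.sin (Real.pi * (1 - y)) = Real.sin (Real.pi * y) := by
      rw [mul_sub, mul_one, Real.sin_pi_sub]
    rw [h4, h5] at h3
    refine le_trans ?_ (h3.trans (le_abs_self _))
    rw [mul_div_assoc]
    linarith

theorem sum_zmod_shift {n : ℕ} [NeZero n] (f : ℤ → ℝ) (hf : ∀ k, f (k + n) = f k) (m : ℤ) :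
    ∑ j : ZMod n, f (j.val + m) = ∑ j : ZMod n, f j.val := by
  have hper : Function.Periodic f (n : ℤ) := hf
  have h1 : ∀ k : ℤ, f k = f ((k : ZMod n).val) := by
    intro k
    rw [ZMod.val_intCast]
    have h2 : k = k % n + (k / n) * n := by
      have := Int.emod_add_mul_ediv k n; linarith
    conv_lhs => rw [h2]
    have := hper.int_mul (k / n) (k % n)
    simpa using this
  have h2 : ∀ j : ZMod n, f (j.val + m) = f ((j + (m : ZMod n)).val) := by
    intro j
    rw [h1]
    congr 2
    push_cast
    simp
  simp only [h2]
  exact Equiv.sum_comp (Equiv.addRight (m : ZMod n)) (fun j : ZMod n => f j.val)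

/-- The sum over equally spaced angles is dominated by geometric series on both sides of the zero
of the sine. -/
theorem sum_exp_sin_le {n : ℕ} [NeZero n] {X : ℝ} (hX : 0 < X) (y : ℝ) :
    ∑ j : ZMod n, Real.exp (-X * |Real.sin (Real.pi * (y + j.val / n))|) ≤
      2 / (1 - Real.exp (-(2 * X / n))) := by
  have hn : 0 < n := Nat.pos_of_ne_zero (NeZero.ne n)
  have hn' : (0 : ℝ) < n := Nat.cast_pos.2 hn
  set m := ⌊n * y⌋ with hm
  set κ := n * y - m with hκ
  have hκ0 : 0 ≤ κ := by have := Int.floor_le (n * y); linarith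
  have hκ1 : κ < 1 := by have := Int.lt_floor_add_one (n * y); linarith
  let f : ℤ → ℝ := fun k => Real.exp (-X * |Real.sin (Real.pi * ((κ + k) / n))|)
  have hf : ∀ k, f (k + n) = f k := by
    intro k
    simp only [f]
    have : Real.pi * ((κ + ((k + n : ℤ) : ℝ)) / n) = Real.pi * ((κ + k) / n) + Real.pi := by
      push_cast; field_simp; ring
    rw [this, Real.sin_add_pi, abs_neg]
  have h1 : ∀ j : ZMod n, Real.exp (-X * |Real.sin (Real.pi * (y + j.val / n))|) =
      f (j.val + m) := by
    intro j
    simp only [f]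
    have : (y + j.val / n : ℝ) = (κ + ((j.val + m : ℤ) : ℝ)) / n := by
      rw [hκ]; push_cast; field_simp; ring
    rw [this]
  simp only [h1]
  rw [sum_zmod_shift f hf m]
  set r := Real.exp (-(2 * X / n)) with hr
  have hr0 : 0 < r := Real.exp_pos _
  have hr1 : r < 1 := by
    rw [hr, Real.exp_lt_one_iff]
    have : 0 < 2 * X / n := by positivity
    linarith
  have hrk : ∀ k : ℕ, Real.exp (-X * (2 * k / n)) = r ^ k := by
    intro k
    rw [hr, ← Real.exp_nat_mul]
    congr 1
    field_simp
  have h2 : ∀ j : ZMod n, f j.val ≤ r ^ j.val + r ^ (n - 1 - j.val) := by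
    intro j
    simp only [f]
    have hp1 : 0 ≤ r ^ j.val := by positivity
    have hp2 : 0 ≤ r ^ (n - 1 - j.val) := by positivity
    rcases sin_pi_ge hn hκ0 hκ1 (ZMod.val_lt j) with h | h
    · have : Real.exp (-X * |Real.sin (Real.pi * ((κ + ((j.val : ℤ) : ℝ)) / n))|) ≤
          Real.exp (-X * (2 * j.val / n)) := by
        apply Real.exp_le_exp.2
        rw [Int.cast_natCast]
        nlinarith
      rw [hrk] at this
      linarith
    · have : Real.exp (-X * |Real.sin (Real.pi * ((κ + ((j.val : ℤ) : ℝ)) / n))|) ≤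
          Real.exp (-X * (2 * (n - 1 - j.val : ℕ) / n)) := by
        apply Real.exp_le_exp.2
        rw [Int.cast_natCast]
        nlinarith
      rw [hrk] at this
      linarith
  have h3 : ∑ k ∈ Finset.range n, r ^ k ≤ (1 - r)⁻¹ := by
    rw [← tsum_geometric_of_lt_one hr0.le hr1]
    exact (summable_geometric_of_lt_one hr0.le hr1).sum_le_tsum _ fun _ _ => by positivity
  have h4 : ∀ F : ℕ → ℝ, ∑ j : ZMod n, F j.val = ∑ k ∈ Finset.range n, F k := by
    intro F
    have := sum_zmod_eq_sum_range (n := n) (fun k => (F k : ℂ))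
    exact_mod_cast this
  calc ∑ j : ZMod n, f j.val ≤ ∑ j : ZMod n, (r ^ j.val + r ^ (n - 1 - j.val)) :=
        Finset.sum_le_sum fun j _ => h2 j
    _ = ∑ k ∈ Finset.range n, r ^ k + ∑ k ∈ Finset.range n, r ^ (n - 1 - k) := by
        rw [h4 (fun k => r ^ k + r ^ (n - 1 - k)), Finset.sum_add_distrib]
    _ = ∑ k ∈ Finset.range n, r ^ k + ∑ k ∈ Finset.range n, r ^ k := by
        rw [Finset.sum_range_reflect (fun k => r ^ k) n]
    _ ≤ (1 - r)⁻¹ + (1 - r)⁻¹ := add_le_add h3 h3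
    _ = _ := by ring

/-! ### The symbol on the circle -/

/-- The constant coefficient of the characteristic polynomial in its second variable. -/
def symbolConst (α : ℝ) (z : ℂ) : ℂ := 1 + α * z

/-- The linear coefficient of the characteristic polynomial in its second variable. -/
def symbolSlope (α β γ : ℝ) (z : ℂ) : ℂ := β - (γ ^ 2 - α * β) * z

theorem symbolDet_eq (α β γ : ℝ) (z₁ z₂ : ℂ) :
    symbolDet α β γ γ z₁ z₂ = symbolConst α z₁ + symbolSlope α β γ z₁ * z₂ := by
  unfold symbolDet symbolConst symbolSlope
  ring

theorem continuous_symbolConst (α : ℝ) : Continuous (symbolConst α) := by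
  unfold symbolConst; fun_prop

theorem continuous_symbolSlope (α β γ : ℝ) : Continuous (symbolSlope α β γ) := by
  unfold symbolSlope; fun_prop

/-- The difference of the squared moduli of the two coefficients is affine in `Re z`. -/
theorem normSq_symbol_sub (α β γ : ℝ) {z : ℂ} (hz : ‖z‖ = 1) :
    ‖symbolConst α z‖ ^ 2 - ‖symbolSlope α β γ z‖ ^ 2 =
      2 * (α + β * (γ ^ 2 - α * β)) * z.re +
        (1 + α ^ 2 - β ^ 2 - (γ ^ 2 - α * β) ^ 2) := by
  have h1 : z.re * z.re + z.im * z.im = 1 := by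
    have := Complex.sq_norm z
    rw [hz, Complex.normSq_apply] at this
    linarith
  rw [Complex.sq_norm, Complex.sq_norm, Complex.normSq_apply, Complex.normSq_apply]
  have e1 : (symbolConst α z).re = 1 + α * z.re := by simp [symbolConst]
  have e2 : (symbolConst α z).im = α * z.im := by simp [symbolConst]
  have e3 : symbolSlope α β γ z = (β : ℂ) - ((γ ^ 2 - α * β : ℝ) : ℂ) * z := by
    simp [symbolSlope]
  have e4 : (symbolSlope α β γ z).re = β - (γ ^ 2 - α * β) * z.re := by
    rw [e3, Complex.sub_re, Complex.re_ofReal_mul, Complex.ofReal_re]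
  have e5 : (symbolSlope α β γ z).im = - ((γ ^ 2 - α * β) * z.im) := by
    rw [e3, Complex.sub_im, Complex.im_ofReal_mul, Complex.ofReal_im, zero_sub]
  rw [e1, e2, e4, e5]
  linear_combination (α ^ 2 - (γ ^ 2 - α * β) ^ 2) * h1

theorem le_max_symbol {α β γ : ℝ} (hα : 0 < α) (hγ : 0 < γ ^ 2 - α * β) (z : ℂ) :
    γ ^ 2 / (γ ^ 2 - α * β + α) ≤ max ‖symbolConst α z‖ ‖symbolSlope α β γ z‖ := by
  have hc : 0 < γ ^ 2 - α * β + α := by linarith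
  rw [div_le_iff₀ hc]
  have h1 : ((γ ^ 2 - α * β : ℝ) : ℂ) * symbolConst α z + (α : ℂ) * symbolSlope α β γ z =
      ((γ ^ 2 : ℝ) : ℂ) := by
    unfold symbolConst symbolSlope
    push_cast
    ring
  have h2 : ‖((γ ^ 2 : ℝ) : ℂ)‖ = γ ^ 2 := by
    rw [Complex.norm_real, Real.norm_of_nonneg (sq_nonneg _)]
  refine (h2.symm.trans (congrArg _ h1.symm)).le.trans ((norm_add_le _ _).trans ?_)
  rw [norm_mul, norm_mul, Complex.norm_real, Complex.norm_real, Real.norm_of_nonneg hγ.le,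
    Real.norm_of_nonneg hα.le]
  have h3 := le_max_left ‖symbolConst α z‖ ‖symbolSlope α β γ z‖
  have h4 := le_max_right ‖symbolConst α z‖ ‖symbolSlope α β γ z‖
  nlinarith

theorem norm_symbolConst_le {α : ℝ} (hα : 0 < α) {z : ℂ} (hz : ‖z‖ = 1) :
    ‖symbolConst α z‖ ≤ 1 + α := by
  refine (norm_add_le _ _).trans ?_
  rw [norm_mul, hz, Complex.norm_real, Real.norm_of_nonneg hα.le]
  simp

theorem norm_symbolSlope_le {α β γ : ℝ} (hβ : 0 < β) (hγ : 0 < γ ^ 2 - α * β) {z : ℂ}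
    (hz : ‖z‖ = 1) : ‖symbolSlope α β γ z‖ ≤ β + (γ ^ 2 - α * β) := by
  have e3 : symbolSlope α β γ z = (β : ℂ) - ((γ ^ 2 - α * β : ℝ) : ℂ) * z := by
    simp [symbolSlope]
  rw [e3]
  refine (norm_sub_le _ _).trans ?_
  rw [norm_mul, hz, Complex.norm_real, Complex.norm_real, Real.norm_of_nonneg hγ.le,
    Real.norm_of_nonneg hβ.le, mul_one]

theorem circlePt_re (x : ℝ) : (circlePt x).re = Real.cos (2 * Real.pi * x) := by
  have : (2 * Real.pi * x * Complex.I : ℂ) = ((2 * Real.pi * x : ℝ) : ℂ) * Complex.I := by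
    push_cast; ring
  rw [circlePt, this, Complex.exp_ofReal_mul_I_re]

theorem circlePt_add (x y : ℝ) : circlePt (x + y) = circlePt x * circlePt y := by
  unfold circlePt
  rw [← Complex.exp_add]
  congr 1
  push_cast
  ring

theorem exists_circlePt {w : ℂ} (hw : ‖w‖ = 1) : ∃ y, circlePt y = w := by
  refine ⟨w.arg / (2 * Real.pi), ?_⟩
  have h1 := Complex.norm_mul_exp_arg_mul_I w
  rw [hw, Complex.ofReal_one, one_mul] at h1
  refine Eq.trans ?_ h1
  rw [circlePt]
  congr 1
  have : (Real.pi : ℂ) ≠ 0 := by exact_mod_cast Real.pi_ne_zero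
  push_cast
  field_simp

/-- The two terms of the symbol have different norms at almost all angles, as `κ cos θ + μ`
vanishes at countably many angles only. -/
theorem ae_norm_symbol_ne {α β γ : ℝ} (hα : 0 < α) (hβ : 0 < β) (hγ : 0 < γ ^ 2 - α * β) :
    ∀ᵐ x : ℝ, ‖symbolSlope α β γ (circlePt x)‖ ≠ ‖symbolConst α (circlePt x)‖ := by
  set κ := 2 * (α + β * (γ ^ 2 - α * β)) with hκ
  set μ := 1 + α ^ 2 - β ^ 2 - (γ ^ 2 - α * β) ^ 2 with hμ
  have hκ0 : 0 < κ := by positivity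
  by_cases hex : ∃ x₀ : ℝ, κ * Real.cos (2 * Real.pi * x₀) + μ = 0
  · obtain ⟨x₀, hx₀⟩ := hex
    have hc : Set.Countable ((Set.range fun k : ℤ => (k : ℝ) + x₀) ∪
        (Set.range fun k : ℤ => (k : ℝ) - x₀)) :=
      (Set.countable_range _).union (Set.countable_range _)
    filter_upwards [hc.ae_notMem volume] with x hx h
    apply hx
    have h1 := normSq_symbol_sub α β γ (norm_circlePt x)
    rw [h, sub_self, circlePt_re, ← hκ, ← hμ] at h1
    have h2 : Real.cos (2 * Real.pi * x₀) = Real.cos (2 * Real.pi * x) := by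
      have : κ * (Real.cos (2 * Real.pi * x₀) - Real.cos (2 * Real.pi * x)) = 0 := by linarith
      rcases mul_eq_zero.1 this with h | h
      · exact absurd h hκ0.ne'
      · linarith
    have hp := Real.pi_pos
    obtain ⟨k, hk | hk⟩ := Real.cos_eq_cos_iff.1 h2
    · refine Or.inl ⟨k, ?_⟩
      have : 2 * Real.pi * x = 2 * Real.pi * (k + x₀) := by linarith
      exact (mul_left_cancel₀ (by positivity) this).symm
    · refine Or.inr ⟨k, ?_⟩
      have : 2 * Real.pi * x = 2 * Real.pi * (k - x₀) := by linarith
      exact (mul_left_cancel₀ (by positivity) this).symm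
  · refine Eventually.of_forall fun x h => hex ⟨x, ?_⟩
    have h1 := normSq_symbol_sub α β γ (norm_circlePt x)
    rw [h, sub_self, circlePt_re, ← hκ, ← hμ] at h1
    linarith

/-- The difference of two cosines is bounded below by the distances to its two zeros. -/
theorem min_sin_le_cos_sub (u v : ℝ) :
    |Real.sin (u + v)| * min |Real.sin u| |Real.sin v| ≤ 2 * |Real.sin u| * |Real.sin v| := by
  have h1 : |Real.sin (u + v)| ≤ |Real.sin u| + |Real.sin v| := by
    rw [Real.sin_add]
    refine (abs_add_le _ _).trans ?_
    rw [abs_mul, abs_mul]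
    have := Real.abs_cos_le_one u
    have := Real.abs_cos_le_one v
    nlinarith [abs_nonneg (Real.sin u), abs_nonneg (Real.sin v)]
  have hu := abs_nonneg (Real.sin u)
  have hv := abs_nonneg (Real.sin v)
  rcases le_total |Real.sin u| |Real.sin v| with h | h
  · rw [min_eq_left h]; nlinarith
  · rw [min_eq_right h]; nlinarith

theorem ratio_pow_le {p q D M : ℝ} (hp : 0 ≤ p) (hpq : p ≤ q) (hq : 0 < q) (hqM : q ≤ M)
    (hD : q ^ 2 - p ^ 2 = D) (n : ℕ) :
    p ^ n / q ^ n ≤ Real.exp (-(n * D / (2 * M ^ 2))) := by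
  have hD0 : 0 ≤ D := by rw [← hD]; nlinarith
  have h1 : p / q ≤ Real.exp (-(D / (2 * M ^ 2))) := by
    have h2 : (p / q) ^ 2 ≤ Real.exp (-(D / (2 * M ^ 2))) ^ 2 := by
      rw [← Real.exp_nat_mul]
      have h3 : (p / q) ^ 2 = 1 - D / q ^ 2 := by
        rw [div_pow, ← hD]; field_simp; ring
      have h4 : D / M ^ 2 ≤ D / q ^ 2 := by gcongr
      have h5 := Real.add_one_le_exp (-(D / M ^ 2))
      have h6 : ((2 : ℕ) : ℝ) * -(D / (2 * M ^ 2)) = -(D / M ^ 2) := by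
        push_cast; field_simp
      rw [h3, h6]
      linarith
    exact (pow_le_pow_iff_left₀ (by positivity) (Real.exp_pos _).le two_ne_zero).1 h2
  rw [← div_pow]
  refine (pow_le_pow_left₀ (by positivity) h1 n).trans (le_of_eq ?_)
  rw [← Real.exp_nat_mul]
  congr 1
  ring

theorem ratio_symbol_pow_le {α β γ : ℝ} (hα : 0 < α) (hβ : 0 < β) (hγ : 0 < γ ^ 2 - α * β)
    {z : ℂ} (hz : ‖z‖ = 1) (n : ℕ) :
    min ‖symbolConst α z ^ n‖ ‖(-symbolSlope α β γ z) ^ n‖ /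
      max ‖symbolConst α z ^ n‖ ‖(-symbolSlope α β γ z) ^ n‖ ≤
      Real.exp (-(n * |‖symbolConst α z‖ ^ 2 - ‖symbolSlope α β γ z‖ ^ 2| /
        (2 * (1 + α + β + (γ ^ 2 - α * β)) ^ 2))) := by
  have hA := norm_symbolConst_le hα hz
  have hB := norm_symbolSlope_le (α := α) (γ := γ) hβ hγ hz
  have hmx0 : 0 < max ‖symbolConst α z‖ ‖symbolSlope α β γ z‖ := by
    refine lt_of_lt_of_le ?_ (le_max_symbol (β := β) hα hγ z)
    have h1 : 0 < γ ^ 2 := by nlinarith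
    have h2 : 0 < γ ^ 2 - α * β + α := by linarith
    exact div_pos h1 h2
  rw [norm_pow, norm_pow, norm_neg]
  rcases le_total ‖symbolConst α z‖ ‖symbolSlope α β γ z‖ with h | h
  · have h' := pow_le_pow_left₀ (norm_nonneg _) h n
    have h2 := pow_le_pow_left₀ (norm_nonneg _) h 2
    rw [max_eq_right h] at hmx0
    rw [min_eq_left h', max_eq_right h']
    refine ratio_pow_le (norm_nonneg _) h hmx0 (hB.trans (by linarith)) ?_ n
    rw [abs_sub_comm, abs_of_nonneg (sub_nonneg.2 h2)]
  · have h' := pow_le_pow_left₀ (norm_nonneg _) h n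
    have h2 := pow_le_pow_left₀ (norm_nonneg _) h 2
    rw [max_eq_left h] at hmx0
    rw [min_eq_right h', max_eq_left h']
    refine ratio_pow_le (norm_nonneg _) h hmx0 (hA.trans (by linarith)) ?_ n
    rw [abs_of_nonneg (sub_nonneg.2 h2)]

/-- In the liquid phase `κ cos θ + μ`, the difference of the squared norms of the two terms, has two
simple zeros on the circle, so that the ratio of the smaller to the larger of the `n`-th powers
decays exponentially in the number of frequencies between the angle and the nearest zero. Its sum
over the frequencies is therefore bounded uniformly in `n`. -/
theorem exists_sum_ratio_le {α β γ : ℝ} (hα : 0 < α) (hβ : 0 < β) (hγ : 0 < γ ^ 2 - α * β)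
    (hliq : |1 + α ^ 2 - β ^ 2 - (γ ^ 2 - α * β) ^ 2| < 2 * (α + β * (γ ^ 2 - α * β))) :
    ∃ C₀ : ℝ, ∀ (n : ℕ) [NeZero n] (w : ℂ), ‖w‖ = 1 →
      ∑ j : ZMod n,
        min ‖symbolConst α (w * ZMod.stdAddChar j) ^ n‖
          ‖(-symbolSlope α β γ (w * ZMod.stdAddChar j)) ^ n‖ /
        max ‖symbolConst α (w * ZMod.stdAddChar j) ^ n‖
          ‖(-symbolSlope α β γ (w * ZMod.stdAddChar j)) ^ n‖ ≤ C₀ := by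
  obtain ⟨κ, hκ⟩ : ∃ κ, κ = 2 * (α + β * (γ ^ 2 - α * β)) := ⟨_, rfl⟩
  obtain ⟨μ, hμ⟩ : ∃ μ, μ = 1 + α ^ 2 - β ^ 2 - (γ ^ 2 - α * β) ^ 2 := ⟨_, rfl⟩
  have hκ0 : 0 < κ := by rw [hκ]; positivity
  obtain ⟨M, hM⟩ : ∃ M, M = 1 + α + β + (γ ^ 2 - α * β) := ⟨_, rfl⟩
  have hM0 : 0 < M := by rw [hM]; positivity
  rw [← hκ, ← hμ] at hliq
  -- the zeros of `κ cos θ + μ` are `x₀` and `-x₀`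
  obtain ⟨x₀, hx₀⟩ : ∃ x₀, x₀ = Real.arccos (-μ / κ) := ⟨_, rfl⟩
  have hcos : Real.cos x₀ = -μ / κ := by
    rw [abs_lt] at hliq
    rw [hx₀]
    apply Real.cos_arccos
    · rw [le_div_iff₀ hκ0]; linarith
    · rw [div_le_iff₀ hκ0]; linarith
  obtain ⟨s, hs⟩ : ∃ s, s = |Real.sin x₀| := ⟨_, rfl⟩
  have hs0 : 0 < s := by
    rw [hs, abs_pos]
    intro h0
    have := Real.sin_sq_add_cos_sq x₀
    rw [h0, hcos] at this
    have h2 : μ ^ 2 = κ ^ 2 := by field_simp at this; linarith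
    have h3 : μ ^ 2 < κ ^ 2 := sq_lt_sq' (by have := (abs_lt.1 hliq).1; linarith) (abs_lt.1 hliq).2
    linarith
  obtain ⟨Y, hY⟩ : ∃ Y, Y = κ * s / (2 * M ^ 2) := ⟨_, rfl⟩
  have hY0 : 0 < Y := by rw [hY]; positivity
  refine ⟨2 / (1 - Real.exp (-(2 * Y))) + 2 / (1 - Real.exp (-(2 * Y))), ?_⟩
  intro n _ w hw
  have hn : 0 < (n : ℝ) := Nat.cast_pos.2 (NeZero.pos n)
  obtain ⟨y, rfl⟩ := exists_circlePt hw
  have hX : 0 < n * Y := by positivity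
  have e1 := sum_exp_sin_le (n := n) hX (y + x₀ / (2 * Real.pi))
  have e2 := sum_exp_sin_le (n := n) hX (y - x₀ / (2 * Real.pi))
  have e3 : 2 * (n * Y) / n = 2 * Y := by field_simp
  rw [e3] at e1 e2
  refine le_trans ?_ (add_le_add e1 e2)
  rw [← Finset.sum_add_distrib]
  refine Finset.sum_le_sum fun j _ => ?_
  have hz : ‖circlePt y * (ZMod.stdAddChar j : ℂ)‖ = 1 := by
    rw [norm_mul, norm_circlePt, norm_stdAddChar, one_mul]
  have hzre : (circlePt y * (ZMod.stdAddChar j : ℂ)).re =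
      Real.cos (2 * Real.pi * (y + j.val / n)) := by
    rw [stdAddChar_eq_circlePt, ← circlePt_add, circlePt_re]
  obtain ⟨z, hzdef⟩ : ∃ z, z = circlePt y * (ZMod.stdAddChar j : ℂ) := ⟨_, rfl⟩
  rw [← hzdef] at hz hzre ⊢
  have hns := normSq_symbol_sub α β γ hz
  rw [← hκ, ← hμ, hzre] at hns
  obtain ⟨p, hp⟩ : ∃ p, p = Real.pi * (y + x₀ / (2 * Real.pi) + j.val / n) := ⟨_, rfl⟩
  obtain ⟨q, hq⟩ : ∃ q, q = Real.pi * (y - x₀ / (2 * Real.pi) + j.val / n) := ⟨_, rfl⟩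
  rw [← hp, ← hq]
  have hpi := Real.pi_pos
  have hpq1 : p + q = 2 * Real.pi * (y + j.val / n) := by rw [hp, hq]; ring
  have hpq2 : p - q = x₀ := by rw [hp, hq]; field_simp; ring
  have hcc : Real.cos (2 * Real.pi * (y + j.val / n)) - Real.cos x₀ =
      -2 * Real.sin p * Real.sin q := by
    rw [← hpq1, ← hpq2, Real.cos_add, Real.cos_sub]; ring
  have hD : κ * s * min |Real.sin p| |Real.sin q| ≤
      |‖symbolConst α z‖ ^ 2 - ‖symbolSlope α β γ z‖ ^ 2| := by
    have h1 : κ * Real.cos (2 * Real.pi * (y + j.val / n)) + μ =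
        κ * (-2 * Real.sin p * Real.sin q) := by
      rw [← hcc, hcos]; field_simp; ring
    rw [hns, h1, abs_mul κ, abs_mul, abs_mul, abs_of_pos hκ0]
    have h2 := min_sin_le_cos_sub p (-q)
    rw [Real.sin_neg, abs_neg, ← sub_eq_add_neg, hpq2, ← hs] at h2
    have h3 : |(-2 : ℝ)| = 2 := by norm_num
    rw [h3]
    nlinarith
  have hratio := ratio_symbol_pow_le hα hβ hγ hz n
  rw [← hM] at hratio
  refine hratio.trans ?_
  have h1 : n * Y * min |Real.sin p| |Real.sin q| ≤
      n * |‖symbolConst α z‖ ^ 2 - ‖symbolSlope α β γ z‖ ^ 2| / (2 * M ^ 2) := by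
    rw [le_div_iff₀ (by positivity)]
    have : n * Y * min |Real.sin p| |Real.sin q| * (2 * M ^ 2) =
        n * (κ * s * min |Real.sin p| |Real.sin q|) := by
      rw [hY]; field_simp
    rw [this]
    gcongr
  have h2 : Real.exp (-(n * |‖symbolConst α z‖ ^ 2 - ‖symbolSlope α β γ z‖ ^ 2| / (2 * M ^ 2))) ≤
      Real.exp (-(n * Y * min |Real.sin p| |Real.sin q|)) := Real.exp_le_exp.2 (neg_le_neg h1)
  refine h2.trans ?_
  rw [neg_mul, neg_mul]
  rcases le_total |Real.sin p| |Real.sin q| with h | h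
  · rw [min_eq_left h]
    exact le_add_of_nonneg_right (Real.exp_pos _).le
  · rw [min_eq_right h]
    exact le_add_of_nonneg_left (Real.exp_pos _).le

/-! ### Limits of the entries of the inverse -/

/-- The average of `z₁ ^ p z₂ ^ q / Δ(z₁, z₂)` over the twisted roots of unity. -/
noncomputable def torusAvg (n : ℕ) [NeZero n] (α β γ : ℝ) (w₁ w₂ : ℂ) (p q : ℤ) : ℂ :=
  (∑ j : ZMod n × ZMod n, (w₁ * ZMod.stdAddChar j.1) ^ p * (w₂ * ZMod.stdAddChar j.2) ^ q /
    symbolDet α β γ γ (w₁ * ZMod.stdAddChar j.1) (w₂ * ZMod.stdAddChar j.2)) / (n : ℂ) ^ 2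

/-- The average of `z₁ ^ p z₂ ^ q / Δ(z₁, z₂)` over the torus `|z₁| = |z₂| = 1`, integrated over
`z₂` first. -/
noncomputable def symbolMoment (α β γ : ℝ) (p q : ℤ) : ℂ :=
  ∫ x in (0 : ℝ)..1, circlePt x ^ p *
    circleAvg q (symbolConst α (circlePt x)) (symbolSlope α β γ (circlePt x))

section Fourier

variable {n : ℕ} [NeZero n]

theorem torusAvg_eq (α β γ : ℝ) (w₁ w₂ : ℂ) (p q : ℤ) :
    torusAvg n α β γ w₁ w₂ p q = (∑ j : ZMod n, (w₁ * ZMod.stdAddChar j) ^ p *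
      rootAvg n w₂ q (symbolConst α (w₁ * ZMod.stdAddChar j))
        (symbolSlope α β γ (w₁ * ZMod.stdAddChar j))) / n := by
  unfold torusAvg rootAvg
  rw [Fintype.sum_prod_type, sq, ← div_div]
  congr 1
  rw [Finset.sum_div]
  refine Finset.sum_congr rfl fun j _ => ?_
  rw [mul_div_assoc', Finset.mul_sum]
  congr 1
  refine Finset.sum_congr rfl fun k _ => ?_
  rw [symbolDet_eq, mul_div_assoc]

theorem character_toTorus (j : ZMod n × ZMod n) (v : ℤ × ℤ) {w₁ w₂ : ℂ} (h₁ : w₁ ≠ 0)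
    (h₂ : w₂ ≠ 0) : character j (toTorus n v) = w₁ ^ (-v.1) * w₂ ^ (-v.2) *
      ((w₁ * ZMod.stdAddChar j.1) ^ v.1 * (w₂ * ZMod.stdAddChar j.2) ^ v.2) := by
  rw [mul_zpow, mul_zpow, stdAddChar_zpow, stdAddChar_zpow, zpow_neg, zpow_neg]
  have := zpow_ne_zero v.1 h₁
  have := zpow_ne_zero v.2 h₂
  simp only [character, toTorus]
  field_simp

/-- The combination of averages which gives an entry of the inverse of the torus matrix. -/
def adjCombination (α β γ : ℝ) (T : ℤ → ℤ → ℂ) (v : ℤ × ℤ) (k k' : Bool) : ℂ :=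
  bif k then (bif k' then T v.1 v.2 + α * T (v.1 + 1) v.2 else -(γ * T (v.1 + 1) v.2))
  else (bif k' then -(γ * T v.1 (v.2 + 1)) else T v.1 v.2 + β * T v.1 (v.2 + 1))

/-- The entries of the inverse are combinations of the averages over the frequencies, up to powers
of the twists, by expanding the adjugate of the symbol. -/
theorem green_toTorus (α β γ : ℝ) {w₁ w₂ : ℂ} (h₁ : w₁ ≠ 0) (h₂ : w₂ ≠ 0) (v : ℤ × ℤ)
    (k k' : Bool) : green n α β γ γ w₁ w₂ (toTorus n v) k k' =
      w₁ ^ (-v.1) * w₂ ^ (-v.2) * adjCombination α β γ (torusAvg n α β γ w₁ w₂) v k k' := by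
  have hz₁ : ∀ j : ZMod n × ZMod n, w₁ * (ZMod.stdAddChar j.1 : ℂ) ≠ 0 := fun j =>
    mul_ne_zero h₁ (stdAddChar_ne_zero _)
  have hz₂ : ∀ j : ZMod n × ZMod n, w₂ * (ZMod.stdAddChar j.2 : ℂ) ≠ 0 := fun j =>
    mul_ne_zero h₂ (stdAddChar_ne_zero _)
  unfold green
  simp only [character_toTorus _ v h₁ h₂]
  cases k <;> cases k' <;>
  · simp only [adjCombination, symbolAdj, cond_true, cond_false, torusAvg, mul_div_assoc',
      ← add_div, ← neg_div, Finset.mul_sum, ← Finset.sum_add_distrib, ← Finset.sum_neg_distrib,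
      zpow_add_one₀ (hz₁ _), zpow_add_one₀ (hz₂ _)]
    congr 1
    refine Finset.sum_congr rfl fun j _ => ?_
    ring

end Fourier

/-- If the gap condition holds at all frequencies, the averages over twisted roots of unity tend
to the moments, by dominated convergence: the inner averages are bounded, and converge at the
angles where the two terms of the symbol have different norms. -/
theorem tendsto_torusAvg {α β γ g : ℝ} (hα : 0 < α) (hβ : 0 < β) (hγ : 0 < γ ^ 2 - α * β)
    (hg : 0 < g) {w₁ w₂ : ℕ → ℂ} (hw₁ : ∀ n, ‖w₁ n‖ = 1) (hlim : Tendsto w₁ atTop (𝓝 1))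
    (hε : ∀ n, ‖w₂ n ^ (n + 1)‖ ≤ 2) (hε' : ∀ n, 1 / 2 ≤ ‖w₂ n ^ (n + 1)‖)
    (hgap : ∀ n, ∀ j : ZMod (n + 1),
      g * max ‖symbolConst α (w₁ n * ZMod.stdAddChar j) ^ (n + 1)‖
        ‖(-symbolSlope α β γ (w₁ n * ZMod.stdAddChar j)) ^ (n + 1)‖ ≤
      ‖symbolConst α (w₁ n * ZMod.stdAddChar j) ^ (n + 1) -
        w₂ n ^ (n + 1) * (-symbolSlope α β γ (w₁ n * ZMod.stdAddChar j)) ^ (n + 1)‖) (p q : ℤ) :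
    Tendsto (fun n => torusAvg (n + 1) α β γ (w₁ n) (w₂ n) p q) atTop
      (𝓝 (symbolMoment α β γ p q)) := by
  have hw₂ : ∀ n, w₂ n ≠ 0 := by
    intro n h
    have := hε' n
    rw [h, zero_pow (Nat.succ_ne_zero n), norm_zero] at this
    linarith
  have hγ2 : 0 < γ ^ 2 := by nlinarith
  have hden : 0 < γ ^ 2 - α * β + α := by linarith
  have hm0 : 0 < γ ^ 2 / (γ ^ 2 - α * β + α) := div_pos hγ2 hden
  simp only [torusAvg_eq]
  refine tendsto_avg_roots (H := fun n z => z ^ p *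
    rootAvg (n + 1) (w₂ n) q (symbolConst α z) (symbolSlope α β γ z))
    (C := 4 / (g * (γ ^ 2 / (γ ^ 2 - α * β + α)))) hlim ?_ ?_
  · filter_upwards [eventually_gt_atTop (|q| + 1).toNat] with n hn j
    have hz : ‖w₁ n * (ZMod.stdAddChar j : ℂ)‖ = 1 := by
      rw [norm_mul, hw₁, norm_stdAddChar, one_mul]
    have hg' := hgap n j
    set z := w₁ n * (ZMod.stdAddChar j : ℂ)
    have hm := le_max_symbol (β := β) hα hγ z
    rw [norm_mul, norm_zpow, hz, one_zpow, one_mul]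
    refine (norm_rootAvg_le (hw₂ n) hg (hm0.trans_le hm) (hε n) (hε' n) ?_
      (by push_cast; omega)).trans (by gcongr)
    refine le_trans (le_of_eq ?_) hg'
    rw [norm_pow, norm_pow, norm_neg]
    congr 1
    exact (pow_left_monotoneOn (n := n + 1)).map_max (norm_nonneg _) (norm_nonneg _)
  · filter_upwards [ae_norm_symbol_ne hα hβ hγ] with x hx z hz
    refine Tendsto.mul ?_ (tendsto_rootAvg hw₂ hε hε'
      (((continuous_symbolConst α).tendsto _).comp hz)
      (((continuous_symbolSlope α β γ).tendsto _).comp hz) hx q)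
    refine hz.zpow₀ p (Or.inl ?_)
    rw [← norm_ne_zero_iff, norm_circlePt]
    exact one_ne_zero

/-- The limit of the minors of the inverse of the torus matrix in the liquid phase. -/
noncomputable def liquidMinor (α β γ : ℝ) (S : Finset (ℤ × ℤ)) (t : ℤ × ℤ → VertexType) :
    Matrix (S × Bool) (S × Bool) ℂ :=
  Matrix.of fun e e' =>
    (bif e.2 then 1 else vertexWeight α β γ γ (t e.1)) *
      adjCombination α β γ (symbolMoment α β γ) ((step (t e.1) e.1.1 e.2).1 - e'.1.1)
        (step (t e.1) e.1.1 e.2).2 e'.2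

theorem tendsto_det_greenMinor {α β γ : ℝ} {w₁ w₂ : ℕ → ℂ} (h₁ : ∀ n, w₁ n ≠ 0)
    (h₂ : ∀ n, w₂ n ≠ 0) (hw₁ : Tendsto w₁ atTop (𝓝 1)) (hw₂ : Tendsto w₂ atTop (𝓝 1))
    (hT : ∀ p q, Tendsto (fun n => torusAvg (n + 1) α β γ (w₁ n) (w₂ n) p q) atTop
      (𝓝 (symbolMoment α β γ p q))) (S : Finset (ℤ × ℤ)) (t : ℤ × ℤ → VertexType) :
    Tendsto (fun n => (greenMinor (n + 1) α β γ γ (w₁ n) (w₂ n) S t).det) atTop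
      (𝓝 (liquidMinor α β γ S t).det) := by
  have hcont : Continuous fun M : Matrix (S × Bool) (S × Bool) ℂ => M.det :=
    continuous_id.matrix_det
  refine (hcont.tendsto _).comp (tendsto_pi_nhds.2 fun e => tendsto_pi_nhds.2 fun e' => ?_)
  simp only [greenMinor, liquidMinor, Matrix.of_apply, green_toTorus α β γ (h₁ _) (h₂ _)]
  refine Tendsto.mul ?_ ?_
  · cases e.2
    · have h3 : Tendsto (fun n => twist (w₁ n) (w₂ n) (t e.1)) atTop (𝓝 1) := by
        unfold twist
        have := (hw₁.pow (outOcc (t e.1) false).toNat).mul (hw₂.pow (outOcc (t e.1) true).toNat)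
        simpa using this
      simpa using h3.const_mul (vertexWeight (α : ℂ) β γ γ (t e.1))
    · simp
  · generalize (step (t e.1) e.1.1 e.2).1 - e'.1.1 = v
    have h4 : ∀ p : ℤ, Tendsto (fun n => w₁ n ^ p) atTop (𝓝 1) := fun p => by
      simpa using hw₁.zpow₀ p (Or.inl one_ne_zero)
    have h5 : ∀ p : ℤ, Tendsto (fun n => w₂ n ^ p) atTop (𝓝 1) := fun p => by
      simpa using hw₂.zpow₀ p (Or.inl one_ne_zero)
    have h6 : ∀ k k', Tendsto (fun n => adjCombination α β γ
        (torusAvg (n + 1) α β γ (w₁ n) (w₂ n)) v k k') atTop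
        (𝓝 (adjCombination α β γ (symbolMoment α β γ) v k k')) := by
      intro k k'
      cases k <;> cases k' <;> simp only [adjCombination, cond_true, cond_false]
      · exact (hT _ _).add ((hT _ _).const_mul _)
      · exact ((hT _ _).const_mul _).neg
      · exact ((hT _ _).const_mul _).neg
      · exact (hT _ _).add ((hT _ _).const_mul _)
    simpa using ((h4 (-v.1)).mul (h5 (-v.2))).mul (h6 (step (t e.1) e.1.1 e.2).2 e'.2)

/-! ### Convergence in the liquid phase -/

theorem exp_log_div_pow {ε : ℂ} (hε : ε ≠ 0) (n : ℕ) :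
    Complex.exp (Complex.log ε / ((n + 1 : ℕ) : ℂ)) ^ (n + 1) = ε := by
  rw [← Complex.exp_nat_mul, mul_div_cancel₀ _ (Nat.cast_ne_zero.2 (Nat.succ_ne_zero n)),
    Complex.exp_log hε]

theorem norm_log_le {ε : ℂ} (h1 : 1 / 2 ≤ ‖ε‖) (h2 : ‖ε‖ ≤ 2) : ‖Complex.log ε‖ ≤ 1 + Real.pi := by
  refine (Complex.norm_le_abs_re_add_abs_im _).trans (add_le_add ?_ ?_)
  · rw [Complex.log_re]
    have h3 : Real.log 2 ≤ 1 := by linarith [Real.log_le_sub_one_of_pos (show (0 : ℝ) < 2 by norm_num)]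
    rw [abs_le]
    constructor
    · have := Real.log_le_log (by norm_num) h1
      rw [one_div, Real.log_inv] at this
      linarith
    · have := Real.log_le_log (by linarith) h2
      linarith
  · rw [Complex.log_im]
    exact Complex.abs_arg_le_pi ε

theorem tendsto_exp_log_div {ε : ℕ → ℂ} (h1 : ∀ n, 1 / 2 ≤ ‖ε n‖) (h2 : ∀ n, ‖ε n‖ ≤ 2) :
    Tendsto (fun n : ℕ => Complex.exp (Complex.log (ε n) / ((n + 1 : ℕ) : ℂ))) atTop (𝓝 1) := by
  rw [← Complex.exp_zero]
  refine (Complex.continuous_exp.tendsto 0).comp ?_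
  have h3 : Tendsto (fun n : ℕ => (1 + Real.pi) / ((n + 1 : ℕ) : ℝ)) atTop (𝓝 0) :=
    (tendsto_const_div_atTop_nhds_zero_nat (1 + Real.pi)).comp (tendsto_add_atTop_nat 1)
  refine squeeze_zero_norm (fun n => ?_) h3
  rw [norm_div, Complex.norm_natCast]
  gcongr
  exact norm_log_le (h1 n) (h2 n)

theorem norm_exp_log_div {ε : ℂ} (h : ‖ε‖ = 1) (n : ℕ) :
    ‖Complex.exp (Complex.log ε / ((n + 1 : ℕ) : ℂ))‖ = 1 := by
  have hε : ε ≠ 0 := by rw [← norm_ne_zero_iff, h]; exact one_ne_zero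
  have h1 := congrArg norm (exp_log_div_pow hε n)
  rw [norm_pow, h] at h1
  exact (pow_eq_one_iff_of_nonneg (norm_nonneg _) (Nat.succ_ne_zero n)).1 h1

theorem signedSum_empty_eq_prod {n : ℕ} (α β γ : ℝ) (s : ZMod (n + 1) × ZMod (n + 1) → VertexType)
    (w₁ : ℂ) {ε : ℂ} (hε : ε ≠ 0) :
    signedSum (vertexWeight α β γ γ) ∅ s (w₁ ^ (n + 1)) ε =
      ∏ j : ZMod (n + 1), (symbolConst α (w₁ * ZMod.stdAddChar j) ^ (n + 1) -
        ε * (-symbolSlope α β γ (w₁ * ZMod.stdAddChar j)) ^ (n + 1)) := by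
  have h := exp_log_div_pow hε n
  set w₂ := Complex.exp (Complex.log ε / ((n + 1 : ℕ) : ℂ))
  rw [← h, ← det_torusMatrix, det_torusMatrix_empty, Fintype.prod_prod_type]
  refine Finset.prod_congr rfl fun j _ => ?_
  rw [← prod_add_roots]
  exact Finset.prod_congr rfl fun k _ => symbolDet_eq _ _ _ _ _

theorem differentiable_signedSum {n : ℕ} [NeZero n] (a : VertexType → ℂ)
    (S : Finset (ZMod n × ZMod n)) (s : ZMod n × ZMod n → VertexType) (ε₁ : ℂ) :
    Differentiable ℂ (signedSum a S s ε₁) := by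
  unfold signedSum
  refine Differentiable.fun_sum fun σ _ => ?_
  split_ifs
  · fun_prop
  · exact differentiable_const _

theorem vertexWeight_eq_freeFermionWeight (α β γ : ℝ) :
    vertexWeight α β γ γ = fun t => (freeFermionWeight α β γ t : ℂ) := by
  funext t
  cases t <;> simp [vertexWeight, freeFermionWeight, sq]

theorem freeFermionWeight_pos {α β γ : ℝ} (hα : 0 < α) (hβ : 0 < β) (hγ : 0 < γ)
    (hc : 0 < γ ^ 2 - α * β) (t : VertexType) : 0 < freeFermionWeight α β γ t := by
  cases t <;> simp only [freeFermionWeight] <;> first | assumption | norm_num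

theorem eventually_injOn_toTorus (S : Finset (ℤ × ℤ)) :
    ∀ᶠ n : ℕ in atTop, Set.InjOn (toTorus (n + 1)) S := by
  obtain ⟨N, hN⟩ : ∃ N : ℕ, ∀ v ∈ S, |v.1| ≤ N ∧ |v.2| ≤ N := by
    refine ⟨∑ v ∈ S, (v.1.natAbs + v.2.natAbs), fun v hv => ?_⟩
    have : v.1.natAbs + v.2.natAbs ≤ ∑ v ∈ S, (v.1.natAbs + v.2.natAbs) :=
      Finset.single_le_sum (f := fun v : ℤ × ℤ => v.1.natAbs + v.2.natAbs)
        (fun _ _ => Nat.zero_le _) hv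
    rw [Int.abs_eq_natAbs, Int.abs_eq_natAbs]
    omega
  filter_upwards [eventually_gt_atTop (2 * N)] with n hn u hu v hv huv
  simp only [toTorus, Prod.mk.injEq, ZMod.intCast_eq_intCast_iff_dvd_sub] at huv
  have hu' := hN u hu
  have hv' := hN v hv
  simp only [abs_le] at hu' hv'
  have key : ∀ x : ℤ, ((n + 1 : ℕ) : ℤ) ∣ x → |x| < ((n + 1 : ℕ) : ℤ) → x = 0 := fun x h1 h2 =>
    Int.eq_zero_of_abs_lt_dvd h1 h2
  have e1 := key _ huv.1 (by rw [abs_lt]; push_cast; omega)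
  have e2 := key _ huv.2 (by rw [abs_lt]; push_cast; omega)
  ext <;> omega

/-- A choice of types on the torus extending given types on a set of vertices of the lattice. -/
noncomputable def torusTypes (n : ℕ) (S : Finset (ℤ × ℤ)) (t : ℤ × ℤ → VertexType)
    (v : ZMod n × ZMod n) : VertexType :=
  open Classical in if h : ∃ u ∈ S, toTorus n u = v then t h.choose else .a1

theorem torusTypes_toTorus {n : ℕ} {S : Finset (ℤ × ℤ)} (hS : Set.InjOn (toTorus n) S)
    (t : ℤ × ℤ → VertexType) {v : ℤ × ℤ} (hv : v ∈ S) :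
    torusTypes n S t (toTorus n v) = t v := by
  have h : ∃ u ∈ S, toTorus n u = toTorus n v := ⟨v, hv, rfl⟩
  rw [torusTypes, dif_pos h]
  exact congrArg t (hS h.choose_spec.1 hv h.choose_spec.2)

/-- In the liquid phase prescribing finitely many types multiplies the signed partition functions
with twists of modulus one by the same factor, up to an error which is small compared with the
partition function. -/
theorem tendsto_signedSum_sub {α β γ : ℝ} (hα : 0 < α) (hβ : 0 < β) (hγ : 0 < γ)
    (hc : 0 < γ ^ 2 - α * β)
    (hliq : |1 + α ^ 2 - β ^ 2 - (γ ^ 2 - α * β) ^ 2| < 2 * (α + β * (γ ^ 2 - α * β)))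
    (S : Finset (ℤ × ℤ)) (t : ℤ × ℤ → VertexType) {η₁ η₂ : ℕ → ℂ} (h₁ : ∀ n, ‖η₁ n‖ = 1)
    (h₂ : ∀ n, ‖η₂ n‖ = 1) :
    Tendsto (fun n : ℕ => ‖signedSum (vertexWeight α β γ γ) (S.image (toTorus (n + 1)))
        (torusTypes (n + 1) S t) (η₁ n) (η₂ n) - (liquidMinor α β γ S t).det *
          signedSum (vertexWeight α β γ γ) ∅ (torusTypes (n + 1) S t) (η₁ n) (η₂ n)‖ /
      partitionFunction (n + 1) (freeFermionWeight α β γ)) atTop (𝓝 0) := by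
  -- only the vertical twist moves: `η₁ n` is fixed, and `ε` runs over a disc around `η₂ n`
  obtain ⟨C₀, hsum⟩ := exists_sum_ratio_le hα hβ hc hliq
  obtain ⟨g, K, hg, hK, hcirc⟩ := exists_good_circle C₀
  have hη₁ : ∀ n, η₁ n ≠ 0 := fun n => by rw [← norm_ne_zero_iff, h₁]; exact one_ne_zero
  set w₁ : ℕ → ℂ := fun n => Complex.exp (Complex.log (η₁ n) / ((n + 1 : ℕ) : ℂ)) with hw₁
  have hw₁n : ∀ n, ‖w₁ n‖ = 1 := fun n => norm_exp_log_div (h₁ n) n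
  have hw₁p : ∀ n, w₁ n ^ (n + 1) = η₁ n := fun n => exp_log_div_pow (hη₁ n) n
  have hw₁l : Tendsto w₁ atTop (𝓝 1) := tendsto_exp_log_div
    (fun n => by rw [h₁]; norm_num) (fun n => by rw [h₁]; norm_num)
  set L := (liquidMinor α β γ S t).det with hL
  set F : ℕ → ℂ → ℂ := fun n ε => signedSum (vertexWeight α β γ γ) (S.image (toTorus (n + 1)))
    (torusTypes (n + 1) S t) (η₁ n) ε - L *
      signedSum (vertexWeight α β γ γ) ∅ (torusTypes (n + 1) S t) (η₁ n) ε with hF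
  set D : ℕ → ℂ → ℂ := fun n ε => signedSum (vertexWeight α β γ γ) ∅
    (torusTypes (n + 1) S t) (η₁ n) ε with hD
  have hDprod : ∀ n ε, ε ≠ 0 → D n ε = ∏ j : ZMod (n + 1),
      (symbolConst α (w₁ n * ZMod.stdAddChar j) ^ (n + 1) -
        ε * (-symbolSlope α β γ (w₁ n * ZMod.stdAddChar j)) ^ (n + 1)) := by
    intro n ε hε
    simp only [hD]
    rw [← hw₁p n, signedSum_empty_eq_prod α β γ _ _ hε]
  have hm0 : ∀ z, 0 < max ‖symbolConst α z‖ ‖symbolSlope α β γ z‖ := fun z =>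
    (div_pos (by positivity) (by linarith)).trans_le (le_max_symbol (β := β) hα hc z)
  -- on a circle of twists near `η₂ n` no factor is small, and the maximum principle applies
  have key : ∀ n, ∃ ε : ℂ, 1 / 2 ≤ ‖ε‖ ∧ ‖ε‖ ≤ 2 ∧
      (∀ j : ZMod (n + 1), g * max ‖symbolConst α (w₁ n * ZMod.stdAddChar j) ^ (n + 1)‖
        ‖(-symbolSlope α β γ (w₁ n * ZMod.stdAddChar j)) ^ (n + 1)‖ ≤
      ‖symbolConst α (w₁ n * ZMod.stdAddChar j) ^ (n + 1) -
        ε * (-symbolSlope α β γ (w₁ n * ZMod.stdAddChar j)) ^ (n + 1)‖) ∧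
      D n ε ≠ 0 ∧ ‖F n (η₂ n)‖ ≤ ‖F n ε‖ / ‖D n ε‖ *
        (K * partitionFunction (n + 1) (freeFermionWeight α β γ)) := by
    intro n
    have hmax0 : ∀ j : ZMod (n + 1),
        0 < max ‖symbolConst α (w₁ n * ZMod.stdAddChar j) ^ (n + 1)‖
        ‖(-symbolSlope α β γ (w₁ n * ZMod.stdAddChar j)) ^ (n + 1)‖ := by
      intro j
      rw [norm_pow, norm_pow, norm_neg]
      rcases lt_max_iff.1 (hm0 (w₁ n * ZMod.stdAddChar j)) with h | h
      · exact lt_max_of_lt_left (pow_pos h _)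
      · exact lt_max_of_lt_right (pow_pos h _)
    obtain ⟨m, ε', hε', hR⟩ := hcirc (ZMod (n + 1))
      (fun j => symbolConst α (w₁ n * ZMod.stdAddChar j) ^ (n + 1))
      (fun j => (-symbolSlope α β γ (w₁ n * ZMod.stdAddChar j)) ^ (n + 1)) hmax0
      (hsum (n + 1) (w₁ n) (hw₁n n))
    obtain ⟨R, hR0, hR4, hgood⟩ := hR (η₂ n) (h₂ n)
    have hnz : ∀ ε ∈ Metric.closedBall (η₂ n) R, 1 / 2 ≤ ‖ε‖ ∧ ‖ε‖ ≤ 2 := by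
      intro ε hε
      rw [mem_closedBall_iff_norm] at hε
      have e1 := norm_sub_norm_le (η₂ n) ε
      have e2 := norm_sub_norm_le ε (η₂ n)
      rw [norm_sub_rev] at e1
      rw [h₂] at e1 e2
      constructor <;> linarith
    -- dividing by `ε ^ m` removes the growth of the product of the factors, and has modulus one
    -- at the centre
    have hdiff : DiffContOnCl ℂ (fun ε => F n ε / ε ^ m) (Metric.ball (η₂ n) R) := by
      have hFd : Differentiable ℂ (F n) := (differentiable_signedSum _ _ _ _).sub
        ((differentiable_signedSum _ _ _ _).const_mul _)
      refine DifferentiableOn.diffContOnCl fun ε hε => ?_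
      rw [closure_ball _ hR0.ne'] at hε
      have : ε ≠ 0 := by
        rw [← norm_pos_iff]; linarith [(hnz ε hε).1]
      have hpow : DifferentiableAt ℂ (fun ε : ℂ => ε ^ m) ε := by fun_prop
      exact (hFd.differentiableAt.fun_div hpow (pow_ne_zero m this)).differentiableWithinAt
    obtain ⟨ε, hεm, hmax⟩ := Complex.exists_mem_frontier_isMaxOn_norm Metric.isBounded_ball
      ⟨η₂ n, Metric.mem_ball_self hR0⟩ hdiff
    rw [frontier_ball _ hR0.ne'] at hεm
    have hεn := hnz ε (Metric.sphere_subset_closedBall hεm)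
    have hε0 : ε ≠ 0 := by rw [← norm_pos_iff]; linarith [hεn.1]
    have hη := hmax (subset_closure (Metric.mem_ball_self hR0))
    simp only [Set.mem_ofPred_eq, Function.comp_apply, norm_div, norm_pow, h₂, one_pow, div_one] at hη
    obtain ⟨hgap, hprod⟩ := hgood ε (by rwa [mem_sphere_iff_norm] at hεm)
    have hDε : D n ε ≠ 0 := by
      rw [hDprod n ε hε0, Finset.prod_ne_zero_iff]
      intro j _ h0
      have h1 := hgap j
      rw [h0, norm_zero] at h1
      exact absurd h1 (not_le.2 (mul_pos hg (hmax0 j)))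
    refine ⟨ε, hεn.1, hεn.2, hgap, hDε, hη.trans ?_⟩
    have hε'0 : ε' ≠ 0 := by rw [← norm_ne_zero_iff, hε']; exact one_ne_zero
    rw [← norm_prod, ← norm_prod, ← hDprod n ε hε0, ← hDprod n ε' hε'0] at hprod
    have hZ : ‖D n ε'‖ ≤ partitionFunction (n + 1) (freeFermionWeight α β γ) := by
      simp only [hD, vertexWeight_eq_freeFermionWeight]
      exact norm_signedSum_le (fun t => (freeFermionWeight_pos hα hβ hγ hc t).le) _ _ (h₁ n).le
        hε'.le
    have hDpos : 0 < ‖D n ε‖ := norm_pos_iff.2 hDε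
    have hεp : 0 < ‖ε‖ ^ m := pow_pos (norm_pos_iff.2 hε0) _
    rw [div_mul_eq_mul_div, div_le_div_iff₀ hεp hDpos]
    have h5 : ‖D n ε‖ ≤ K * partitionFunction (n + 1) (freeFermionWeight α β γ) * ‖ε‖ ^ m := by
      refine hprod.trans ?_
      rw [mul_right_comm]
      gcongr
    calc ‖F n ε‖ * ‖D n ε‖ ≤ ‖F n ε‖ *
          (K * partitionFunction (n + 1) (freeFermionWeight α β γ) * ‖ε‖ ^ m) := by gcongr
      _ = _ := by ring
  choose ε hε1 hε2 hgap hDne hbound using key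
  have hε0 : ∀ n, ε n ≠ 0 := fun n => by rw [← norm_pos_iff]; linarith [hε1 n]
  set w₂ : ℕ → ℂ := fun n => Complex.exp (Complex.log (ε n) / ((n + 1 : ℕ) : ℂ)) with hw₂
  have hw₂p : ∀ n, w₂ n ^ (n + 1) = ε n := fun n => exp_log_div_pow (hε0 n) n
  have hT := tendsto_torusAvg hα hβ hc hg hw₁n hw₁l (w₂ := w₂)
    (fun n => by rw [hw₂p]; exact hε2 n) (fun n => by rw [hw₂p]; exact hε1 n)
    (fun n j => by rw [hw₂p]; exact hgap n j)
  have hdet := tendsto_det_greenMinor (w₁ := w₁) (w₂ := w₂) (fun n => Complex.exp_ne_zero _)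
    (fun n => Complex.exp_ne_zero _) hw₁l (tendsto_exp_log_div hε1 hε2) hT S t
  have hdet0 := ((hdet.sub_const L).norm).const_mul K
  rw [hL, sub_self, norm_zero, mul_zero, ← hL] at hdet0
  refine squeeze_zero' (Eventually.of_forall fun n => ?_) ?_ hdet0
  · exact div_nonneg (norm_nonneg _)
      (partitionFunction_pos (freeFermionWeight_pos hα hβ hγ hc)).le
  · filter_upwards [eventually_injOn_toTorus S] with n hn
    have hZ : 0 < partitionFunction (n + 1) (freeFermionWeight α β γ) :=
      partitionFunction_pos (freeFermionWeight_pos hα hβ hγ hc)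
    rw [div_le_iff₀ hZ]
    refine (hbound n).trans (le_of_eq ?_)
    have hΔ : ∀ j : ZMod (n + 1) × ZMod (n + 1),
        symbolDet α β γ γ (w₁ n * ZMod.stdAddChar j.1) (w₂ n * ZMod.stdAddChar j.2) ≠ 0 := by
      intro j
      have h1 := hDne n
      simp only [hD] at h1
      rw [← hw₁p n, ← hw₂p n, ← det_torusMatrix, det_torusMatrix_empty,
        Finset.prod_ne_zero_iff] at h1
      exact h1 j (Finset.mem_univ j)
    have h2 := det_torusMatrix_eq_mul_greenMinor S hn t (torusTypes (n + 1) S t)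
      (fun v hv => torusTypes_toTorus hn t hv) hΔ
    rw [det_torusMatrix, det_torusMatrix, hw₁p, hw₂p] at h2
    have h3 : F n (ε n) = D n (ε n) *
        ((greenMinor (n + 1) α β γ γ (w₁ n) (w₂ n) S t).det - L) := by
      simp only [hF, hD, h2]
      ring
    rw [h3, norm_mul, mul_div_cancel_left₀ _ (norm_ne_zero_iff.2 (hDne n))]
    ring

/-- Convergence of the local statistics in the liquid phase. -/
theorem tendsto_boltzmann_liquid {α β γ : ℝ} (hα : 0 < α) (hβ : 0 < β) (hγ : 0 < γ)
    (hc : 0 < γ ^ 2 - α * β)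
    (hliq : |1 + α ^ 2 - β ^ 2 - (γ ^ 2 - α * β) ^ 2| < 2 * (α + β * (γ ^ 2 - α * β)))
    (S : Finset (ℤ × ℤ)) (t : ℤ × ℤ → VertexType) :
    Tendsto (fun n : ℕ => (((boltzmann (n + 1) (freeFermionWeight α β γ)).real
        {σ | ∀ v ∈ S, vertexType σ v = t v} : ℝ) : ℂ)) atTop
      (𝓝 (liquidMinor α β γ S t).det) := by
  set L := (liquidMinor α β γ S t).det with hL
  set η : ℕ → ℂ := fun n => (-1) ^ (n + 1 - 1) with hη
  have hη1 : ∀ n, ‖η n‖ = 1 := fun n => by simp [hη]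
  have hη2 : ∀ n, ‖-η n‖ = 1 := fun n => by rw [norm_neg, hη1]
  have k1 := tendsto_signedSum_sub hα hβ hγ hc hliq S t hη1 hη1
  have k2 := tendsto_signedSum_sub hα hβ hγ hc hliq S t hη1 hη2
  have k3 := tendsto_signedSum_sub hα hβ hγ hc hliq S t hη2 hη1
  have k4 := tendsto_signedSum_sub hα hβ hγ hc hliq S t hη2 hη2
  rw [tendsto_iff_norm_sub_tendsto_zero]
  have k5 := ((k1.add k2).add k3).add k4
  simp only [add_zero] at k5
  refine squeeze_zero' (Eventually.of_forall fun n => norm_nonneg _) ?_ k5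
  filter_upwards [eventually_injOn_toTorus S] with n hn
  have ha := freeFermionWeight_pos hα hβ hγ hc
  have hZ : 0 < partitionFunction (n + 1) (freeFermionWeight α β γ) := partitionFunction_pos ha
  rw [boltzmann_cylinder (fun t => (ha t).le) S t (torusTypes (n + 1) S t)
    (fun v hv => torusTypes_toTorus hn t hv)]
  have e1 := restrictedSum_eq (freeFermionWeight α β γ) (S.image (toTorus (n + 1)))
    (torusTypes (n + 1) S t) (η := η n) rfl
  have e2 := restrictedSum_eq (n := n + 1) (freeFermionWeight α β γ) ∅
    (torusTypes (n + 1) S t) (η := η n) rfl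
  rw [restrictedSum_empty] at e2
  rw [← vertexWeight_eq_freeFermionWeight] at e1 e2
  rw [← add_div, ← add_div, ← add_div, le_div_iff₀ hZ]
  have hZc : (partitionFunction (n + 1) (freeFermionWeight α β γ) : ℂ) ≠ 0 := by
    exact_mod_cast hZ.ne'
  have h3 : ‖(((restrictedSum (freeFermionWeight α β γ) (S.image (toTorus (n + 1)))
      (torusTypes (n + 1) S t) / partitionFunction (n + 1) (freeFermionWeight α β γ) : ℝ)) : ℂ) -
      L‖ * partitionFunction (n + 1) (freeFermionWeight α β γ) =
      ‖(restrictedSum (freeFermionWeight α β γ) (S.image (toTorus (n + 1)))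
        (torusTypes (n + 1) S t) : ℂ) -
        L * partitionFunction (n + 1) (freeFermionWeight α β γ)‖ := by
    rw [← Real.norm_of_nonneg hZ.le, ← Complex.norm_real, ← norm_mul, sub_mul,
      Complex.norm_real, Real.norm_of_nonneg hZ.le, Complex.ofReal_div, div_mul_cancel₀ _ hZc]
  rw [h3]
  generalize signedSum (vertexWeight α β γ γ) (S.image (toTorus (n + 1)))
    (torusTypes (n + 1) S t) (η n) (η n) = x1 at *
  generalize signedSum (vertexWeight α β γ γ) (S.image (toTorus (n + 1)))
    (torusTypes (n + 1) S t) (η n) (-η n) = x2 at *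
  generalize signedSum (vertexWeight α β γ γ) (S.image (toTorus (n + 1)))
    (torusTypes (n + 1) S t) (-η n) (η n) = x3 at *
  generalize signedSum (vertexWeight α β γ γ) (S.image (toTorus (n + 1)))
    (torusTypes (n + 1) S t) (-η n) (-η n) = x4 at *
  generalize signedSum (vertexWeight α β γ γ) ∅ (torusTypes (n + 1) S t) (η n) (η n) = y1 at *
  generalize signedSum (vertexWeight α β γ γ) ∅ (torusTypes (n + 1) S t) (η n) (-η n) = y2 at *
  generalize signedSum (vertexWeight α β γ γ) ∅ (torusTypes (n + 1) S t) (-η n) (η n) = y3 at *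
  generalize signedSum (vertexWeight α β γ γ) ∅ (torusTypes (n + 1) S t) (-η n) (-η n) = y4 at *
  have h5 : (restrictedSum (freeFermionWeight α β γ) (S.image (toTorus (n + 1)))
        (torusTypes (n + 1) S t) : ℂ) -
        L * partitionFunction (n + 1) (freeFermionWeight α β γ) =
      ((x1 - L * y1) + (x2 - L * y2) + (x3 - L * y3) - (x4 - L * y4)) / 2 := by
    linear_combination e1 / 2 - L * e2 / 2
  rw [h5, norm_div, Complex.norm_ofNat]
  have n1 := norm_sub_le ((x1 - L * y1) + (x2 - L * y2) + (x3 - L * y3)) (x4 - L * y4)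
  have n2 := norm_add_le ((x1 - L * y1) + (x2 - L * y2)) (x3 - L * y3)
  have n3 := norm_add_le (x1 - L * y1) (x2 - L * y2)
  have := norm_nonneg (x1 - L * y1 + (x2 - L * y2) + (x3 - L * y3) - (x4 - L * y4))
  linarith

/-! ### The density of occupied edges in the frozen phase -/

section Counting

variable {n : ℕ} [NeZero n]

/-- The number of vertices whose west (`k = false`) or south (`k = true`) edge is occupied
(`b = true`) or empty (`b = false`). -/
noncomputable def occCount (σ : Config (ZMod n)) (k b : Bool) : ℕ :=
  (Finset.univ.filter fun v => inOcc (vertexType σ v) k = b).card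

/-- The weights `a` with an additional factor `s` for every occupied west (`k = false`) or south
(`k = true`) edge. -/
def tilt (a : VertexType → ℝ) (s : ℝ) (k : Bool) (t : VertexType) : ℝ :=
  a t * if inOcc t k then s else 1

theorem weight_tilt (a : VertexType → ℝ) (s : ℝ) (k : Bool) (σ : Config (ZMod n)) :
    weight (tilt a s k) σ = weight a σ * s ^ occCount σ k true := by
  unfold weight tilt occCount
  rw [Finset.prod_mul_distrib, Finset.prod_ite, Finset.prod_const, Finset.prod_const_one, mul_one]

theorem occCount_add (σ : Config (ZMod n)) (k : Bool) :
    occCount σ k true + occCount σ k false = n * n := by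
  unfold occCount
  have h := Finset.card_filter_add_card_filter_not (s := (Finset.univ : Finset (ZMod n × ZMod n)))
    (fun v => inOcc (vertexType σ v) k = true)
  simp only [Bool.not_eq_true] at h
  rw [h]
  simp [ZMod.card]

omit [NeZero n] in
/-- Translation of a configuration on the torus. -/
def translate (u : ZMod n × ZMod n) (σ : Config (ZMod n)) : Config (ZMod n) :=
  ⟨(fun v => σ.1.1 (v + u), fun v => σ.1.2 (v + u)), fun v => by
    have h := σ.2 (v + u)
    simpa only [indegree, outdegree, west, east, south, north, sub_add_eq_add_sub] using h⟩

omit [NeZero n] in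
theorem vertexType_translate (u : ZMod n × ZMod n) (σ : Config (ZMod n)) (v : ZMod n × ZMod n) :
    vertexType (translate u σ) v = vertexType σ (v + u) := by
  rw [vertexType_eq_iff, ← arrows_vertexType]
  simp only [translate, west, east, south, north, sub_add_eq_add_sub]

omit [NeZero n] in
theorem translate_bijective (u : ZMod n × ZMod n) :
    Function.Bijective (translate u : Config (ZMod n) → Config (ZMod n)) := by
  refine Function.bijective_iff_has_inverse.2 ⟨translate (-u), fun σ => ?_, fun σ => ?_⟩ <;>
  · apply Subtype.ext
    simp [translate]

theorem weight_translate (a : VertexType → ℝ) (u : ZMod n × ZMod n) (σ : Config (ZMod n)) :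
    weight a (translate u σ) = weight a σ := by
  unfold weight
  simp only [vertexType_translate]
  exact Fintype.prod_equiv (Equiv.addRight u) _ _ fun v => rfl

/-- The probability that the west (`k = false`) or south (`k = true`) edge of `v` is occupied
(`b = true`) or empty (`b = false`). -/
noncomputable def edgeDensity (a : VertexType → ℝ) (k b : Bool) (v : ZMod n × ZMod n) : ℝ :=
  (∑ σ : Config (ZMod n), if inOcc (vertexType σ v) k = b then weight a σ else 0) /
    partitionFunction n a

theorem edgeDensity_nonneg {a : VertexType → ℝ} (ha : ∀ t, 0 < a t) (k b : Bool)
    (v : ZMod n × ZMod n) : 0 ≤ edgeDensity a k b v := by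
  refine div_nonneg (Finset.sum_nonneg fun σ _ => ?_) (partitionFunction_pos ha).le
  split_ifs
  exacts [weight_nonneg (fun t => (ha t).le) σ, le_rfl]

/-- The Boltzmann measure is invariant under translations. -/
theorem edgeDensity_eq (a : VertexType → ℝ) (k b : Bool) (v v' : ZMod n × ZMod n) :
    edgeDensity a k b v = edgeDensity a k b v' := by
  unfold edgeDensity
  congr 1
  refine ((translate_bijective (v - v')).sum_comp _).symm.trans
    (Finset.sum_congr rfl fun σ _ => ?_) |>.symm
  rw [vertexType_translate, weight_translate, add_sub_cancel]

/-- The expected number of occupied (or empty) edges is the number of vertices times the density. -/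
theorem sum_weight_mul_occCount (a : VertexType → ℝ) (k b : Bool) (v : ZMod n × ZMod n) :
    (∑ σ : Config (ZMod n), weight a σ * occCount σ k b) / partitionFunction n a =
      (n * n : ℝ) * edgeDensity a k b v := by
  have h1 : ∀ σ : Config (ZMod n), weight a σ * occCount σ k b =
      ∑ u : ZMod n × ZMod n, if inOcc (vertexType σ u) k = b then weight a σ else 0 := by
    intro σ
    rw [← Finset.sum_filter, Finset.sum_const, nsmul_eq_mul, mul_comm]
    rfl
  simp only [h1]
  rw [Finset.sum_comm, Finset.sum_div]
  have h2 : ∀ u : ZMod n × ZMod n,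
      (∑ σ : Config (ZMod n), if inOcc (vertexType σ u) k = b then weight a σ else 0) /
        partitionFunction n a = edgeDensity a k b v := fun u => edgeDensity_eq a k b u v
  simp only [h2, Finset.sum_const, Finset.card_univ, Fintype.card_prod, ZMod.card, nsmul_eq_mul]
  push_cast
  ring

end Counting

/-- Jensen's inequality for the exponential function. -/
theorem exp_mean_mul_le {ι : Type*} [Fintype ι] {w x : ι → ℝ} (hw : ∀ i, 0 ≤ w i)
    (hZ : 0 < ∑ i, w i) :
    Real.exp ((∑ i, w i * x i) / ∑ i, w i) * ∑ i, w i ≤ ∑ i, w i * Real.exp (x i) := by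
  set Z := ∑ i, w i with hZd
  set m := (∑ i, w i * x i) / Z with hm
  have h1 : ∀ i, w i * (Real.exp m * (1 + (x i - m))) ≤ w i * Real.exp (x i) := by
    intro i
    refine mul_le_mul_of_nonneg_left ?_ (hw i)
    have h2 : Real.exp (x i) = Real.exp m * Real.exp (x i - m) := by
      rw [← Real.exp_add]; congr 1; ring
    rw [h2]
    refine mul_le_mul_of_nonneg_left ?_ (Real.exp_pos _).le
    linarith [Real.add_one_le_exp (x i - m)]
  refine le_trans (le_of_eq ?_) (Finset.sum_le_sum fun i _ => h1 i)
  have h3 : ∀ i, w i * (Real.exp m * (1 + (x i - m))) =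
      Real.exp m * w i + Real.exp m * (w i * x i) - Real.exp m * m * w i := fun i => by ring
  simp only [h3]
  rw [Finset.sum_sub_distrib, Finset.sum_add_distrib, ← Finset.mul_sum, ← Finset.mul_sum,
    ← Finset.mul_sum, ← hZd]
  have h4 : ∑ i, w i * x i = m * Z := by rw [hm, div_mul_cancel₀ _ hZ.ne']
  rw [h4]
  ring

section Tilt

variable {n : ℕ}

/-- The partition function is half of a signed combination of four signed sums. -/
theorem partitionFunction_le_of_signedSum [NeZero n] {a : VertexType → ℝ} {X : ℝ}
    (h : ∀ η₁ η₂ : ℂ, ‖η₁‖ = 1 → ‖η₂‖ = 1 →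
      ‖signedSum (n := n) (fun t => (a t : ℂ)) ∅ (fun _ => .a1) η₁ η₂‖ ≤ X) :
    partitionFunction n a ≤ 2 * X := by
  have e := restrictedSum_eq (n := n) a ∅ (fun _ => .a1) (η := (-1) ^ (n - 1)) rfl
  rw [restrictedSum_empty] at e
  have n1 : ‖((-1) ^ (n - 1) : ℂ)‖ = 1 := by simp
  have n2 : ‖-((-1) ^ (n - 1) : ℂ)‖ = 1 := by rw [norm_neg, n1]
  set η : ℂ := (-1) ^ (n - 1)
  have k1 := h η η n1 n1
  have k2 := h η (-η) n1 n2
  have k3 := h (-η) η n2 n1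
  have k4 := h (-η) (-η) n2 n2
  have e2 := congrArg norm e
  rw [norm_mul, Complex.norm_ofNat, Complex.norm_real] at e2
  have e3 := Real.le_norm_self (partitionFunction n a)
  generalize signedSum (n := n) (fun t => (a t : ℂ)) ∅ (fun _ => .a1) η η = x1 at *
  generalize signedSum (n := n) (fun t => (a t : ℂ)) ∅ (fun _ => .a1) η (-η) = x2 at *
  generalize signedSum (n := n) (fun t => (a t : ℂ)) ∅ (fun _ => .a1) (-η) η = x3 at *
  generalize signedSum (n := n) (fun t => (a t : ℂ)) ∅ (fun _ => .a1) (-η) (-η) = x4 at *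
  have m1 := norm_sub_le (x1 + x2 + x3) x4
  have m2 := norm_add_le (x1 + x2) x3
  have m3 := norm_add_le x1 x2
  linarith

theorem tilt_freeFermionWeight_true (α β γ s : ℝ) :
    (fun t => (tilt (freeFermionWeight α β γ) s true t : ℂ)) =
      vertexWeight α (s * β) (s * γ) γ := by
  funext t
  cases t <;> simp [tilt, freeFermionWeight, vertexWeight, inOcc] <;> ring

theorem tilt_freeFermionWeight_false (α β γ s : ℝ) :
    (fun t => (tilt (freeFermionWeight α β γ) s false t : ℂ)) =
      vertexWeight (s * α) β γ (s * γ) := by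
  funext t
  cases t <;> simp [tilt, freeFermionWeight, vertexWeight, inOcc] <;> ring

theorem norm_pow_sub_le {A B ε : ℂ} {s : ℝ} (hs : 0 < s) (hε : ‖ε‖ = 1) (n : ℕ) :
    ‖A ^ n - ε * (-(s * B)) ^ n‖ ≤ ‖A‖ ^ n + s ^ n * ‖B‖ ^ n := by
  refine (norm_sub_le _ _).trans (le_of_eq ?_)
  rw [norm_mul, hε, one_mul, norm_pow, norm_pow, norm_neg, norm_mul, Complex.norm_real,
    Real.norm_of_nonneg hs.le, mul_pow]

/-- The partition function with tilted weights is bounded by the products over one of the two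
frequencies. -/
theorem partitionFunction_tilt_le (α β γ : ℝ) {s X : ℝ} (hs : 0 < s) (k : Bool)
    (hX : ∀ w : ℂ, ‖w‖ = 1 → ∏ j : ZMod (n + 1),
      (‖symbolConst (bif k then α else β) (w * ZMod.stdAddChar j)‖ ^ (n + 1) + s ^ (n + 1) *
        ‖symbolSlope (bif k then α else β) (bif k then β else α) γ
          (w * ZMod.stdAddChar j)‖ ^ (n + 1)) ≤ X) :
    partitionFunction (n + 1) (tilt (freeFermionWeight α β γ) s k) ≤ 2 * X := by
  refine partitionFunction_le_of_signedSum fun η₁ η₂ h₁ h₂ => ?_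
  have hη₁ : η₁ ≠ 0 := by rw [← norm_ne_zero_iff, h₁]; exact one_ne_zero
  have hη₂ : η₂ ≠ 0 := by rw [← norm_ne_zero_iff, h₂]; exact one_ne_zero
  have p₁ := exp_log_div_pow hη₁ n
  have p₂ := exp_log_div_pow hη₂ n
  have m₁ := norm_exp_log_div h₁ n
  have m₂ := norm_exp_log_div h₂ n
  set w₁ := Complex.exp (Complex.log η₁ / ((n + 1 : ℕ) : ℂ))
  set w₂ := Complex.exp (Complex.log η₂ / ((n + 1 : ℕ) : ℂ))
  cases k
  · rw [tilt_freeFermionWeight_false, ← p₁, ← p₂, ← det_torusMatrix, det_torusMatrix_empty,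
      Fintype.prod_prod_type_right, norm_prod]
    refine le_trans (Finset.prod_le_prod (fun _ _ => norm_nonneg _) fun j _ => ?_) (hX w₂ m₂)
    have h3 : ∀ i : ZMod (n + 1), symbolDet (s * α) β γ (s * γ) (w₁ * ZMod.stdAddChar i)
        (w₂ * ZMod.stdAddChar j) = symbolConst β (w₂ * ZMod.stdAddChar j) +
        (s * symbolSlope β α γ (w₂ * ZMod.stdAddChar j)) * (w₁ * ZMod.stdAddChar i) := by
      intro i
      unfold symbolDet symbolConst symbolSlope
      ring
    rw [Finset.prod_congr rfl fun i _ => h3 i, prod_add_roots]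
    exact norm_pow_sub_le hs (by rw [p₁, h₁]) _
  · rw [tilt_freeFermionWeight_true, ← p₁, ← p₂, ← det_torusMatrix, det_torusMatrix_empty,
      Fintype.prod_prod_type, norm_prod]
    refine le_trans (Finset.prod_le_prod (fun _ _ => norm_nonneg _) fun j _ => ?_) (hX w₁ m₁)
    have h3 : ∀ i : ZMod (n + 1), symbolDet α (s * β) (s * γ) γ (w₁ * ZMod.stdAddChar j)
        (w₂ * ZMod.stdAddChar i) = symbolConst α (w₁ * ZMod.stdAddChar j) +
        (s * symbolSlope α β γ (w₁ * ZMod.stdAddChar j)) * (w₂ * ZMod.stdAddChar i) := by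
      intro i
      unfold symbolDet symbolConst symbolSlope
      ring
    rw [Finset.prod_congr rfl fun i _ => h3 i, prod_add_roots]
    exact norm_pow_sub_le hs (by rw [p₂, h₂]) _

end Tilt

/-- If `Q j ≤ P j`, with a gap which closes at most quadratically in the distance to one point,
then multiplying the `Q j` by `s > 1` changes the product of the `P j ^ n + Q j ^ n` by a factor
whose logarithm is small compared with `n ^ 2 log s`. -/
theorem prod_two_terms_le {n : ℕ} [NeZero n] {P Q : ZMod n → ℝ} {M κ τ s y : ℝ}
    (hQ0 : ∀ j, 0 ≤ Q j) (hQP : ∀ j, Q j ≤ P j) (hQM : ∀ j, Q j ≤ M) (hκ : 0 < κ)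
    (hgap : ∀ j, 2 * κ * Real.sin (Real.pi * (y + j.val / n)) ^ 2 ≤ P j ^ 2 - Q j ^ 2)
    (hτ : 0 < τ) (hs1 : 1 < s) (hs : (s ^ 2 - 1) * M ^ 2 = 2 * κ * τ ^ 2) :
    ∏ j, (P j ^ n + s ^ n * Q j ^ n) ≤ 2 ^ n * (∏ j, P j) ^ n *
      Real.exp (n * Real.log s * (Real.exp 1 * (2 + τ * n))) := by
  have hn : (0 : ℝ) < n := Nat.cast_pos.2 (NeZero.pos n)
  have hlog : 0 < Real.log s := Real.log_pos hs1
  have hP0 : ∀ j, 0 ≤ P j := fun j => (hQ0 j).trans (hQP j)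
  have hsn : s ^ n = Real.exp (n * Real.log s) := by
    rw [Real.exp_nat_mul, Real.exp_log (by linarith)]
  set θ : ZMod n → ℝ := fun j => Real.exp (-(1 / τ) * |Real.sin (Real.pi * (y + j.val / n))|)
    with hθ
  have h1 : ∀ j, P j ^ n + s ^ n * Q j ^ n ≤
      2 * P j ^ n * Real.exp (n * Real.log s * (Real.exp 1 * θ j)) := by
    intro j
    have hPn := pow_nonneg (hP0 j) n
    have hθ0 : 0 < θ j := Real.exp_pos _
    rcases le_or_gt (s * Q j) (P j) with h | h
    · have h2 : s ^ n * Q j ^ n ≤ P j ^ n := by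
        rw [← mul_pow]
        exact pow_le_pow_left₀ (mul_nonneg (by linarith) (hQ0 j)) h n
      have h3 : 1 ≤ Real.exp (n * Real.log s * (Real.exp 1 * θ j)) :=
        Real.one_le_exp (by positivity)
      nlinarith
    · have h2 : |Real.sin (Real.pi * (y + j.val / n))| < τ := by
        rw [← abs_of_pos hτ]
        apply sq_lt_sq.1
        have h3 := hgap j
        have h4 : P j ^ 2 < (s * Q j) ^ 2 := pow_lt_pow_left₀ h (hP0 j) two_ne_zero
        have h5 : Q j ^ 2 ≤ M ^ 2 := pow_le_pow_left₀ (hQ0 j) (hQM j) 2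
        have h6 : (s ^ 2 - 1) * Q j ^ 2 ≤ (s ^ 2 - 1) * M ^ 2 :=
          mul_le_mul_of_nonneg_left h5 (by nlinarith)
        have h7 : 2 * κ * Real.sin (Real.pi * (y + j.val / n)) ^ 2 < 2 * κ * τ ^ 2 := by nlinarith
        exact lt_of_mul_lt_mul_left h7 (by positivity)
      have h3 : 1 ≤ Real.exp 1 * θ j := by
        simp only [hθ]
        rw [← Real.exp_add]
        apply Real.one_le_exp
        have : 1 / τ * |Real.sin (Real.pi * (y + j.val / n))| ≤ 1 := by
          rw [one_div, inv_mul_le_iff₀ hτ]; linarith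
        linarith
      have h4 : s ^ n ≤ Real.exp (n * Real.log s * (Real.exp 1 * θ j)) := by
        rw [hsn]
        apply Real.exp_le_exp.2
        have : 0 < n * Real.log s := by positivity
        nlinarith
      have h5 : Q j ^ n ≤ P j ^ n := pow_le_pow_left₀ (hQ0 j) (hQP j) n
      have h6 : 1 ≤ s ^ n := one_le_pow₀ hs1.le
      calc P j ^ n + s ^ n * Q j ^ n ≤ s ^ n * P j ^ n + s ^ n * P j ^ n := by
            gcongr
            exact le_mul_of_one_le_left hPn h6
        _ = 2 * P j ^ n * s ^ n := by ring
        _ ≤ _ := by gcongr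
  refine (Finset.prod_le_prod (fun j _ => ?_) fun j _ => h1 j).trans ?_
  · have := pow_nonneg (hP0 j) n
    have := pow_nonneg (hQ0 j) n
    have : 0 < s ^ n := by positivity
    positivity
  rw [Finset.prod_mul_distrib, Finset.prod_mul_distrib, Finset.prod_const, Finset.card_univ,
    ZMod.card, Finset.prod_pow, ← Real.exp_sum, ← Finset.mul_sum, ← Finset.mul_sum]
  have h2 : ∑ j, θ j ≤ 2 + τ * n := by
    refine (sum_exp_sin_le (n := n) (X := 1 / τ) (by positivity) y).trans ?_
    have hx : 0 < 2 * (1 / τ) / n := by positivity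
    have h3 : Real.exp (-(2 * (1 / τ) / n)) ≤ 1 / (1 + 2 * (1 / τ) / n) := by
      rw [Real.exp_neg, one_div (1 + _)]
      apply inv_anti₀ (by positivity)
      linarith [Real.add_one_le_exp (2 * (1 / τ) / n)]
    have h4 : 1 - 1 / (1 + 2 * (1 / τ) / n) = 2 / (2 + τ * n) := by
      field_simp
      ring
    rw [div_le_iff₀ (by rw [sub_pos, Real.exp_lt_one_iff]; linarith)]
    have h5 : 2 / (2 + τ * n) ≤ 1 - Real.exp (-(2 * (1 / τ) / n)) := by linarith
    calc (2 : ℝ) = (2 + τ * n) * (2 / (2 + τ * n)) := by field_simp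
      _ ≤ _ := by gcongr
  have hPp : 0 ≤ (∏ j, P j) ^ n := pow_nonneg (Finset.prod_nonneg fun j _ => hP0 j) n
  gcongr

/-- The tilt `s` for which the tilted smaller term overtakes the larger one only at angles whose
sine is at most `τ`. -/
theorem exists_tilt {M κ τ : ℝ} (hM : 0 < M) (hκ : 0 < κ) (hτ : 0 < τ) :
    ∃ s : ℝ, 1 < s ∧ (s ^ 2 - 1) * M ^ 2 = 2 * κ * τ ^ 2 := by
  have h : 0 < 2 * κ * τ ^ 2 / M ^ 2 := by positivity
  refine ⟨Real.sqrt (1 + 2 * κ * τ ^ 2 / M ^ 2), ?_, ?_⟩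
  · rw [Real.lt_sqrt (by norm_num)]; linarith
  · rw [Real.sq_sqrt (by positivity)]
    field_simp
    ring

theorem prod_norm_symbolConst_le {n : ℕ} [NeZero n] {α : ℝ} (hα : 0 < α) {w : ℂ} (hw : ‖w‖ = 1) :
    ∏ j : ZMod n, ‖symbolConst α (w * ZMod.stdAddChar j)‖ ≤ 2 * max 1 α ^ n := by
  unfold symbolConst
  rw [← norm_prod, prod_add_roots]
  refine (norm_sub_le _ _).trans ?_
  rw [one_pow, norm_one, norm_mul, norm_pow, hw, one_pow, one_mul, norm_pow, norm_neg,
    Complex.norm_real, Real.norm_of_nonneg hα.le, two_mul]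
  exact add_le_add (one_le_pow₀ (le_max_left _ _)) (pow_le_pow_left₀ hα.le (le_max_right _ _) n)

theorem prod_norm_symbolSlope_le {n : ℕ} [NeZero n] {α β γ : ℝ} (hβ : 0 < β)
    (hc : 0 < γ ^ 2 - α * β) {w : ℂ} (hw : ‖w‖ = 1) :
    ∏ j : ZMod n, ‖symbolSlope α β γ (w * ZMod.stdAddChar j)‖ ≤
      2 * max β (γ ^ 2 - α * β) ^ n := by
  have h : ∀ z : ℂ, symbolSlope α β γ z = β + (-((γ ^ 2 - α * β : ℝ) : ℂ)) * z := by
    intro z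
    unfold symbolSlope
    push_cast
    ring
  simp only [h]
  rw [← norm_prod, prod_add_roots]
  refine (norm_sub_le _ _).trans ?_
  rw [norm_mul, norm_pow, norm_pow, hw, one_pow, one_mul, norm_pow, neg_neg, Complex.norm_real,
    Complex.norm_real, Real.norm_of_nonneg hβ.le, Real.norm_of_nonneg hc.le, two_mul]
  exact add_le_add (pow_le_pow_left₀ hβ.le (le_max_left _ _) n)
    (pow_le_pow_left₀ hc.le (le_max_right _ _) n)

/-- The products in the bound for tilted partition functions, when the constant coefficient of the
symbol dominates on the circle. -/
theorem prod_symbol_le_of_const {n : ℕ} [NeZero n] {α β γ : ℝ} (hα : 0 < α) (hβ : 0 < β)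
    (hc : 0 < γ ^ 2 - α * β)
    (hfr : 2 * (α + β * (γ ^ 2 - α * β)) ≤ 1 + α ^ 2 - β ^ 2 - (γ ^ 2 - α * β) ^ 2)
    {τ s : ℝ} (hτ : 0 < τ) (hs1 : 1 < s)
    (hs : (s ^ 2 - 1) * (1 + α + β + (γ ^ 2 - α * β)) ^ 2 =
      2 * (2 * (α + β * (γ ^ 2 - α * β))) * τ ^ 2) {w : ℂ} (hw : ‖w‖ = 1) :
    ∏ j : ZMod n, (‖symbolConst α (w * ZMod.stdAddChar j)‖ ^ n +
        s ^ n * ‖symbolSlope α β γ (w * ZMod.stdAddChar j)‖ ^ n) ≤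
      2 ^ n * (2 * max 1 α ^ n) ^ n *
        Real.exp (n * Real.log s * (Real.exp 1 * (2 + τ * n))) := by
  obtain ⟨y, rfl⟩ := exists_circlePt hw
  have hκ : 0 < 2 * (α + β * (γ ^ 2 - α * β)) := by positivity
  have hz : ∀ j : ZMod n, ‖circlePt y * (ZMod.stdAddChar j : ℂ)‖ = 1 := fun j => by
    rw [norm_mul, norm_circlePt, norm_stdAddChar, one_mul]
  have hgap : ∀ j : ZMod n, 2 * (2 * (α + β * (γ ^ 2 - α * β))) *
      Real.sin (Real.pi * (y + 1 / 2 + j.val / n)) ^ 2 ≤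
      ‖symbolConst α (circlePt y * ZMod.stdAddChar j)‖ ^ 2 -
        ‖symbolSlope α β γ (circlePt y * ZMod.stdAddChar j)‖ ^ 2 := by
    intro j
    rw [normSq_symbol_sub α β γ (hz j), stdAddChar_eq_circlePt, ← circlePt_add, circlePt_re]
    have h1 : Real.pi * (y + 1 / 2 + j.val / n) =
        Real.pi * (y + j.val / n) + Real.pi / 2 := by ring
    have h2 : 2 * Real.pi * (y + j.val / n) = 2 * (Real.pi * (y + j.val / n)) := by ring
    rw [h1, Real.sin_add_pi_div_two, h2, Real.cos_two_mul]
    linarith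
  have hle : ∀ j : ZMod n, ‖symbolSlope α β γ (circlePt y * ZMod.stdAddChar j)‖ ≤
      ‖symbolConst α (circlePt y * ZMod.stdAddChar j)‖ := by
    intro j
    have h1 : 0 ≤ 2 * (2 * (α + β * (γ ^ 2 - α * β))) *
      Real.sin (Real.pi * (y + 1 / 2 + j.val / n)) ^ 2 := by positivity
    exact (pow_le_pow_iff_left₀ (norm_nonneg _) (norm_nonneg _) two_ne_zero).1
      (by linarith [hgap j])
  refine (prod_two_terms_le (fun j => norm_nonneg _) hle
    (fun j => (norm_symbolSlope_le hβ hc (hz j)).trans (by linarith)) hκ hgap hτ hs1 hs).trans ?_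
  have h1 := prod_norm_symbolConst_le (n := n) hα hw
  have h2 : 0 ≤ ∏ j : ZMod n, ‖symbolConst α (circlePt y * ZMod.stdAddChar j)‖ :=
    Finset.prod_nonneg fun j _ => norm_nonneg _
  gcongr

/-- The products in the bound for tilted partition functions, when the linear coefficient of the
symbol dominates on the circle. -/
theorem prod_symbol_le_of_slope {n : ℕ} [NeZero n] {α β γ : ℝ} (hα : 0 < α) (hβ : 0 < β)
    (hc : 0 < γ ^ 2 - α * β)
    (hfr : 1 + α ^ 2 - β ^ 2 - (γ ^ 2 - α * β) ^ 2 ≤ -(2 * (α + β * (γ ^ 2 - α * β))))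
    {τ s : ℝ} (hτ : 0 < τ) (hs1 : 1 < s)
    (hs : (s ^ 2 - 1) * (1 + α + β + (γ ^ 2 - α * β)) ^ 2 =
      2 * (2 * (α + β * (γ ^ 2 - α * β))) * τ ^ 2) {w : ℂ} (hw : ‖w‖ = 1) :
    ∏ j : ZMod n, (‖symbolSlope α β γ (w * ZMod.stdAddChar j)‖ ^ n +
        s ^ n * ‖symbolConst α (w * ZMod.stdAddChar j)‖ ^ n) ≤
      2 ^ n * (2 * max β (γ ^ 2 - α * β) ^ n) ^ n *
        Real.exp (n * Real.log s * (Real.exp 1 * (2 + τ * n))) := by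
  obtain ⟨y, rfl⟩ := exists_circlePt hw
  have hκ : 0 < 2 * (α + β * (γ ^ 2 - α * β)) := by positivity
  have hz : ∀ j : ZMod n, ‖circlePt y * (ZMod.stdAddChar j : ℂ)‖ = 1 := fun j => by
    rw [norm_mul, norm_circlePt, norm_stdAddChar, one_mul]
  have hgap : ∀ j : ZMod n, 2 * (2 * (α + β * (γ ^ 2 - α * β))) *
      Real.sin (Real.pi * (y + j.val / n)) ^ 2 ≤
      ‖symbolSlope α β γ (circlePt y * ZMod.stdAddChar j)‖ ^ 2 -
      ‖symbolConst α (circlePt y * ZMod.stdAddChar j)‖ ^ 2 := by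
    intro j
    have h1 := normSq_symbol_sub α β γ (hz j)
    rw [stdAddChar_eq_circlePt, ← circlePt_add, circlePt_re] at h1
    rw [stdAddChar_eq_circlePt, ← circlePt_add]
    have h2 : 2 * Real.pi * (y + j.val / n) = 2 * (Real.pi * (y + j.val / n)) := by ring
    rw [h2, Real.cos_two_mul, Real.cos_sq'] at h1
    linarith
  have hle : ∀ j : ZMod n, ‖symbolConst α (circlePt y * ZMod.stdAddChar j)‖ ≤
      ‖symbolSlope α β γ (circlePt y * ZMod.stdAddChar j)‖ := by
    intro j
    have h1 : 0 ≤ 2 * (2 * (α + β * (γ ^ 2 - α * β))) *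
      Real.sin (Real.pi * (y + j.val / n)) ^ 2 := by positivity
    exact (pow_le_pow_iff_left₀ (norm_nonneg _) (norm_nonneg _) two_ne_zero).1
      (by linarith [hgap j])
  refine (prod_two_terms_le (fun j => norm_nonneg _) hle
    (fun j => (norm_symbolConst_le hα (hz j)).trans (by linarith)) hκ hgap hτ hs1 hs).trans ?_
  have h1 := prod_norm_symbolSlope_le (n := n) hβ hc hw
  have h2 : 0 ≤ ∏ j : ZMod n, ‖symbolSlope α β γ (circlePt y * ZMod.stdAddChar j)‖ :=
    Finset.prod_nonneg fun j _ => norm_nonneg _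
  gcongr

/-- Taking logarithms in an exponential moment bound: the constants are of order `N`, and the only
term of order `N ^ 2` is the small one with `τ`. -/
theorem density_le_of_exp_le {N : ℕ} (hN : 0 < N) {p m s τ : ℝ} (hs : 1 < s) (hm : 0 < m)
    (h5 : Real.exp (Real.log s * ((N * N : ℝ) * p)) * m ^ (N * N) ≤
      2 * (2 ^ N * (2 * m ^ N) ^ N *
        Real.exp (N * Real.log s * (Real.exp 1 * (2 + τ * N))))) :
    p ≤ (3 / Real.log s + 2 * Real.exp 1) / N + Real.exp 1 * τ := by
  have hlog : 0 < Real.log s := Real.log_pos hs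
  have hN0 : (0 : ℝ) < N := Nat.cast_pos.2 hN
  have hl2 : Real.log 2 ≤ 1 := by
    linarith [Real.log_le_sub_one_of_pos (show (0 : ℝ) < 2 by norm_num)]
  have h6 : (2 : ℝ) * (2 ^ N * (2 * m ^ N) ^ N *
        Real.exp (N * Real.log s * (Real.exp 1 * (2 + τ * N)))) =
      Real.exp ((1 + 2 * N) * Real.log 2 + N * Real.log s * (Real.exp 1 * (2 + τ * N))) *
        m ^ (N * N) := by
    have e1 : Real.exp ((1 + 2 * N) * Real.log 2) = 2 * 2 ^ N * 2 ^ N := by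
      have : ((1 + 2 * N : ℝ)) * Real.log 2 = ((1 + N + N : ℕ) : ℝ) * Real.log 2 := by
        push_cast; ring
      rw [this, Real.exp_nat_mul, Real.exp_log (by norm_num)]
      ring
    rw [Real.exp_add, e1, mul_pow, ← pow_mul]
    ring
  rw [h6] at h5
  have h7 := Real.exp_le_exp.1 (le_of_mul_le_mul_right h5 (by positivity))
  have hN1 : (1 : ℝ) ≤ N := by exact_mod_cast hN
  have h8 : (1 + 2 * N) * Real.log 2 ≤ 3 * (N : ℝ) := by nlinarith [Real.log_nonneg one_le_two]
  have h9 : p * (Real.log s * (N * N)) ≤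
      ((3 / Real.log s + 2 * Real.exp 1) / N + Real.exp 1 * τ) * (Real.log s * (N * N)) := by
    have : ((3 / Real.log s + 2 * Real.exp 1) / N + Real.exp 1 * τ) * (Real.log s * (N * N)) =
        3 * N + N * Real.log s * (Real.exp 1 * (2 + τ * N)) := by
      field_simp
      ring
    rw [this]
    linarith
  exact le_of_mul_le_mul_right h9 (by positivity)

/-- A bound for the exponential moment of the number of edges of one kind gives a bound for the
density of these edges. -/
theorem edgeDensity_le {n : ℕ} {a : VertexType → ℝ} (ha : ∀ t, 0 < a t) {s τ m : ℝ} (hs : 1 < s)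
    (hm : 0 < m) (hZ : m ^ ((n + 1) * (n + 1)) ≤ partitionFunction (n + 1) a) (k b : Bool)
    (hmom : ∑ σ : Config (ZMod (n + 1)), weight a σ * s ^ occCount σ k b ≤
      2 * (2 ^ (n + 1) * (2 * m ^ (n + 1)) ^ (n + 1) *
        Real.exp ((n + 1 : ℕ) * Real.log s * (Real.exp 1 * (2 + τ * (n + 1 : ℕ))))))
    (v : ZMod (n + 1) × ZMod (n + 1)) :
    edgeDensity a k b v ≤ (3 / Real.log s + 2 * Real.exp 1) / (n + 1 : ℕ) + Real.exp 1 * τ := by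
  have hlog : 0 < Real.log s := Real.log_pos hs
  have hN : (0 : ℝ) < ((n + 1 : ℕ) : ℝ) := Nat.cast_pos.2 n.succ_pos
  have hZ0 : 0 < partitionFunction (n + 1) a := partitionFunction_pos ha
  have h1 := exp_mean_mul_le (w := fun σ : Config (ZMod (n + 1)) => weight a σ)
    (x := fun σ => Real.log s * occCount σ k b) (fun σ => weight_nonneg (fun t => (ha t).le) σ) hZ0
  have h2 : (∑ σ : Config (ZMod (n + 1)), weight a σ * (Real.log s * occCount σ k b)) /
      ∑ σ : Config (ZMod (n + 1)), weight a σ =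
      Real.log s * (((n + 1 : ℕ) * (n + 1 : ℕ) : ℝ) * edgeDensity a k b v) := by
    rw [← sum_weight_mul_occCount a k b v, mul_div_assoc', Finset.mul_sum]
    congr 1
    exact Finset.sum_congr rfl fun σ _ => by ring
  have h3 : ∀ σ : Config (ZMod (n + 1)), Real.exp (Real.log s * occCount σ k b) =
      s ^ occCount σ k b := by
    intro σ
    rw [mul_comm, Real.exp_nat_mul, Real.exp_log (by linarith)]
  rw [h2] at h1
  simp only [h3] at h1
  have h4 := h1.trans hmom
  have h5 := (mul_le_mul_of_nonneg_left hZ (Real.exp_pos _).le).trans h4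
  exact density_le_of_exp_le n.succ_pos hs hm h5

theorem tendsto_edgeDensity {a : VertexType → ℝ} (ha : ∀ t, 0 < a t) (k b : Bool)
    (h : ∀ τ : ℝ, 0 < τ → ∃ C : ℝ, ∀ (n : ℕ) (v : ZMod (n + 1) × ZMod (n + 1)),
      edgeDensity a k b v ≤ C / (n + 1 : ℕ) + Real.exp 1 * τ)
    (v : ∀ n : ℕ, ZMod (n + 1) × ZMod (n + 1)) :
    Tendsto (fun n => edgeDensity a k b (v n)) atTop (𝓝 0) := by
  rw [Metric.tendsto_atTop]
  intro δ hδ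
  have he := Real.exp_pos 1
  obtain ⟨C, hC⟩ := h (δ / (2 * Real.exp 1)) (by positivity)
  have h1 : Tendsto (fun n : ℕ => C / ((n + 1 : ℕ) : ℝ)) atTop (𝓝 0) :=
    (tendsto_const_div_atTop_nhds_zero_nat C).comp (tendsto_add_atTop_nat 1)
  obtain ⟨N, hN⟩ := (Metric.tendsto_atTop.1 h1) (δ / 2) (by linarith)
  refine ⟨N, fun n hn => ?_⟩
  have h2 := hN n hn
  rw [Real.dist_eq, sub_zero] at h2 ⊢
  rw [abs_of_nonneg (edgeDensity_nonneg ha _ _ _)]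
  have h3 : Real.exp 1 * (δ / (2 * Real.exp 1)) = δ / 2 := by field_simp
  have h4 := hC n (v n)
  rw [h3] at h4
  linarith [le_abs_self (C / ((n + 1 : ℕ) : ℝ))]

/-- The two constant configurations as a lower bound for the partition function. -/
theorem max_pow_le_partitionFunction {a : VertexType → ℝ} (ha : ∀ t, 0 < a t) {n : ℕ} [NeZero n]
    {t t' : VertexType} (ht : ∀ k, inOcc t k = outOcc t k) (ht' : ∀ k, inOcc t' k = outOcc t' k) :
    max (a t) (a t') ^ (n * n) ≤ partitionFunction n a := by
  rcases max_choice (a t) (a t') with h | h <;> rw [h]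
  · exact pow_le_partitionFunction (fun t => (ha t).le) ht
  · exact pow_le_partitionFunction (fun t => (ha t).le) ht'

/-- If the constant coefficient of the symbol dominates on the circle, the density of occupied
edges tends to zero. For the horizontal edges (`k = false`) the symbol is considered as a linear
function of the first variable, which exchanges `α` and `β`. -/
theorem tendsto_edgeDensity_true {α β γ : ℝ} (hα : 0 < α) (hβ : 0 < β) (hγ : 0 < γ)
    (hc : 0 < γ ^ 2 - α * β) (k : Bool) {α' β' : ℝ} (hα' : α' = bif k then α else β)
    (hβ' : β' = bif k then β else α)
    (hfr : 2 * (α' + β' * (γ ^ 2 - α' * β')) ≤ 1 + α' ^ 2 - β' ^ 2 - (γ ^ 2 - α' * β') ^ 2)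
    (v : ∀ n : ℕ, ZMod (n + 1) × ZMod (n + 1)) :
    Tendsto (fun n => edgeDensity (freeFermionWeight α β γ) k true (v n)) atTop (𝓝 0) := by
  have ha := freeFermionWeight_pos hα hβ hγ hc
  have hα'0 : 0 < α' := by rw [hα']; cases k <;> assumption
  have hβ'0 : 0 < β' := by rw [hβ']; cases k <;> assumption
  have hc' : 0 < γ ^ 2 - α' * β' := by
    rw [hα', hβ']; cases k <;> simp only [cond_true, cond_false] <;> linarith
  refine tendsto_edgeDensity ha k true (fun τ hτ => ?_) v
  obtain ⟨s, hs1, hs⟩ := exists_tilt (M := 1 + α' + β' + (γ ^ 2 - α' * β'))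
    (κ := 2 * (α' + β' * (γ ^ 2 - α' * β'))) (by positivity) (by positivity) hτ
  refine ⟨3 / Real.log s + 2 * Real.exp 1, fun n v => ?_⟩
  refine edgeDensity_le ha hs1 (m := max 1 α') (by positivity) ?_ k true ?_ v
  · cases k
    · rw [hα']
      exact max_pow_le_partitionFunction ha (t := .a1) (t' := .b1) (by decide) (by decide)
    · rw [hα']
      exact max_pow_le_partitionFunction ha (t := .a1) (t' := .b2) (by decide) (by decide)
  · simp only [← weight_tilt]
    refine partitionFunction_tilt_le α β γ (by linarith) k fun w hw => ?_
    rw [← hα', ← hβ']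
    exact prod_symbol_le_of_const hα'0 hβ'0 hc' hfr hτ hs1 hs hw

/-- If the linear coefficient of the symbol dominates on the circle, the density of empty edges
tends to zero. For the horizontal edges (`k = false`) `α` and `β` are exchanged. -/
theorem tendsto_edgeDensity_false {α β γ : ℝ} (hα : 0 < α) (hβ : 0 < β) (hγ : 0 < γ)
    (hc : 0 < γ ^ 2 - α * β) (k : Bool) {α' β' : ℝ} (hα' : α' = bif k then α else β)
    (hβ' : β' = bif k then β else α)
    (hfr : 1 + α' ^ 2 - β' ^ 2 - (γ ^ 2 - α' * β') ^ 2 ≤ -(2 * (α' + β' * (γ ^ 2 - α' * β'))))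
    (v : ∀ n : ℕ, ZMod (n + 1) × ZMod (n + 1)) :
    Tendsto (fun n => edgeDensity (freeFermionWeight α β γ) k false (v n)) atTop (𝓝 0) := by
  have ha := freeFermionWeight_pos hα hβ hγ hc
  have hα'0 : 0 < α' := by rw [hα']; cases k <;> assumption
  have hβ'0 : 0 < β' := by rw [hβ']; cases k <;> assumption
  have hc' : 0 < γ ^ 2 - α' * β' := by
    rw [hα', hβ']; cases k <;> simp only [cond_true, cond_false] <;> linarith
  have hcc : γ ^ 2 - α' * β' = γ ^ 2 - α * β := by
    rw [hα', hβ']; cases k <;> simp only [cond_true, cond_false]; ring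
  refine tendsto_edgeDensity ha k false (fun τ hτ => ?_) v
  obtain ⟨s, hs1, hs⟩ := exists_tilt (M := 1 + α' + β' + (γ ^ 2 - α' * β'))
    (κ := 2 * (α' + β' * (γ ^ 2 - α' * β'))) (by positivity) (by positivity) hτ
  have hs0 : 0 < s := by linarith
  refine ⟨3 / Real.log s + 2 * Real.exp 1, fun n v => ?_⟩
  refine edgeDensity_le ha hs1 (m := max β' (γ ^ 2 - α' * β')) (by positivity) ?_ k false ?_ v
  · rw [hcc]
    cases k
    · rw [hβ']
      exact max_pow_le_partitionFunction ha (t := .b2) (t' := .a2) (by decide) (by decide)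
    · rw [hβ']
      exact max_pow_le_partitionFunction ha (t := .b1) (t' := .a2) (by decide) (by decide)
  · -- counting empty edges with `s` is counting occupied edges with `s⁻¹`
    have h1 : ∀ σ : Config (ZMod (n + 1)),
        weight (freeFermionWeight α β γ) σ * s ^ occCount σ k false =
          weight (tilt (freeFermionWeight α β γ) s⁻¹ k) σ * s ^ ((n + 1) * (n + 1)) := by
      intro σ
      rw [weight_tilt, mul_assoc, ← occCount_add σ k, pow_add, inv_pow]
      have := (pow_pos hs0 (occCount σ k true)).ne'
      field_simp
    simp only [h1]
    rw [← Finset.sum_mul, ← le_div_iff₀ (by positivity), mul_div_assoc]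
    refine partitionFunction_tilt_le α β γ (inv_pos.2 hs0) k fun w hw => ?_
    rw [← hα', ← hβ', le_div_iff₀ (by positivity)]
    refine le_trans (le_of_eq ?_)
      (prod_symbol_le_of_slope (n := n + 1) hα'0 hβ'0 hc' hfr hτ hs1 hs hw)
    have h2 : s ^ ((n + 1) * (n + 1)) = ∏ _j : ZMod (n + 1), s ^ (n + 1) := by
      rw [Finset.prod_const, Finset.card_univ, ZMod.card, pow_mul]
    rw [h2, ← Finset.prod_mul_distrib]
    refine Finset.prod_congr rfl fun j _ => ?_
    rw [inv_pow]
    have := (pow_pos hs0 (n + 1)).ne'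
    field_simp
    ring

/-! ### Convergence in the frozen phase -/

theorem outOcc_vertexType {R : Type*} [CommRing R] (σ : Config R) (v : R × R) :
    outOcc (vertexType σ v) false = inOcc (vertexType σ (v + (1, 0))) false ∧
      outOcc (vertexType σ v) true = inOcc (vertexType σ (v + (0, 1))) true := by
  rw [(outOcc_eq _).1, (outOcc_eq _).2, (inOcc_eq _).1, (inOcc_eq _).2, ← arrows_vertexType,
    ← arrows_vertexType, ← arrows_vertexType]
  simp [west, east, south, north]

theorem eq_of_occ {t t₀ : VertexType} (ht₀ : ∀ k, inOcc t₀ k = outOcc t₀ k)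
    (h : ∀ k, inOcc t k = inOcc t₀ k) (h' : ∀ k, outOcc t k = inOcc t₀ k) : t = t₀ := by
  revert t t₀
  decide

theorem measurableSet_vertexType_ne (v : ℤ × ℤ) (t : VertexType) :
    MeasurableSet {σ : Config ℤ | vertexType σ v ≠ t} :=
  (measurableSet_vertexType v t).compl

/-- A vertex is not of type `t₀` only if one of its four edges is in the wrong state. -/
theorem boltzmann_ne_le {n : ℕ} [NeZero n] {a : VertexType → ℝ} (ha : ∀ t, 0 < a t)
    {t₀ : VertexType} (ht₀ : ∀ k, inOcc t₀ k = outOcc t₀ k) (v : ℤ × ℤ) :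
    (boltzmann n a).real {σ | vertexType σ v ≠ t₀} ≤
      edgeDensity a false (!inOcc t₀ false) (toTorus n v) +
      edgeDensity a false (!inOcc t₀ false) (toTorus n v + (1, 0)) +
      edgeDensity a true (!inOcc t₀ true) (toTorus n v) +
      edgeDensity a true (!inOcc t₀ true) (toTorus n v + (0, 1)) := by
  classical
  rw [boltzmann_real (fun t => (ha t).le) (measurableSet_vertexType_ne v t₀)]
  unfold edgeDensity
  rw [← add_div, ← add_div, ← add_div]
  refine div_le_div_of_nonneg_right ?_ (partitionFunction_pos ha).le
  rw [← Finset.sum_add_distrib, ← Finset.sum_add_distrib, ← Finset.sum_add_distrib]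
  refine Finset.sum_le_sum fun σ _ => ?_
  have hw := weight_nonneg (fun t => (ha t).le) σ
  have key : ∀ b c : Bool, b ≠ c → b = !c := by decide
  simp only [Set.mem_ofPred_eq, vertexType_periodize]
  by_cases h : vertexType σ (toTorus n v) = t₀
  · rw [if_neg (not_not.2 h)]
    refine add_nonneg (add_nonneg (add_nonneg ?_ ?_) ?_) ?_ <;>
    · split_ifs
      exacts [hw, le_rfl]
  · rw [if_pos h]
    have h1 : ¬ ((∀ k, inOcc (vertexType σ (toTorus n v)) k = inOcc t₀ k) ∧
        ∀ k, outOcc (vertexType σ (toTorus n v)) k = inOcc t₀ k) := fun h2 =>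
      h (eq_of_occ ht₀ h2.1 h2.2)
    simp only [Bool.forall_bool, (outOcc_vertexType σ _).1, (outOcc_vertexType σ _).2] at h1
    by_cases c1 : inOcc (vertexType σ (toTorus n v)) false = inOcc t₀ false
    · by_cases c2 : inOcc (vertexType σ (toTorus n v)) true = inOcc t₀ true
      · by_cases c3 : inOcc (vertexType σ (toTorus n v + (1, 0))) false = inOcc t₀ false
        · by_cases c4 : inOcc (vertexType σ (toTorus n v + (0, 1))) true = inOcc t₀ true
          · exact absurd ⟨⟨c1, c2⟩, c3, c4⟩ h1
          · rw [if_pos (key _ _ c4)]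
            refine le_add_of_nonneg_left (add_nonneg (add_nonneg ?_ ?_) ?_) <;>
            · split_ifs
              exacts [hw, le_rfl]
        · rw [if_pos (key _ _ c3)]
          refine (le_add_of_nonneg_left ?_).trans ((le_add_of_nonneg_right ?_).trans
            (le_add_of_nonneg_right ?_)) <;>
          · split_ifs
            exacts [hw, le_rfl]
      · rw [if_pos (key _ _ c2)]
        refine (le_add_of_nonneg_left (add_nonneg ?_ ?_)).trans (le_add_of_nonneg_right ?_) <;>
        · split_ifs
          exacts [hw, le_rfl]
    · rw [if_pos (key _ _ c1)]
      refine (le_add_of_nonneg_right ?_).trans ((le_add_of_nonneg_right ?_).trans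
            (le_add_of_nonneg_right ?_)) <;>
      · split_ifs
        exacts [hw, le_rfl]

/-- If the density of the edges which are not in the state prescribed by the type `t₀` tends to
zero, all vertices have type `t₀` in the limit. -/
theorem tendsto_cylinder_of_edgeDensity {a : VertexType → ℝ} (ha : ∀ t, 0 < a t)
    {t₀ : VertexType} (ht₀ : ∀ k, inOcc t₀ k = outOcc t₀ k)
    (h : ∀ k, ∀ v : ∀ n : ℕ, ZMod (n + 1) × ZMod (n + 1),
      Tendsto (fun n => edgeDensity a k (!inOcc t₀ k) (v n)) atTop (𝓝 0))
    (S : Finset (ℤ × ℤ)) (t : ℤ × ℤ → VertexType) :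
    Tendsto (fun n : ℕ => (boltzmann (n + 1) a).real {σ | ∀ v ∈ S, vertexType σ v = t v}) atTop
      (𝓝 (if ∀ v ∈ S, t v = t₀ then 1 else 0)) := by
  have hp : ∀ n : ℕ, IsProbabilityMeasure (boltzmann (n + 1) a) := fun n =>
    isProbabilityMeasure_boltzmann ha
  have h1 : ∀ v : ℤ × ℤ,
      Tendsto (fun n : ℕ => (boltzmann (n + 1) a).real {σ | vertexType σ v ≠ t₀}) atTop
        (𝓝 0) := by
    intro v
    have h2 := (((h false fun n => toTorus (n + 1) v).add
      (h false fun n => toTorus (n + 1) v + (1, 0))).add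
      (h true fun n => toTorus (n + 1) v)).add (h true fun n => toTorus (n + 1) v + (0, 1))
    simp only [add_zero] at h2
    exact squeeze_zero (fun n => measureReal_nonneg) (fun n => boltzmann_ne_le ha ht₀ v) h2
  split_ifs with hS
  · have h2 : Tendsto (fun n : ℕ => 1 - ∑ v ∈ S,
        (boltzmann (n + 1) a).real {σ | vertexType σ v ≠ t₀}) atTop (𝓝 1) := by
      simpa using (tendsto_finsetSum S fun v _ => h1 v).const_sub 1
    refine tendsto_of_tendsto_of_tendsto_of_le_of_le h2 tendsto_const_nhds (fun n => ?_)
      fun n => measureReal_le_one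
    have h3 := probReal_compl_eq_one_sub (μ := boltzmann (n + 1) a) (measurableSet_cylinder S t)
    have h4 : (boltzmann (n + 1) a).real {σ | ∀ v ∈ S, vertexType σ v = t v}ᶜ ≤
        ∑ v ∈ S, (boltzmann (n + 1) a).real {σ | vertexType σ v ≠ t₀} := by
      refine le_trans (measureReal_mono ?_ (measure_ne_top _ _)) (measureReal_biUnion_finset_le S _)
      intro σ hσ
      simp only [Set.mem_compl_iff, Set.mem_ofPred_eq, not_forall] at hσ
      obtain ⟨v, hv, hne⟩ := hσ
      simp only [Set.mem_iUnion]
      exact ⟨v, hv, fun h5 => hne (h5.trans (hS v hv).symm)⟩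
    simp only
    linarith
  · push Not at hS
    obtain ⟨v, hv, hne⟩ := hS
    refine squeeze_zero (fun n => measureReal_nonneg) (fun n => measureReal_mono ?_) (h1 v)
    intro σ hσ h2
    exact hne ((hσ v hv).symm.trans h2)

/-! ### The single-vertex probabilities -/

/-- The probability of a type at a vertex, in terms of the moments of `1 / Δ`. -/
noncomputable def typeProb (α β γ : ℝ) : VertexType → ℂ
  | .a1 => (symbolMoment α β γ 0 0 + β * symbolMoment α β γ 0 1) *
      (symbolMoment α β γ 0 0 + α * symbolMoment α β γ 1 0) -
      γ ^ 2 * symbolMoment α β γ 1 0 * symbolMoment α β γ 0 1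
  | .a2 => (γ ^ 2 - α * β) * (γ ^ 2 * symbolMoment α β γ 1 1 * symbolMoment α β γ 1 1 -
      (symbolMoment α β γ 0 1 + α * symbolMoment α β γ 1 1) *
      (symbolMoment α β γ 1 0 + β * symbolMoment α β γ 1 1))
  | .b1 => β * ((symbolMoment α β γ 0 0 + β * symbolMoment α β γ 0 1) *
      (symbolMoment α β γ 0 1 + α * symbolMoment α β γ 1 1) -
      γ ^ 2 * symbolMoment α β γ 0 1 * symbolMoment α β γ 1 1)
  | .b2 => α * ((symbolMoment α β γ 1 0 + β * symbolMoment α β γ 1 1) *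
      (symbolMoment α β γ 0 0 + α * symbolMoment α β γ 1 0) -
      γ ^ 2 * symbolMoment α β γ 1 0 * symbolMoment α β γ 1 1)
  | .c1 => γ ^ 2 * ((symbolMoment α β γ 1 0 + β * symbolMoment α β γ 1 1) *
      symbolMoment α β γ 0 1 -
      (symbolMoment α β γ 0 0 + β * symbolMoment α β γ 0 1) * symbolMoment α β γ 1 1)
  | .c2 => γ ^ 2 * (symbolMoment α β γ 1 0 *
      (symbolMoment α β γ 0 1 + α * symbolMoment α β γ 1 1) -
      symbolMoment α β γ 1 1 * (symbolMoment α β γ 0 0 + α * symbolMoment α β γ 1 0))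

/-- For a single vertex the limit is a `2 × 2` determinant of moments. -/
theorem det_liquidMinor_singleton (α β γ : ℝ) (v : ℤ × ℤ) (t : ℤ × ℤ → VertexType) :
    (liquidMinor α β γ {v} t).det = typeProb α β γ (t v) := by
  let e : Bool ≃ (({v} : Finset (ℤ × ℤ)) × Bool) :=
    (Equiv.uniqueProd Bool ({v} : Finset (ℤ × ℤ))).symm
  rw [← Matrix.det_submatrix_equiv_self e, ← Matrix.det_submatrix_equiv_self finTwoEquiv,
    Matrix.det_fin_two]
  have he : ∀ k : Bool, e k = (⟨v, Finset.mem_singleton_self v⟩, k) := fun k => rfl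
  simp only [Matrix.submatrix_apply, he, liquidMinor, Matrix.of_apply, finTwoEquiv,
    Equiv.coe_fn_mk]
  cases t v <;> simp [step, outEdge, adjCombination, vertexWeight, typeProb] <;> ring

/-- The average of a monomial divided by a linear function over the circle. -/
theorem integral_zpow_div {A B : ℂ} (h : ‖B‖ ≠ ‖A‖) (p : ℤ) :
    ∫ x in (0 : ℝ)..1, circlePt x ^ p / (A + B * circlePt x) = circleAvg p A B := by
  have hlow : ∀ z : ℂ, ‖z‖ = 1 → |‖A‖ - ‖B‖| ≤ ‖A + B * z‖ := by
    intro z hz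
    have h1 := abs_norm_sub_norm_le A (-(B * z))
    rwa [norm_neg, norm_mul, hz, mul_one, sub_neg_eq_add] at h1
  have hpos : 0 < |‖A‖ - ‖B‖| := abs_pos.2 (sub_ne_zero.2 h.symm)
  have h1 := tendsto_avg_roots (H := fun _ z => z ^ p / (A + B * z)) (w := fun _ => 1)
    (h := fun x => circlePt x ^ p / (A + B * circlePt x)) (C := 1 / |‖A‖ - ‖B‖|)
    tendsto_const_nhds (Eventually.of_forall fun n j => by
      have hz : ‖(1 : ℂ) * (ZMod.stdAddChar j : ℂ)‖ = 1 := by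
        rw [one_mul, norm_stdAddChar]
      rw [norm_div, norm_zpow, hz, one_zpow]
      exact one_div_le_one_div_of_le hpos (hlow _ hz))
    (Eventually.of_forall fun x z hz => by
      refine Tendsto.div (hz.zpow₀ p (Or.inl ?_)) ((hz.const_mul B).const_add A) ?_
      · rw [← norm_ne_zero_iff, norm_circlePt]
        exact one_ne_zero
      · rw [← norm_pos_iff]
        exact hpos.trans_le (hlow _ (norm_circlePt x)))
  have h2 := tendsto_rootAvg (w := fun _ => 1) (A := fun _ => A) (B := fun _ => B)
    (fun _ => one_ne_zero) (fun n => by norm_num) (fun n => by norm_num) tendsto_const_nhds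
    tendsto_const_nhds h p
  exact tendsto_nhds_unique h1 h2

theorem circleAvg_of_lt {A B : ℂ} (h : ‖B‖ < ‖A‖) : circleAvg 0 A B = 1 / A ∧
    circleAvg 1 A B = 0 := by
  simp [circleAvg, h]

theorem circleAvg_of_gt {A B : ℂ} (h : ‖A‖ < ‖B‖) : circleAvg 0 A B = 0 ∧
    circleAvg 1 A B = 1 / B := by
  simp [circleAvg, not_lt.2 h.le]

/-- If the constant term of the symbol dominates at almost all angles, the inner integral is `1 /
A` for `q = 0` and `0` for `q = 1`. -/
theorem symbolMoment_of_const {α β γ : ℝ} (hα : 0 < α) (hβ : 0 < β) (hc : 0 < γ ^ 2 - α * β)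
    (hfr : 2 * (α + β * (γ ^ 2 - α * β)) ≤ 1 + α ^ 2 - β ^ 2 - (γ ^ 2 - α * β) ^ 2)
    (hα1 : α ≠ 1) (p : ℤ) :
    symbolMoment α β γ p 0 = circleAvg p 1 α ∧ symbolMoment α β γ p 1 = 0 := by
  have hκ : 0 < 2 * (α + β * (γ ^ 2 - α * β)) := by positivity
  have h1 : ∀ᵐ x : ℝ, ‖symbolSlope α β γ (circlePt x)‖ < ‖symbolConst α (circlePt x)‖ := by
    filter_upwards [ae_norm_symbol_ne hα hβ hc] with x hx
    refine lt_of_le_of_ne ?_ hx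
    have h2 := normSq_symbol_sub α β γ (norm_circlePt x)
    rw [circlePt_re] at h2
    have h3 := Real.neg_one_le_cos (2 * Real.pi * x)
    exact (pow_le_pow_iff_left₀ (norm_nonneg _) (norm_nonneg _) two_ne_zero).1 (by nlinarith)
  have hne : ‖(α : ℂ)‖ ≠ ‖(1 : ℂ)‖ := by
    rwa [norm_one, Complex.norm_real, Real.norm_of_nonneg hα.le]
  constructor
  · rw [← integral_zpow_div hne, symbolMoment]
    refine intervalIntegral.integral_congr_ae ?_
    filter_upwards [h1] with x hx _
    rw [(circleAvg_of_lt hx).1, symbolConst, mul_one_div]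
  · rw [symbolMoment]
    refine (intervalIntegral.integral_congr_ae (g := fun _ => 0) ?_).trans (by simp)
    filter_upwards [h1] with x hx _
    rw [(circleAvg_of_lt hx).2, mul_zero]

/-- If the linear term of the symbol dominates at almost all angles, the inner integral is `0` for
`q = 0` and `1 / B` for `q = 1`. -/
theorem symbolMoment_of_slope {α β γ : ℝ} (hα : 0 < α) (hβ : 0 < β) (hc : 0 < γ ^ 2 - α * β)
    (hfr : 1 + α ^ 2 - β ^ 2 - (γ ^ 2 - α * β) ^ 2 ≤ -(2 * (α + β * (γ ^ 2 - α * β))))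
    (hβ1 : γ ^ 2 - α * β ≠ β) (p : ℤ) :
    symbolMoment α β γ p 0 = 0 ∧
      symbolMoment α β γ p 1 = circleAvg p β (-((γ ^ 2 - α * β : ℝ) : ℂ)) := by
  have hκ : 0 < 2 * (α + β * (γ ^ 2 - α * β)) := by positivity
  have h1 : ∀ᵐ x : ℝ, ‖symbolConst α (circlePt x)‖ < ‖symbolSlope α β γ (circlePt x)‖ := by
    filter_upwards [ae_norm_symbol_ne hα hβ hc] with x hx
    refine lt_of_le_of_ne ?_ hx.symm
    have h2 := normSq_symbol_sub α β γ (norm_circlePt x)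
    rw [circlePt_re] at h2
    have h3 := Real.cos_le_one (2 * Real.pi * x)
    exact (pow_le_pow_iff_left₀ (norm_nonneg _) (norm_nonneg _) two_ne_zero).1 (by nlinarith)
  have hne : ‖(-((γ ^ 2 - α * β : ℝ) : ℂ))‖ ≠ ‖(β : ℂ)‖ := by
    rwa [norm_neg, Complex.norm_real, Complex.norm_real, Real.norm_of_nonneg hc.le,
      Real.norm_of_nonneg hβ.le]
  constructor
  · rw [symbolMoment]
    refine (intervalIntegral.integral_congr_ae (g := fun _ => 0) ?_).trans (by simp)
    filter_upwards [h1] with x hx _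
    rw [(circleAvg_of_gt hx).1, mul_zero]
  · rw [← integral_zpow_div hne, symbolMoment]
    refine intervalIntegral.integral_congr_ae ?_
    filter_upwards [h1] with x hx _
    rw [(circleAvg_of_gt hx).2, mul_one_div]
    congr 1
    unfold symbolSlope
    push_cast
    ring

/-- In the frozen phase all vertices have the same type, and it is the one selected by the
single-vertex probabilities. The boundary with the liquid phase is included; there one of the two
terms of the symbol still dominates at all but one angle. -/
theorem exists_frozen_type {α β γ : ℝ} (hα : 0 < α) (hβ : 0 < β) (hγ : 0 < γ)
    (hc : 0 < γ ^ 2 - α * β)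
    (hfr : 2 * (α + β * (γ ^ 2 - α * β)) ≤ |1 + α ^ 2 - β ^ 2 - (γ ^ 2 - α * β) ^ 2|) :
    ∃ t₀ : VertexType, (∀ k, inOcc t₀ k = outOcc t₀ k) ∧
      (∀ k, ∀ v : ∀ n : ℕ, ZMod (n + 1) × ZMod (n + 1),
        Tendsto (fun n => edgeDensity (freeFermionWeight α β γ) k (!inOcc t₀ k) (v n)) atTop
          (𝓝 0)) ∧
      ∀ t, typeProb α β γ t = if t = t₀ then 1 else 0 := by
  obtain ⟨c, hcd⟩ : ∃ c, c = γ ^ 2 - α * β := ⟨_, rfl⟩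
  have hcd' : c = γ ^ 2 - β * α := by rw [hcd]; ring
  have hγc : (γ : ℂ) ^ 2 = c + α * β := by
    rw [hcd]; push_cast; ring
  have hαc : (α : ℂ) ≠ 0 := by exact_mod_cast hα.ne'
  have hβc : (β : ℂ) ≠ 0 := by exact_mod_cast hβ.ne'
  have nα : ‖(α : ℂ)‖ = α := by rw [Complex.norm_real, Real.norm_of_nonneg hα.le]
  have nβ : ‖(β : ℂ)‖ = β := by rw [Complex.norm_real, Real.norm_of_nonneg hβ.le]
  rw [← hcd] at hfr hc
  have nc : ‖-(c : ℂ)‖ = c := by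
    rw [norm_neg, Complex.norm_real, Real.norm_of_nonneg hc.le]
  have hcc : (c : ℂ) ≠ 0 := by exact_mod_cast hc.ne'
  have hβc0 : 0 < β * c := mul_pos hβ hc
  have hαc0 : 0 < α * c := mul_pos hα hc
  rcases le_abs'.1 hfr with hs | hs
  · -- the linear coefficient dominates: `1 + α ≤ |β - c|`
    have h1 : (1 + α) ^ 2 ≤ (β - c) ^ 2 := by nlinarith
    have h2 : 1 + α ≤ |β - c| := by
      rw [← abs_of_pos (show 0 < 1 + α by linarith)]; exact sq_le_sq.1 h1
    have hs0 := hs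
    rw [hcd] at hs0
    rcases le_abs'.1 h2 with h3 | h3
    · refine ⟨.a2, by decide, fun k v => ?_, ?_⟩
      · cases k
        · refine tendsto_edgeDensity_false hα hβ hγ (by rwa [← hcd]) false rfl rfl ?_ v
          simp only [cond_false]
          rw [← hcd']
          nlinarith
        · exact tendsto_edgeDensity_false hα hβ hγ (by rwa [← hcd]) true rfl rfl hs0 v
      · have hm := symbolMoment_of_slope hα hβ (by rwa [← hcd]) hs0 (by rw [← hcd]; linarith)
        rw [← hcd] at hm
        have hgt := circleAvg_of_gt (A := (β : ℂ)) (B := -(c : ℂ)) (by rw [nβ, nc]; linarith)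
        have e1 := (hm 0).1
        have e2 := (hm 1).1
        have e3 := (hm 0).2.trans hgt.1
        have e4 := (hm 1).2.trans hgt.2
        intro t
        cases t <;> simp [typeProb, e1, e2, e3, e4, hγc]
        field_simp
        ring
    · refine ⟨.b1, by decide, fun k v => ?_, ?_⟩
      · cases k
        · refine tendsto_edgeDensity_true hα hβ hγ (by rwa [← hcd]) false rfl rfl ?_ v
          simp only [cond_false]
          rw [← hcd']
          nlinarith
        · exact tendsto_edgeDensity_false hα hβ hγ (by rwa [← hcd]) true rfl rfl hs0 v
      · have hm := symbolMoment_of_slope hα hβ (by rwa [← hcd]) hs0 (by rw [← hcd]; linarith)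
        rw [← hcd] at hm
        have hlt := circleAvg_of_lt (A := (β : ℂ)) (B := -(c : ℂ)) (by rw [nβ, nc]; linarith)
        have e1 := (hm 0).1
        have e2 := (hm 1).1
        have e3 := (hm 0).2.trans hlt.1
        have e4 := (hm 1).2.trans hlt.2
        intro t
        cases t <;> simp [typeProb, e1, e2, e3, e4, hβc]
  · -- the constant coefficient dominates: `β + c ≤ |1 - α|`
    have h1 : (β + c) ^ 2 ≤ (1 - α) ^ 2 := by nlinarith
    have h2 : β + c ≤ |1 - α| := by
      rw [← abs_of_pos (show 0 < β + c by linarith)]; exact sq_le_sq.1 h1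
    have hs0 := hs
    rw [hcd] at hs0
    rcases le_abs'.1 h2 with h3 | h3
    · refine ⟨.b2, by decide, fun k v => ?_, ?_⟩
      · cases k
        · refine tendsto_edgeDensity_false hα hβ hγ (by rwa [← hcd]) false rfl rfl ?_ v
          simp only [cond_false]
          rw [← hcd']
          nlinarith
        · exact tendsto_edgeDensity_true hα hβ hγ (by rwa [← hcd]) true rfl rfl hs0 v
      · have hm := symbolMoment_of_const hα hβ (by rwa [← hcd]) hs0 (by linarith)
        have hgt := circleAvg_of_gt (A := (1 : ℂ)) (B := (α : ℂ)) (by rw [norm_one, nα]; linarith)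
        have e1 := (hm 0).1.trans hgt.1
        have e2 := (hm 1).1.trans hgt.2
        have e3 := (hm 0).2
        have e4 := (hm 1).2
        intro t
        cases t <;> simp [typeProb, e1, e2, e3, e4, hαc]
    · refine ⟨.a1, by decide, fun k v => ?_, ?_⟩
      · cases k
        · refine tendsto_edgeDensity_true hα hβ hγ (by rwa [← hcd]) false rfl rfl ?_ v
          simp only [cond_false]
          rw [← hcd']
          nlinarith
        · exact tendsto_edgeDensity_true hα hβ hγ (by rwa [← hcd]) true rfl rfl hs0 v
      · have hm := symbolMoment_of_const hα hβ (by rwa [← hcd]) hs0 (by linarith)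
        have hlt := circleAvg_of_lt (A := (1 : ℂ)) (B := (α : ℂ)) (by rw [norm_one, nα]; linarith)
        have e1 := (hm 0).1.trans hlt.1
        have e2 := (hm 1).1.trans hlt.2
        have e3 := (hm 0).2
        have e4 := (hm 1).2
        intro t
        cases t <;> simp [typeProb, e1, e2, e3, e4]

/-- All cylinder probabilities converge. -/
theorem exists_tendsto_boltzmann {α β γ : ℝ} (hα : 0 < α) (hβ : 0 < β) (hγ : 0 < γ)
    (hc : 0 < γ ^ 2 - α * β) (S : Finset (ℤ × ℤ)) (t : ℤ × ℤ → VertexType) :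
    ∃ ℓ : ℝ, Tendsto (fun n : ℕ => (boltzmann (n + 1) (freeFermionWeight α β γ)).real
      {σ | ∀ v ∈ S, vertexType σ v = t v}) atTop (𝓝 ℓ) := by
  rcases lt_or_ge |1 + α ^ 2 - β ^ 2 - (γ ^ 2 - α * β) ^ 2| (2 * (α + β * (γ ^ 2 - α * β)))
    with h | h
  · have h1 := tendsto_boltzmann_liquid hα hβ hγ hc h S t
    refine ⟨_, ((Complex.continuous_re.tendsto _).comp h1).congr fun n => ?_⟩
    simp
  · obtain ⟨t₀, ht₀, hd, -⟩ := exists_frozen_type hα hβ hγ hc h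
    exact ⟨_, tendsto_cylinder_of_edgeDensity (freeFermionWeight_pos hα hβ hγ hc) ht₀ hd S t⟩

/-- The limit of the probability of a type at a vertex. -/
theorem tendsto_boltzmann_vertexType {α β γ : ℝ} (hα : 0 < α) (hβ : 0 < β) (hγ : 0 < γ)
    (hc : 0 < γ ^ 2 - α * β) (v : ℤ × ℤ) (t : VertexType) :
    Tendsto (fun n : ℕ => (((boltzmann (n + 1) (freeFermionWeight α β γ)).real
      {σ | vertexType σ v = t} : ℝ) : ℂ)) atTop (𝓝 (typeProb α β γ t)) := by
  have e : {σ : Config ℤ | ∀ u ∈ ({v} : Finset (ℤ × ℤ)), vertexType σ u = (fun _ => t) u} =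
      {σ | vertexType σ v = t} := by
    ext; simp
  rcases lt_or_ge |1 + α ^ 2 - β ^ 2 - (γ ^ 2 - α * β) ^ 2| (2 * (α + β * (γ ^ 2 - α * β)))
    with h | h
  · have h1 := tendsto_boltzmann_liquid hα hβ hγ hc h {v} fun _ => t
    rwa [det_liquidMinor_singleton, e] at h1
  · obtain ⟨t₀, ht₀, hd, hp⟩ := exists_frozen_type hα hβ hγ hc h
    have h1 := tendsto_cylinder_of_edgeDensity (freeFermionWeight_pos hα hβ hγ hc) ht₀ hd {v}
      fun _ => t
    rw [e] at h1
    have h2 := (Complex.continuous_ofReal.tendsto _).comp h1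
    rw [hp]
    by_cases h3 : t = t₀
    · rw [if_pos fun _ _ => h3, Complex.ofReal_one] at h2
      rwa [if_pos h3]
    · rw [if_neg fun h4 => h3 (h4 v (Finset.mem_singleton_self v)), Complex.ofReal_zero] at h2
      rwa [if_neg h3]

/-! ### Existence and uniqueness of the limit law -/

theorem isClopen_vertexType (v : ℤ × ℤ) (t : VertexType) :
    IsClopen {σ : Config ℤ | vertexType σ v = t} := by
  have h1 : ∀ u : ℤ × ℤ, Continuous fun σ : Config ℤ => σ.1.1 u := fun u =>
    (continuous_apply u).comp (continuous_fst.comp continuous_subtype_val)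
  have h2 : ∀ u : ℤ × ℤ, Continuous fun σ : Config ℤ => σ.1.2 u := fun u =>
    (continuous_apply u).comp (continuous_snd.comp continuous_subtype_val)
  have h3 : Continuous fun σ : Config ℤ => (west σ.1 v, east σ.1 v, south σ.1 v, north σ.1 v) :=
    (h1 _).prodMk ((h1 _).prodMk ((h2 _).prodMk (h2 _)))
  have h4 : {σ : Config ℤ | vertexType σ v = t} =
      (fun σ : Config ℤ => (west σ.1 v, east σ.1 v, south σ.1 v, north σ.1 v)) ⁻¹'
        {arrows t} := by
    ext σ
    exact vertexType_eq_iff σ v t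
  rw [h4]
  exact (isClopen_discrete _).preimage h3

theorem isClopen_cylinder (S : Finset (ℤ × ℤ)) (t : ℤ × ℤ → VertexType) :
    IsClopen {σ : Config ℤ | ∀ v ∈ S, vertexType σ v = t v} := by
  have : {σ : Config ℤ | ∀ v ∈ S, vertexType σ v = t v} =
      ⋂ v ∈ S, {σ : Config ℤ | vertexType σ v = t v} := by ext; simp
  rw [this]
  exact isClopen_biInter_finset fun v _ => isClopen_vertexType v (t v)

theorem isClosed_iceRule : IsClosed {σ : Orientation ℤ | IceRule σ} := by
  have h1 : ∀ u : ℤ × ℤ, Continuous fun σ : Orientation ℤ => σ.1 u := fun u =>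
    (continuous_apply u).comp continuous_fst
  have h2 : ∀ u : ℤ × ℤ, Continuous fun σ : Orientation ℤ => σ.2 u := fun u =>
    (continuous_apply u).comp continuous_snd
  have h4 : {σ : Orientation ℤ | IceRule σ} = ⋂ v : ℤ × ℤ,
      (fun σ : Orientation ℤ => (σ.1 (v - (1, 0)), σ.1 v, σ.2 (v - (0, 1)), σ.2 v)) ⁻¹'
        {x | x.1.toNat + (!x.2.1).toNat + x.2.2.1.toNat + (!x.2.2.2).toNat = 2 ∧
          (!x.1).toNat + x.2.1.toNat + (!x.2.2.1).toNat + x.2.2.2.toNat = 2} := by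
    ext σ
    simp [IceRule, indegree, outdegree, west, east, south, north]
  rw [h4]
  refine isClosed_iInter fun v => ?_
  exact (isClosed_discrete _).preimage
    ((h1 _).prodMk ((h1 _).prodMk ((h2 _).prodMk (h2 _))))

instance : CompactSpace (Config ℤ) :=
  isCompact_iff_compactSpace.1 isClosed_iceRule.isCompact

/-- If the probabilities of all cylinder events converge, there is a limit law. -/
theorem exists_law {a : VertexType → ℝ} (ha : ∀ t, 0 < a t)
    (h : ∀ (S : Finset (ℤ × ℤ)) (t : ℤ × ℤ → VertexType), ∃ ℓ : ℝ,
      Tendsto (fun n : ℕ => (boltzmann (n + 1) a).real {σ | ∀ v ∈ S, vertexType σ v = t v}) atTop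
        (𝓝 ℓ)) :
    ∃ P : Measure (Config ℤ), IsSixVertexLaw a P := by
  -- the probability measures on a compact space form a compact space, so that a limit along an
  -- ultrafilter exists
  let μ : ℕ → ProbabilityMeasure (Config ℤ) := fun n =>
    ⟨boltzmann (n + 1) a, isProbabilityMeasure_boltzmann ha⟩
  let U : Ultrafilter ℕ := Ultrafilter.of atTop
  obtain ⟨P, -, hP⟩ := isCompact_univ.ultrafilter_le_nhds (U.map μ) (by simp)
  have hP' : Tendsto μ U (𝓝 P) := hP
  refine ⟨P, inferInstance, fun S t => ?_⟩
  obtain ⟨ℓ, hℓ⟩ := h S t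
  have hC := isClopen_cylinder S t
  -- the indicator function of a cylinder is continuous
  let f : BoundedContinuousFunction (Config ℤ) ℝ := BoundedContinuousFunction.mkOfCompact
    ⟨Set.indicator {σ : Config ℤ | ∀ v ∈ S, vertexType σ v = t v} 1,
      continuous_one.indicator (by rw [hC.frontier_eq]; simp)⟩
  have hf : ∀ ν : Measure (Config ℤ), ∫ σ, f σ ∂ν =
      ν.real {σ | ∀ v ∈ S, vertexType σ v = t v} := fun ν =>
    integral_indicator_one (measurableSet_cylinder S t)
  have h1 := (ProbabilityMeasure.tendsto_iff_forall_integral_tendsto.1 hP') f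
  simp only [hf] at h1
  rwa [tendsto_nhds_unique h1 (hℓ.mono_left (Ultrafilter.of_le _))]

/-- The cylinder events: the types at finitely many vertices are prescribed. -/
def cylinders : Set (Set (Config ℤ)) :=
  {C | ∃ (S : Finset (ℤ × ℤ)) (t : ℤ × ℤ → VertexType), C = {σ | ∀ v ∈ S, vertexType σ v = t v}}

/-- Two cylinders with a common configuration intersect in the cylinder of this configuration. -/
theorem isPiSystem_cylinders : IsPiSystem cylinders := by
  rintro _ ⟨S, t, rfl⟩ _ ⟨S', t', rfl⟩ ⟨σ₀, h₀, h₀'⟩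
  refine ⟨S ∪ S', vertexType σ₀, ?_⟩
  ext σ
  constructor
  · rintro ⟨h, h'⟩ v hv
    rcases Finset.mem_union.1 hv with hv | hv
    · rw [h v hv, h₀ v hv]
    · rw [h' v hv, h₀' v hv]
  · intro h
    exact ⟨fun v hv => (h v (Finset.mem_union_left _ hv)).trans (h₀ v hv),
      fun v hv => (h v (Finset.mem_union_right _ hv)).trans (h₀' v hv)⟩

/-- A map to configurations is measurable if it is measurable vertex by vertex. -/
theorem measurable_of_vertexType {Ω : Type*} [MeasurableSpace Ω] {f : Ω → Config ℤ}
    (h : ∀ (v : ℤ × ℤ) (t : VertexType), MeasurableSet {ω | vertexType (f ω) v = t}) :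
    Measurable f := by
  have hE : ∀ (v : ℤ × ℤ) (p : Bool × Bool × Bool × Bool → Bool) (b : Bool),
      MeasurableSet {ω | p (arrows (vertexType (f ω) v)) = b} := by
    intro v p b
    have : {ω | p (arrows (vertexType (f ω) v)) = b} =
        ⋃ t ∈ {t : VertexType | p (arrows t) = b}, {ω | vertexType (f ω) v = t} := by
      ext; simp
    rw [this]
    exact MeasurableSet.biUnion (Set.to_countable _) fun t _ => h v t
  refine Measurable.subtype_mk (f := fun ω => (f ω).1) ?_
  refine Measurable.prodMk (f := fun ω => (f ω).1.1) (g := fun ω => (f ω).1.2)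
    (measurable_pi_iff.2 fun v => ?_) (measurable_pi_iff.2 fun v => ?_)
  · refine measurable_to_countable' fun b => ?_
    have := hE v (fun x => x.2.1) b
    simp only [← arrows_vertexType] at this
    exact this
  · refine measurable_to_countable' fun b => ?_
    have := hE v (fun x => x.2.2.2) b
    simp only [← arrows_vertexType] at this
    exact this

theorem generateFrom_cylinders :
    (inferInstance : MeasurableSpace (Config ℤ)) = MeasurableSpace.generateFrom cylinders := by
  apply le_antisymm
  · have hid := @measurable_of_vertexType (Config ℤ) (MeasurableSpace.generateFrom cylinders) id
      (fun v t => by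
        refine MeasurableSpace.measurableSet_generateFrom ⟨{v}, fun _ => t, ?_⟩
        ext; simp)
    exact fun s hs => hid hs
  · refine MeasurableSpace.generateFrom_le ?_
    rintro _ ⟨S, t, rfl⟩
    exact measurableSet_cylinder S t

/-- The probabilities of the cylinders, being limits, are determined, and the cylinders are a
generating system stable under intersections. -/
theorem law_unique {a : VertexType → ℝ} {P Q : Measure (Config ℤ)} (hP : IsSixVertexLaw a P)
    (hQ : IsSixVertexLaw a Q) : P = Q := by
  have := hP.1
  have := hQ.1
  refine ext_of_generate_finite cylinders generateFrom_cylinders isPiSystem_cylinders ?_ (by simp)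
  rintro _ ⟨S, t, rfl⟩
  have h1 := tendsto_nhds_unique (hP.2 S t) (hQ.2 S t)
  rwa [measureReal_eq_measureReal_iff] at h1

/-! ### Integrability of the inverse characteristic polynomial -/

theorem intervalIntegrable_abs_sin_rpow {r : ℝ} (h0 : 0 ≤ r) (h1 : r < 1) (a b : ℝ) :
    IntervalIntegrable (fun u => |Real.sin u| ^ (-r)) volume a b := by
  have hpi := Real.pi_pos
  have hper : Function.Periodic (fun u => |Real.sin u| ^ (-r)) Real.pi := fun u => by
    simp only [Real.sin_add_pi, abs_neg]
  have hmeas : Measurable fun u => |Real.sin u| ^ (-r) :=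
    (Real.measurable_sin.abs).pow_const _
  have hpos : IntervalIntegrable (fun u => |Real.sin u| ^ (-r)) volume 0 (Real.pi / 2) := by
    have h2 : IntervalIntegrable (fun u : ℝ => (2 / Real.pi) ^ (-r) * u ^ (-r)) volume 0
        (Real.pi / 2) := (intervalIntegral.intervalIntegrable_rpow' (by linarith)).const_mul _
    refine h2.mono_fun' hmeas.aestronglyMeasurable ?_
    refine (ae_restrict_iff' measurableSet_uIoc).2 (Eventually.of_forall fun u hu => ?_)
    rw [Set.uIoc_of_le (by positivity)] at hu
    simp only
    rw [Real.norm_of_nonneg (Real.rpow_nonneg (abs_nonneg _) _),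
      ← Real.mul_rpow (by positivity) hu.1.le]
    refine Real.rpow_le_rpow_of_nonpos (mul_pos (by positivity) hu.1) ?_ (by linarith)
    exact (Real.mul_le_sin hu.1.le hu.2).trans (le_abs_self _)
  have hneg : IntervalIntegrable (fun u => |Real.sin u| ^ (-r)) volume (-(Real.pi / 2)) 0 := by
    rw [IntervalIntegrable.iff_comp_neg]
    simpa using hpos.symm
  refine hper.intervalIntegrable hpi.ne' (t := -(Real.pi / 2)) ?_ a b
  have : -(Real.pi / 2) + Real.pi = Real.pi / 2 := by ring
  rw [this]
  exact hneg.trans hpos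

theorem intervalIntegrable_abs_sin_add {r : ℝ} (h0 : 0 ≤ r) (h1 : r < 1) (φ a b : ℝ) :
    IntervalIntegrable (fun u => |Real.sin (u + φ)| ^ (-r)) volume a b := by
  have := (intervalIntegrable_abs_sin_rpow h0 h1 (a + φ) (b + φ)).comp_add_right φ
  simpa using this

theorem intervalIntegrable_abs_sin_half {r : ℝ} (h0 : 0 ≤ r) (h1 : r < 1) (φ a b : ℝ) :
    IntervalIntegrable (fun u => |Real.sin (u / 2 + φ)| ^ (-r)) volume a b := by
  have := (intervalIntegrable_abs_sin_add h0 h1 φ (a / 2) (b / 2)).comp_mul_left (c := 1 / 2)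
  convert this using 1
  · funext u; congr 4; ring
  · ring
  · ring

theorem ae_sin_add_ne_zero (φ : ℝ) : ∀ᵐ u : ℝ, Real.sin (u + φ) ≠ 0 := by
  have hc : (Set.range fun k : ℤ => (k : ℝ) * Real.pi - φ).Countable := Set.countable_range _
  filter_upwards [hc.ae_notMem volume] with u hu h
  obtain ⟨k, hk⟩ := Real.sin_eq_zero_iff.1 h
  exact hu ⟨k, by simp only; linarith⟩

theorem ae_sin_half_ne_zero (φ : ℝ) : ∀ᵐ u : ℝ, Real.sin (u / 2 + φ) ≠ 0 := by
  have hc : (Set.range fun k : ℤ => 2 * ((k : ℝ) * Real.pi - φ)).Countable :=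
    Set.countable_range _
  filter_upwards [hc.ae_notMem volume] with u hu h
  obtain ⟨k, hk⟩ := Real.sin_eq_zero_iff.1 h
  exact hu ⟨k, by simp only; linarith⟩

/-- The length measure on the interval of angles. -/
noncomputable abbrev angleMeasure : Measure ℝ := volume.restrict (Set.Icc 0 (2 * Real.pi))

theorem integrable_angleMeasure_iff {E : Type*} [NormedAddCommGroup E] {f : ℝ → E} :
    Integrable f angleMeasure ↔ IntervalIntegrable f volume 0 (2 * Real.pi) :=
  (intervalIntegrable_iff_integrableOn_Icc_of_le (by positivity)).symm

theorem integral_angleMeasure {E : Type*} [NormedAddCommGroup E] [NormedSpace ℝ E] (f : ℝ → E) :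
    ∫ θ, f θ ∂angleMeasure = ∫ θ in (0 : ℝ)..2 * Real.pi, f θ := by
  rw [intervalIntegral.integral_of_le (by positivity), integral_Icc_eq_integral_Ioc]

/-- The point of the unit circle with angle `θ`. -/
noncomputable def anglePt (θ : ℝ) : ℂ := circlePt (θ / (2 * Real.pi))

theorem norm_anglePt (θ : ℝ) : ‖anglePt θ‖ = 1 := norm_circlePt _

theorem continuous_anglePt : Continuous anglePt := continuous_circlePt.comp (by fun_prop)

theorem anglePt_eq (θ : ℝ) : anglePt θ = Complex.exp (θ * Complex.I) := by
  have : (Real.pi : ℂ) ≠ 0 := by exact_mod_cast Real.pi_ne_zero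
  rw [anglePt, circlePt]
  congr 1
  push_cast
  field_simp

theorem anglePt_re (θ : ℝ) : (anglePt θ).re = Real.cos θ := by
  rw [anglePt_eq, Complex.exp_ofReal_mul_I_re]

theorem integral_anglePt (F : ℂ → ℂ) :
    ∫ θ, F (anglePt θ) ∂angleMeasure = 2 * Real.pi * ∫ x in (0 : ℝ)..1, F (circlePt x) := by
  have hpi : (2 * Real.pi) ≠ 0 := by positivity
  rw [integral_angleMeasure]
  unfold anglePt
  rw [intervalIntegral.integral_comp_div (fun x => F (circlePt x)) hpi, zero_div, div_self hpi,
    Complex.real_smul]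
  push_cast
  rfl

/-- A linear function on the circle is bounded below by the distance to its closest approach
to zero. -/
theorem exists_sin_le_norm (A B : ℂ) :
    ∃ φ : ℝ, ∀ θ, max ‖A‖ ‖B‖ * |Real.sin (θ + φ)| ≤ ‖A + B * anglePt θ‖ := by
  refine ⟨B.arg - A.arg, fun θ => ?_⟩
  set ψ := θ + (B.arg - A.arg) with hψ
  have hA := Complex.norm_mul_exp_arg_mul_I A
  have hB := Complex.norm_mul_exp_arg_mul_I B
  have h1 : A + B * anglePt θ = Complex.exp (A.arg * Complex.I) *
      (‖A‖ + ‖B‖ * Complex.exp (ψ * Complex.I)) := by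
    have h2 : Complex.exp (A.arg * Complex.I) * Complex.exp (ψ * Complex.I) =
        Complex.exp (B.arg * Complex.I) * Complex.exp (θ * Complex.I) := by
      rw [← Complex.exp_add, ← Complex.exp_add]
      congr 1
      rw [hψ]
      push_cast
      ring
    rw [anglePt_eq]
    conv_lhs => rw [← hA, ← hB]
    linear_combination -(‖B‖ : ℂ) * h2
  have h2 : ‖A + B * anglePt θ‖ = ‖(‖A‖ : ℂ) + ‖B‖ * Complex.exp (ψ * Complex.I)‖ := by
    rw [h1, norm_mul, Complex.norm_exp_ofReal_mul_I, one_mul]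
  have e1 : ‖B‖ * |Real.sin ψ| ≤ ‖A + B * anglePt θ‖ := by
    rw [h2]
    refine le_trans (le_of_eq ?_) (Complex.abs_im_le_norm _)
    rw [Complex.add_im, Complex.ofReal_im, zero_add, Complex.im_ofReal_mul,
      Complex.exp_ofReal_mul_I_im, abs_mul, abs_of_nonneg (norm_nonneg _)]
  have e2 : ‖A‖ * |Real.sin ψ| ≤ ‖A + B * anglePt θ‖ := by
    have h3 : ‖A + B * anglePt θ‖ = ‖(‖A‖ : ℂ) * Complex.exp ((-ψ : ℝ) * Complex.I) + ‖B‖‖ := by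
      have h4 : (‖A‖ : ℂ) * Complex.exp ((-ψ : ℝ) * Complex.I) + ‖B‖ =
          Complex.exp ((-ψ : ℝ) * Complex.I) *
            ((‖A‖ : ℂ) + ‖B‖ * Complex.exp (ψ * Complex.I)) := by
        have h5 : Complex.exp ((-ψ : ℝ) * Complex.I) * Complex.exp (ψ * Complex.I) = 1 := by
          rw [← Complex.exp_add, ← Complex.exp_zero]
          congr 1
          push_cast
          ring
        linear_combination -(‖B‖ : ℂ) * h5
      rw [h4, norm_mul, Complex.norm_exp_ofReal_mul_I, one_mul, h2]
    rw [h3]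
    refine le_trans (le_of_eq ?_) (Complex.abs_im_le_norm _)
    rw [Complex.add_im, Complex.ofReal_im, add_zero, Complex.im_ofReal_mul,
      Complex.exp_ofReal_mul_I_im, abs_mul, abs_of_nonneg (norm_nonneg _), Real.sin_neg, abs_neg]
  rcases max_choice ‖A‖ ‖B‖ with h | h <;> rw [h] <;> assumption

/-- Interpolation between two lower bounds. The exponents are such that `d ^ (-1 / 4)` is
integrable when `d` has a double zero, and `s ^ (-3 / 4)` when `s` has a simple zero. -/
theorem inv_le_rpow_mul_rpow {X d s : ℝ} (hd : 0 < d) (hs : 0 < s) (hdX : d ≤ X) (hsX : s ≤ X) :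
    X⁻¹ ≤ d ^ (-(1 / 4) : ℝ) * s ^ (-(3 / 4) : ℝ) := by
  have hX : 0 < X := hd.trans_le hdX
  have h1 : X⁻¹ = X ^ (-(1 / 4) : ℝ) * X ^ (-(3 / 4) : ℝ) := by
    rw [← Real.rpow_add hX, ← Real.rpow_neg_one]
    norm_num
  rw [h1]
  exact mul_le_mul (Real.rpow_le_rpow_of_nonpos hd hdX (by norm_num))
    (Real.rpow_le_rpow_of_nonpos hs hsX (by norm_num)) (Real.rpow_nonneg hX.le _)
    (Real.rpow_nonneg hd.le _)

/-- The integral of `1 / |A + B z|` over the circle is at most of the order of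
`| |A| - |B| | ^ (-1 / 4)`. -/
theorem integral_inv_linear_le {A B : ℂ} (h : ‖A‖ ≠ ‖B‖) :
    ∫ θ, ‖A + B * anglePt θ‖⁻¹ ∂angleMeasure ≤
      |‖A‖ - ‖B‖| ^ (-(1 / 4) : ℝ) * max ‖A‖ ‖B‖ ^ (-(3 / 4) : ℝ) *
        ∫ θ, |Real.sin θ| ^ (-(3 / 4) : ℝ) ∂angleMeasure := by
  obtain ⟨φ, hφ⟩ := exists_sin_le_norm A B
  have hd : 0 < |‖A‖ - ‖B‖| := abs_pos.2 (sub_ne_zero.2 h)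
  have hm : 0 < max ‖A‖ ‖B‖ := by
    rcases lt_or_gt_of_ne h with h | h
    · exact lt_max_of_lt_right ((norm_nonneg _).trans_lt h)
    · exact lt_max_of_lt_left ((norm_nonneg _).trans_lt h)
  have hdX : ∀ θ, |‖A‖ - ‖B‖| ≤ ‖A + B * anglePt θ‖ := by
    intro θ
    have h1 := abs_norm_sub_norm_le A (-(B * anglePt θ))
    rwa [norm_neg, norm_mul, norm_anglePt, mul_one, sub_neg_eq_add] at h1
  have hint : Integrable (fun θ => |Real.sin (θ + φ)| ^ (-(3 / 4) : ℝ)) angleMeasure :=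
    integrable_angleMeasure_iff.2
      (intervalIntegrable_abs_sin_add (by norm_num) (by norm_num) φ _ _)
  have hshift : ∫ θ, |Real.sin (θ + φ)| ^ (-(3 / 4) : ℝ) ∂angleMeasure =
      ∫ θ, |Real.sin θ| ^ (-(3 / 4) : ℝ) ∂angleMeasure := by
    have hper : Function.Periodic (fun u => |Real.sin u| ^ (-(3 / 4) : ℝ)) (2 * Real.pi) :=
      fun u => by simp only [Real.sin_add_two_pi]
    rw [integral_angleMeasure, integral_angleMeasure,
      intervalIntegral.integral_comp_add_right (fun u => |Real.sin u| ^ (-(3 / 4) : ℝ)),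
      zero_add, add_comm _ φ, hper.intervalIntegral_add_eq φ 0, zero_add]
  rw [← hshift, ← integral_const_mul]
  refine integral_mono_of_nonneg (Eventually.of_forall fun θ => inv_nonneg.2 (norm_nonneg _))
    (hint.const_mul _) ?_
  filter_upwards [ae_restrict_of_ae (ae_sin_add_ne_zero φ)] with θ hθ
  have h1 := inv_le_rpow_mul_rpow hd (mul_pos hm (abs_pos.2 hθ)) (hdX θ) (hφ θ)
  rwa [Real.mul_rpow hm.le (abs_nonneg _), ← mul_assoc] at h1

theorem measurable_symbolDet_inv (α β γ : ℝ) (p q : ℕ) :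
    Measurable fun x : ℝ × ℝ => anglePt x.1 ^ p * anglePt x.2 ^ q /
      symbolDet α β γ γ (anglePt x.1) (anglePt x.2) := by
  have h1 : Continuous fun x : ℝ × ℝ => anglePt x.1 := continuous_anglePt.comp continuous_fst
  have h2 : Continuous fun x : ℝ × ℝ => anglePt x.2 := continuous_anglePt.comp continuous_snd
  refine Measurable.div ((h1.pow p).mul (h2.pow q)).measurable (Continuous.measurable ?_)
  unfold symbolDet
  fun_prop

/-- For `|μ| > κ`, where `κ cos θ + μ` has no zero, the truncation of `arccos` replaces it by the
smaller function with a double zero at `0` or `π`. -/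
theorem abs_add_cos_ge {κ μ : ℝ} (hκ : 0 < κ) (θ : ℝ) :
    κ * |Real.cos θ - Real.cos (Real.arccos (-μ / κ))| ≤ |κ * Real.cos θ + μ| := by
  have h0 : κ * Real.cos θ + μ = κ * (Real.cos θ - -μ / κ) := by field_simp; ring
  rw [h0, abs_mul, abs_of_pos hκ]
  refine mul_le_mul_of_nonneg_left ?_ hκ.le
  have hc1 := Real.neg_one_le_cos θ
  have hc2 := Real.cos_le_one θ
  rcases le_or_gt (-μ / κ) (-1) with h | h
  · rw [Real.arccos_of_le_neg_one h, Real.cos_pi, abs_of_nonneg (by linarith),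
      abs_of_nonneg (by linarith)]
    linarith
  · rcases le_or_gt 1 (-μ / κ) with h' | h'
    · rw [Real.arccos_of_one_le h', Real.cos_zero, abs_of_nonpos (by linarith),
        abs_of_nonpos (by linarith)]
      linarith
    · rw [Real.cos_arccos h.le h'.le]

/-- The function `|κ cos θ + μ| ^ (-1 / 4)` is integrable, because the zeros of `κ cos θ + μ` are
at most double. -/
theorem integrable_abs_cos_rpow {κ : ℝ} (hκ : 0 < κ) (μ : ℝ) :
    Integrable (fun θ => |κ * Real.cos θ + μ| ^ (-(1 / 4) : ℝ)) angleMeasure := by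
  set θ₀ := Real.arccos (-μ / κ) with hθ₀
  have hp := intervalIntegrable_abs_sin_half (r := 1 / 2) (by norm_num) (by norm_num) (θ₀ / 2) 0
    (2 * Real.pi)
  have hm := intervalIntegrable_abs_sin_half (r := 1 / 2) (by norm_num) (by norm_num) (-(θ₀ / 2)) 0
    (2 * Real.pi)
  have hsum := ((integrable_angleMeasure_iff.2 (hp.add hm)).const_mul ((2 * κ) ^ (-(1 / 4) : ℝ)))
  refine hsum.mono' ?_ ?_
  · exact Measurable.aestronglyMeasurable
      (((Real.measurable_cos.const_mul κ).add_const μ).abs.pow_const _)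
  filter_upwards [ae_restrict_of_ae (ae_sin_half_ne_zero (θ₀ / 2)),
    ae_restrict_of_ae (ae_sin_half_ne_zero (-(θ₀ / 2)))] with θ h1 h2
  have s1 := abs_pos.2 h1
  have s2 := abs_pos.2 h2
  have h3 := abs_add_cos_ge (μ := μ) hκ θ
  rw [← hθ₀, Real.cos_sub_cos, abs_mul, abs_mul] at h3
  have h4 : |(-2 : ℝ)| = 2 := by norm_num
  have e1 : (θ + θ₀) / 2 = θ / 2 + θ₀ / 2 := by ring
  have e2 : (θ - θ₀) / 2 = θ / 2 + -(θ₀ / 2) := by ring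
  rw [h4, e1, e2] at h3
  rw [Real.norm_of_nonneg (Real.rpow_nonneg (abs_nonneg _) _)]
  set a := |Real.sin (θ / 2 + θ₀ / 2)|
  set b := |Real.sin (θ / 2 + -(θ₀ / 2))|
  have h5 : |κ * Real.cos θ + μ| ^ (-(1 / 4) : ℝ) ≤ (2 * κ * (a * b)) ^ (-(1 / 4) : ℝ) :=
    Real.rpow_le_rpow_of_nonpos (by positivity) (by linarith) (by norm_num)
  refine h5.trans ?_
  rw [Real.mul_rpow (by positivity) (by positivity), Real.mul_rpow s1.le s2.le]
  refine mul_le_mul_of_nonneg_left ?_ (Real.rpow_nonneg (by positivity) _)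
  have ha : a ^ (-(1 / 2) : ℝ) = (a ^ (-(1 / 4) : ℝ)) ^ 2 := by
    rw [← Real.rpow_natCast, ← Real.rpow_mul s1.le]; norm_num
  have hb : b ^ (-(1 / 2) : ℝ) = (b ^ (-(1 / 4) : ℝ)) ^ 2 := by
    rw [← Real.rpow_natCast, ← Real.rpow_mul s2.le]; norm_num
  rw [ha, hb]
  nlinarith [sq_nonneg (a ^ (-(1 / 4) : ℝ) - b ^ (-(1 / 4) : ℝ)),
    sq_nonneg (a ^ (-(1 / 4) : ℝ)), sq_nonneg (b ^ (-(1 / 4) : ℝ))]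

theorem ae_angle_norm_symbol_ne {α β γ : ℝ} (hα : 0 < α) (hβ : 0 < β) (hc : 0 < γ ^ 2 - α * β) :
    ∀ᵐ θ ∂angleMeasure, ‖symbolSlope α β γ (anglePt θ)‖ ≠ ‖symbolConst α (anglePt θ)‖ := by
  have hpi : (2 * Real.pi)⁻¹ ≠ 0 := by positivity
  have h1 : Measure.QuasiMeasurePreserving (fun θ : ℝ => θ / (2 * Real.pi)) volume volume := by
    refine ⟨by fun_prop, ?_⟩
    simp only [div_eq_mul_inv]
    rw [Real.map_volume_mul_right hpi]
    exact Measure.smul_absolutelyContinuous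
  exact ae_restrict_of_ae (h1.ae (ae_norm_symbol_ne hα hβ hc))

/-- The monomials divided by the characteristic polynomial are integrable on the two-dimensional
torus. -/
theorem integrable_div_symbolDet {α β γ : ℝ} (hα : 0 < α) (hβ : 0 < β)
    (hc : 0 < γ ^ 2 - α * β) (p q : ℕ) :
    Integrable (fun x : ℝ × ℝ => anglePt x.1 ^ p * anglePt x.2 ^ q /
      symbolDet α β γ γ (anglePt x.1) (anglePt x.2)) (angleMeasure.prod angleMeasure) := by
  have hmeas := (measurable_symbolDet_inv α β γ p q).aestronglyMeasurable
    (μ := angleMeasure.prod angleMeasure)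
  have hnorm : ∀ x y : ℝ, ‖anglePt x ^ p * anglePt y ^ q /
      symbolDet α β γ γ (anglePt x) (anglePt y)‖ =
      ‖symbolConst α (anglePt x) + symbolSlope α β γ (anglePt x) * anglePt y‖⁻¹ := by
    intro x y
    rw [norm_div, norm_mul, norm_pow, norm_pow, norm_anglePt, norm_anglePt, one_pow, one_pow,
      one_mul, symbolDet_eq, one_div]
  refine (integrable_prod_iff hmeas).2 ⟨?_, ?_⟩
  · filter_upwards [ae_angle_norm_symbol_ne hα hβ hc] with x hx
    set A := symbolConst α (anglePt x)
    set B := symbolSlope α β γ (anglePt x)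
    have hd : 0 < |‖A‖ - ‖B‖| := abs_pos.2 (sub_ne_zero.2 hx.symm)
    refine Integrable.mono' (integrable_const |‖A‖ - ‖B‖|⁻¹)
      ((measurable_symbolDet_inv α β γ p q).comp
        (measurable_const.prodMk measurable_id)).aestronglyMeasurable
      (Eventually.of_forall fun y => ?_)
    rw [hnorm]
    have h1 := abs_norm_sub_norm_le A (-(B * anglePt y))
    rw [norm_neg, norm_mul, norm_anglePt, mul_one, sub_neg_eq_add] at h1
    exact inv_anti₀ hd h1
  · simp only [hnorm]
    set κ := 2 * (α + β * (γ ^ 2 - α * β)) with hκ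
    set μ := 1 + α ^ 2 - β ^ 2 - (γ ^ 2 - α * β) ^ 2 with hμ
    have hκ0 : 0 < κ := by positivity
    set M := 1 + α + β + (γ ^ 2 - α * β) with hM
    have hM0 : 0 < M := by positivity
    set m := γ ^ 2 / (γ ^ 2 - α * β + α) with hm
    have hm0 : 0 < m := div_pos (by nlinarith) (by linarith)
    set K := ∫ θ, |Real.sin θ| ^ (-(3 / 4) : ℝ) ∂angleMeasure with hK
    have hK0 : 0 ≤ K := integral_nonneg fun θ => Real.rpow_nonneg (abs_nonneg _) _
    refine Integrable.mono' ((integrable_abs_cos_rpow hκ0 μ).const_mul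
      (M⁻¹ ^ (-(1 / 4) : ℝ) * m ^ (-(3 / 4) : ℝ) * K)) ?_ ?_
    · have h1 := hmeas.norm.integral_prod_right'
      simpa only [hnorm] using h1
    · filter_upwards [ae_angle_norm_symbol_ne hα hβ hc] with x hx
      rw [Real.norm_of_nonneg (integral_nonneg fun y => inv_nonneg.2 (norm_nonneg _))]
      refine (integral_inv_linear_le hx.symm).trans ?_
      have hz := norm_anglePt x
      have hA := norm_symbolConst_le hα hz
      have hB := norm_symbolSlope_le (α := α) (γ := γ) hβ hc hz
      have hmx := le_max_symbol (β := β) hα hc (anglePt x)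
      have hsq := normSq_symbol_sub α β γ hz
      rw [anglePt_re, ← hκ, ← hμ] at hsq
      rw [← hm] at hmx
      set a := ‖symbolConst α (anglePt x)‖
      set b := ‖symbolSlope α β γ (anglePt x)‖
      have hd : 0 < |a - b| := abs_pos.2 (sub_ne_zero.2 hx.symm)
      have ha0 : 0 ≤ a := norm_nonneg _
      have hb0 : 0 ≤ b := norm_nonneg _
      have h1 : M⁻¹ * |κ * Real.cos x + μ| ≤ |a - b| := by
        rw [← hsq, sq_sub_sq, abs_mul, abs_of_nonneg (add_nonneg ha0 hb0), inv_mul_le_iff₀ hM0]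
        exact mul_le_mul_of_nonneg_right (by linarith) (abs_nonneg _)
      have h2 : 0 < |κ * Real.cos x + μ| := by
        rw [← hsq, sq_sub_sq, abs_mul]
        refine mul_pos (abs_pos.2 ?_) hd
        intro h0
        have ha : a = 0 := by linarith
        have hb : b = 0 := by linarith
        rw [ha, hb, sub_self, abs_zero] at hd
        exact lt_irrefl _ hd
      have h3 : |a - b| ^ (-(1 / 4) : ℝ) ≤
          M⁻¹ ^ (-(1 / 4) : ℝ) * |κ * Real.cos x + μ| ^ (-(1 / 4) : ℝ) := by
        rw [← Real.mul_rpow (by positivity) h2.le]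
        exact Real.rpow_le_rpow_of_nonpos (by positivity) h1 (by norm_num)
      have h4 : max a b ^ (-(3 / 4) : ℝ) ≤ m ^ (-(3 / 4) : ℝ) :=
        Real.rpow_le_rpow_of_nonpos hm0 hmx (by norm_num)
      calc |a - b| ^ (-(1 / 4) : ℝ) * max a b ^ (-(3 / 4) : ℝ) * K ≤
            M⁻¹ ^ (-(1 / 4) : ℝ) * |κ * Real.cos x + μ| ^ (-(1 / 4) : ℝ) *
              m ^ (-(3 / 4) : ℝ) * K := by
            refine mul_le_mul_of_nonneg_right (mul_le_mul h3 h4 ?_ ?_) hK0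
            · exact Real.rpow_nonneg (ha0.trans (le_max_left _ _)) _
            · exact mul_nonneg (Real.rpow_nonneg (inv_nonneg.2 hM0.le) _)
                (Real.rpow_nonneg (abs_nonneg _) _)
        _ = _ := by ring

/-- The moments of the inverse characteristic polynomial as integrals over the torus. -/
theorem integral_div_symbolDet {α β γ : ℝ} (hα : 0 < α) (hβ : 0 < β)
    (hc : 0 < γ ^ 2 - α * β) (p q : ℕ) :
    ∫ x : ℝ × ℝ, anglePt x.1 ^ p * anglePt x.2 ^ q /
      symbolDet α β γ γ (anglePt x.1) (anglePt x.2) ∂(angleMeasure.prod angleMeasure) =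
      (2 * Real.pi) ^ 2 * symbolMoment α β γ p q := by
  rw [integral_prod _ (integrable_div_symbolDet hα hβ hc p q)]
  have h1 : ∀ᵐ x ∂angleMeasure, ∫ y, anglePt x ^ p * anglePt y ^ q /
      symbolDet α β γ γ (anglePt x) (anglePt y) ∂angleMeasure =
      2 * Real.pi * (anglePt x ^ (p : ℤ) *
        circleAvg q (symbolConst α (anglePt x)) (symbolSlope α β γ (anglePt x))) := by
    filter_upwards [ae_angle_norm_symbol_ne hα hβ hc] with x hx
    have h2 := integral_anglePt (fun z => anglePt x ^ p * z ^ q /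
      symbolDet α β γ γ (anglePt x) z)
    rw [h2, ← integral_zpow_div hx]
    congr 1
    rw [← intervalIntegral.integral_const_mul]
    refine intervalIntegral.integral_congr fun y _ => ?_
    simp only [symbolDet_eq, zpow_natCast]
    ring
  rw [integral_congr_ae h1, integral_const_mul, symbolMoment]
  have h3 := integral_anglePt (fun z => z ^ (p : ℤ) *
    circleAvg q (symbolConst α z) (symbolSlope α β γ z))
  rw [h3]
  ring

/-! ### The single-vertex integrals -/

/-- Four angles as two pairs of angles. -/
def anglesEquiv : (ℝ × ℝ) × (ℝ × ℝ) ≃ᵐ (Fin 4 → ℝ) where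
  toFun x := ![x.1.1, x.1.2, x.2.1, x.2.2]
  invFun θ := ((θ 0, θ 1), (θ 2, θ 3))
  left_inv _ := rfl
  right_inv θ := by
    funext i
    fin_cases i <;> rfl
  measurable_toFun := by
    refine measurable_pi_iff.2 fun i => ?_
    fin_cases i
    · exact measurable_fst.fst
    · exact measurable_fst.snd
    · exact measurable_snd.fst
    · exact measurable_snd.snd
  measurable_invFun := by
    refine Measurable.prodMk (Measurable.prodMk ?_ ?_) (Measurable.prodMk ?_ ?_) <;>
    exact measurable_pi_apply _

theorem anglesEquiv_apply (x : (ℝ × ℝ) × (ℝ × ℝ)) :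
    anglesEquiv x = ![x.1.1, x.1.2, x.2.1, x.2.2] := rfl

theorem measurePreserving_anglesEquiv :
    MeasurePreserving anglesEquiv
      ((angleMeasure.prod angleMeasure).prod (angleMeasure.prod angleMeasure))
      (volume.restrict (Set.Icc (0 : Fin 4 → ℝ) fun _ => 2 * Real.pi)) := by
  refine ⟨anglesEquiv.measurable, ?_⟩
  have h1 : Set.Icc (0 : Fin 4 → ℝ) (fun _ => 2 * Real.pi) =
      Set.univ.pi fun _ => Set.Icc (0 : ℝ) (2 * Real.pi) := (Set.pi_univ_Icc _ _).symm
  rw [h1, volume_pi, Measure.restrict_pi_pi]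
  refine (Measure.pi_eq fun s hs => ?_).symm
  rw [anglesEquiv.map_apply]
  have h2 : anglesEquiv ⁻¹' (Set.univ.pi s) = (s 0 ×ˢ s 1) ×ˢ (s 2 ×ˢ s 3) := by
    ext x
    simp only [Set.mem_preimage, Set.mem_univ_pi, Fin.forall_fin_succ, Set.mem_prod]
    simp [anglesEquiv_apply, and_assoc]
  rw [h2, Measure.prod_prod, Measure.prod_prod, Measure.prod_prod, Fin.prod_univ_four, mul_assoc,
    mul_assoc, mul_assoc]

theorem charPoly_eq_symbolDet (α β γ : ℝ) (z₁ z₂ : ℂ) :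
    charPoly α β γ z₁ z₂ = symbolDet α β γ γ z₁ z₂ := by
  unfold charPoly symbolDet
  ring

/-- A linear combination of two monomials divided by the characteristic polynomial. -/
noncomputable def binomialQuotient (α β γ : ℝ) (p q p' q' : ℕ) (k : ℂ) (x : ℝ × ℝ) : ℂ :=
  anglePt x.1 ^ p * anglePt x.2 ^ q / symbolDet α β γ γ (anglePt x.1) (anglePt x.2) +
    k * (anglePt x.1 ^ p' * anglePt x.2 ^ q' / symbolDet α β γ γ (anglePt x.1) (anglePt x.2))

/-- The ratio of `f_t(w)` and `Δ(w₁, w₂) Δ(u₁, u₂)` on the torus. -/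
noncomputable def vertexQuotient (α β γ : ℝ) (t : VertexType) (x : (ℝ × ℝ) × (ℝ × ℝ)) : ℂ :=
  vertexPoly α β γ t (anglePt x.1.1) (anglePt x.1.2) (anglePt x.2.1) (anglePt x.2.2) /
    (charPoly α β γ (anglePt x.1.1) (anglePt x.1.2) *
      charPoly α β γ (anglePt x.2.1) (anglePt x.2.2))

theorem integrable_binomialQuotient {α β γ : ℝ} (hα : 0 < α) (hβ : 0 < β)
    (hc : 0 < γ ^ 2 - α * β) (p q p' q' : ℕ) (k : ℂ) :
    Integrable (binomialQuotient α β γ p q p' q' k) (angleMeasure.prod angleMeasure) :=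
  (integrable_div_symbolDet hα hβ hc p q).add
    ((integrable_div_symbolDet hα hβ hc p' q').const_mul k)

theorem integral_binomialQuotient {α β γ : ℝ} (hα : 0 < α) (hβ : 0 < β)
    (hc : 0 < γ ^ 2 - α * β) (p q p' q' : ℕ) (k : ℂ) :
    ∫ x, binomialQuotient α β γ p q p' q' k x ∂(angleMeasure.prod angleMeasure) =
      (2 * Real.pi) ^ 2 * (symbolMoment α β γ p q + k * symbolMoment α β γ p' q') := by
  unfold binomialQuotient
  rw [integral_add (integrable_div_symbolDet hα hβ hc p q)
    ((integrable_div_symbolDet hα hβ hc p' q').const_mul k), integral_const_mul,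
    integral_div_symbolDet hα hβ hc, integral_div_symbolDet hα hβ hc]
  ring

/-- The integral of a difference of two products of functions of separate variables. -/
theorem integrable_two_products {P₁ P₂ P₃ P₄ : ℝ × ℝ → ℂ}
    (h₁ : Integrable P₁ (angleMeasure.prod angleMeasure))
    (h₂ : Integrable P₂ (angleMeasure.prod angleMeasure))
    (h₃ : Integrable P₃ (angleMeasure.prod angleMeasure))
    (h₄ : Integrable P₄ (angleMeasure.prod angleMeasure)) (k k' : ℂ)
    {F : (ℝ × ℝ) × (ℝ × ℝ) → ℂ}
    (hF : ∀ x, F x = k * (P₁ x.1 * P₂ x.2) - k' * (P₃ x.1 * P₄ x.2)) {I : ℂ}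
    (hI : k * ((∫ x, P₁ x ∂(angleMeasure.prod angleMeasure)) *
        ∫ x, P₂ x ∂(angleMeasure.prod angleMeasure)) -
      k' * ((∫ x, P₃ x ∂(angleMeasure.prod angleMeasure)) *
        ∫ x, P₄ x ∂(angleMeasure.prod angleMeasure)) = I) :
    Integrable F ((angleMeasure.prod angleMeasure).prod (angleMeasure.prod angleMeasure)) ∧
      ∫ x, F x ∂((angleMeasure.prod angleMeasure).prod (angleMeasure.prod angleMeasure)) = I := by
  have e : F = fun x => k * (P₁ x.1 * P₂ x.2) - k' * (P₃ x.1 * P₄ x.2) := funext hF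
  have i₁ := (h₁.mul_prod h₂).const_mul k
  have i₂ := (h₃.mul_prod h₄).const_mul k'
  rw [e]
  refine ⟨i₁.sub i₂, ?_⟩
  rw [integral_sub i₁ i₂, integral_const_mul, integral_const_mul, integral_prod_mul,
    integral_prod_mul, hI]

/-- The polynomials `f_t` are differences of two products, each of a function of `w₁, w₂` and a
function of `u₁, u₂`, so that the integral is a polynomial in the moments. -/
theorem integrable_integral_vertexQuotient {α β γ : ℝ} (hα : 0 < α) (hβ : 0 < β)
    (hc : 0 < γ ^ 2 - α * β) (t : VertexType) :
    Integrable (vertexQuotient α β γ t)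
        ((angleMeasure.prod angleMeasure).prod (angleMeasure.prod angleMeasure)) ∧
      ∫ x, vertexQuotient α β γ t x
        ∂((angleMeasure.prod angleMeasure).prod (angleMeasure.prod angleMeasure)) =
        (2 * Real.pi) ^ 4 * typeProb α β γ t := by
  have hi := fun p q p' q' k => integrable_binomialQuotient hα hβ hc p q p' q' k
  cases t
  · refine integrable_two_products (hi 0 0 0 1 β) (hi 0 0 1 0 α) (hi 1 0 0 0 0) (hi 0 1 0 0 0)
      1 (γ ^ 2) (fun x => ?_) ?_
    · simp only [vertexQuotient, vertexPoly, charPoly_eq_symbolDet, binomialQuotient]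
      ring
    · simp only [integral_binomialQuotient hα hβ hc, typeProb, Nat.cast_zero, Nat.cast_one]
      ring
  · refine integrable_two_products (hi 1 1 0 0 0) (hi 1 1 0 0 0) (hi 1 0 1 1 β) (hi 0 1 1 1 α)
      ((γ ^ 2 - α * β) * γ ^ 2) (γ ^ 2 - α * β) (fun x => ?_) ?_
    · simp only [vertexQuotient, vertexPoly, charPoly_eq_symbolDet, binomialQuotient]
      ring
    · simp only [integral_binomialQuotient hα hβ hc, typeProb, Nat.cast_zero, Nat.cast_one]
      ring
  · refine integrable_two_products (hi 0 0 0 1 β) (hi 0 1 1 1 α) (hi 1 1 0 0 0) (hi 0 1 0 0 0)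
      β (β * γ ^ 2) (fun x => ?_) ?_
    · simp only [vertexQuotient, vertexPoly, charPoly_eq_symbolDet, binomialQuotient]
      ring
    · simp only [integral_binomialQuotient hα hβ hc, typeProb, Nat.cast_zero, Nat.cast_one]
      ring
  · refine integrable_two_products (hi 1 0 1 1 β) (hi 0 0 1 0 α) (hi 1 0 0 0 0) (hi 1 1 0 0 0)
      α (α * γ ^ 2) (fun x => ?_) ?_
    · simp only [vertexQuotient, vertexPoly, charPoly_eq_symbolDet, binomialQuotient]
      ring
    · simp only [integral_binomialQuotient hα hβ hc, typeProb, Nat.cast_zero, Nat.cast_one]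
      ring
  · refine integrable_two_products (hi 1 0 1 1 β) (hi 0 1 0 0 0) (hi 0 0 0 1 β) (hi 1 1 0 0 0)
      (γ ^ 2) (γ ^ 2) (fun x => ?_) ?_
    · simp only [vertexQuotient, vertexPoly, charPoly_eq_symbolDet, binomialQuotient]
      ring
    · simp only [integral_binomialQuotient hα hβ hc, typeProb, Nat.cast_zero, Nat.cast_one]
      ring
  · refine integrable_two_products (hi 1 0 0 0 0) (hi 0 1 1 1 α) (hi 1 1 0 0 0) (hi 0 0 1 0 α)
      (γ ^ 2) (γ ^ 2) (fun x => ?_) ?_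
    · simp only [vertexQuotient, vertexPoly, charPoly_eq_symbolDet, binomialQuotient]
      ring
    · simp only [integral_binomialQuotient hα hβ hc, typeProb, Nat.cast_zero, Nat.cast_one]
      ring

theorem torusMap_anglesEquiv (x : (ℝ × ℝ) × (ℝ × ℝ)) :
    torusMap 0 (fun _ => 1) (anglesEquiv x) =
      ![anglePt x.1.1, anglePt x.1.2, anglePt x.2.1, anglePt x.2.2] := by
  funext i
  fin_cases i <;> simp [torusMap, anglesEquiv_apply, anglePt_eq]

theorem vertexIntegrand_anglesEquiv (α β γ : ℝ) (t : VertexType) (x : (ℝ × ℝ) × (ℝ × ℝ)) :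
    vertexIntegrand α β γ t (torusMap 0 (fun _ => 1) (anglesEquiv x)) =
      (1 / (2 * Real.pi * Complex.I)) ^ 4 * (anglePt x.1.1 * anglePt x.1.2 *
        anglePt x.2.1 * anglePt x.2.2)⁻¹ * vertexQuotient α β γ t x := by
  rw [torusMap_anglesEquiv, vertexIntegrand, Fin.prod_univ_four]
  simp only [Matrix.cons_val, vertexQuotient]
  ring

theorem torusIntegrable_vertexIntegrand {α β γ : ℝ} (hα : 0 < α) (hβ : 0 < β)
    (hc : 0 < γ ^ 2 - α * β) (t : VertexType) :
    TorusIntegrable (vertexIntegrand α β γ t) 0 (fun _ => 1) := by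
  unfold TorusIntegrable IntegrableOn
  rw [← measurePreserving_anglesEquiv.integrable_comp_emb anglesEquiv.measurableEmbedding]
  have h1 := (integrable_integral_vertexQuotient hα hβ hc t).1
  have h2 : (fun θ => vertexIntegrand α β γ t (torusMap 0 (fun _ => 1) θ)) ∘ anglesEquiv =
      fun x => (1 / (2 * Real.pi * Complex.I)) ^ 4 * (anglePt x.1.1 * anglePt x.1.2 *
        anglePt x.2.1 * anglePt x.2.2)⁻¹ * vertexQuotient α β γ t x :=
    funext fun x => vertexIntegrand_anglesEquiv α β γ t x
  rw [h2]
  refine h1.bdd_mul (c := ‖(1 / (2 * Real.pi * Complex.I)) ^ 4‖) ?_ (Eventually.of_forall ?_)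
  · have hm := continuous_anglePt.measurable
    exact ((((hm.comp measurable_fst.fst).mul (hm.comp measurable_fst.snd)).mul
      (hm.comp measurable_snd.fst)).mul
        (hm.comp measurable_snd.snd)).inv.const_mul _ |>.aestronglyMeasurable
  · intro x
    rw [norm_mul, norm_inv, norm_mul, norm_mul, norm_mul, norm_anglePt, norm_anglePt, norm_anglePt,
      norm_anglePt]
    simp

theorem torusIntegral_vertexIntegrand {α β γ : ℝ} (hα : 0 < α) (hβ : 0 < β)
    (hc : 0 < γ ^ 2 - α * β) (t : VertexType) :
    torusIntegral (vertexIntegrand α β γ t) 0 (fun _ => 1) = typeProb α β γ t := by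
  unfold torusIntegral
  rw [← measurePreserving_anglesEquiv.integral_comp anglesEquiv.measurableEmbedding]
  have hpi : (Real.pi : ℂ) ≠ 0 := by exact_mod_cast Real.pi_ne_zero
  have h1 : ∀ x, (∏ i, (((1 : ℝ) : ℂ) * Complex.exp (anglesEquiv x i * Complex.I) * Complex.I)) •
      vertexIntegrand α β γ t (torusMap 0 (fun _ => 1) (anglesEquiv x)) =
      (1 / (2 * Real.pi)) ^ 4 * vertexQuotient α β γ t x := by
    intro x
    have hne : ∀ θ, anglePt θ ≠ 0 := fun θ => by
      rw [← norm_ne_zero_iff, norm_anglePt]; exact one_ne_zero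
    have n1 := hne x.1.1
    have n2 := hne x.1.2
    have n3 := hne x.2.1
    have n4 := hne x.2.2
    rw [vertexIntegrand_anglesEquiv, Fin.prod_univ_four, ← anglePt_eq, ← anglePt_eq, ← anglePt_eq,
      ← anglePt_eq, smul_eq_mul]
    have e : (anglesEquiv x 0 = x.1.1 ∧ anglesEquiv x 1 = x.1.2) ∧
        (anglesEquiv x 2 = x.2.1 ∧ anglesEquiv x 3 = x.2.2) := ⟨⟨rfl, rfl⟩, rfl, rfl⟩
    rw [e.1.1, e.1.2, e.2.1, e.2.2]
    have hI := Complex.I_ne_zero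
    push_cast
    field_simp
  simp only [h1]
  rw [integral_const_mul, (integrable_integral_vertexQuotient hα hβ hc t).2]
  field_simp

end SixVertex

theorem theorem1p2 (α β γ : ℝ) (hα : 0 < α) (hβ : 0 < β) (hγ : 0 < γ)
    (hαβγ : 0 < γ ^ 2 - α * β) :
    (∃! P : Measure (SixVertex.Config ℤ),
      SixVertex.IsSixVertexLaw (SixVertex.freeFermionWeight α β γ) P) ∧
    (∀ P : Measure (SixVertex.Config ℤ),
      SixVertex.IsSixVertexLaw (SixVertex.freeFermionWeight α β γ) P →
      ∀ (v : ℤ × ℤ) (t : SixVertex.VertexType),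
        TorusIntegrable (SixVertex.vertexIntegrand α β γ t) 0 (fun _ => 1) ∧
        ((P.real {σ | SixVertex.vertexType σ v = t} : ℝ) : ℂ) =
          torusIntegral (SixVertex.vertexIntegrand α β γ t) 0 (fun _ => 1)) ∧
    (∀ w₁ w₂ u₁ u₂ : ℂ,
      ∑ t : SixVertex.VertexType, SixVertex.vertexPoly α β γ t w₁ w₂ u₁ u₂ =
        SixVertex.charPoly α β γ w₁ w₂ * SixVertex.charPoly α β γ u₁ u₂) := by
  refine ⟨?_, fun P hP v t => ⟨?_, ?_⟩, fun w₁ w₂ u₁ u₂ => ?_⟩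
  · obtain ⟨P, hP⟩ := SixVertex.exists_law (SixVertex.freeFermionWeight_pos hα hβ hγ hαβγ)
      (SixVertex.exists_tendsto_boltzmann hα hβ hγ hαβγ)
    exact ⟨P, hP, fun Q hQ => SixVertex.law_unique hQ hP⟩
  · exact SixVertex.torusIntegrable_vertexIntegrand hα hβ hαβγ t
  · rw [SixVertex.torusIntegral_vertexIntegrand hα hβ hαβγ t]
    have h1 := hP.2 {v} fun _ => t
    simp only [Finset.mem_singleton, forall_eq] at h1
    exact tendsto_nhds_unique ((Complex.continuous_ofReal.tendsto _).comp h1)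
      (SixVertex.tendsto_boltzmann_vertexType hα hβ hγ hαβγ v t)
  · rw [SixVertex.sum_vertexType]
    simp only [SixVertex.vertexPoly, SixVertex.charPoly]
    ring
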